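/- **Setting.** Let $V$ be a separable reflexive real Banach space, densely and continuously injected in a separable real Hilbert space $H$; identify $H$ with its dual, so that $V\subset H\cong H^*\subset V^*$. Let $\mathbb X$ be a locally compact Polish space, $\nu$ a Borel measure on $\mathbb X$ that is finite on compact sets, $T>0$, $\lambda_T$ Lebesgue measure on $[0,T]$, $\mathbb X_T=[0,T]\times\mathbb X$, $\nu_T=\lambda_T\otimes\nu$, and $x\in H$. Let $\mathcal A:[0,T]\times V\to V^*$ and $f:[0,T]\times V\times\mathbb X\to H$ be Borel measurable. Assume that there are constants $\alpha>1$, $\beta\ge 0$, $\theta>0$, $C>0$, nonnegative $K,F\in L^1([0,T])$ and a measurable $\rho:V\to[0,\infty)$, bounded on balls, with $\rho(v)\le C(1+\|v\|_V^\alpha)(1+\|v\|_H^\beta)$, such that for all $t\in[0,T]$, $z\in\mathbb X$ and $v,v_1,v_2\in V$: * (H1) $s\mapsto\langle\mathcal A(t,v_1+sv_2),v\rangle_{V^*,V}$ is continuous on $\mathbb R$; * (H2) $2\langle\mathcal A(t,v_1)-\mathcal A(t,v_2),v_1-v_2\rangle_{V^*,V}+\int_{\mathbb X}\|f(t,v_1,z)-f(t,v_2,z)\|_H^2\,\nu(dz)\le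 (K_t+\rho(v_2))\|v_1-v_2\|_H^2$, the integral being finite; * (H3) $2\langle\mathcal A(t,v),v\rangle_{V^*,V}+\theta\|v\|_V^\alpha\le F_t(1+\|v\|_H^2)$; * (H4) $\|\mathcal A(t,v)\|_{V^*}^{\alpha/(\alpha-1)}\le(F_t+C\|v\|_V^\alpha)(1+\|v\|_H^\beta)$; * (H5) there are $\eta_0>0$, $p\ge\Upsilon:=\max\{\frac{2\beta(\alpha-1)(\alpha+\eta_0)}{\alpha},\frac{4(\alpha-1)(\alpha+\eta_0)}{\alpha},4,\beta+2\}$ and $L_f\in L^2(\nu_T)\cap L^4(\nu_T)\cap L^{\beta+2}(\nu_T)\cap L^{\Upsilon}(\nu_T)\cap L^{\Upsilon/2}(\nu_T)\cap\mathcal H_p$ with $\|f(t,v,z)\|_H\le L_f(t,z)(1+\|v\|_H)$; * (H6) there is $G_f\in L^2(\nu_T)\cap\mathcal H_2$ with $\|f(t,v_1,z)-f(t,v_2,z)\|_H\le G_f(t,z)\|v_1-v_2\|_H$. Here $\mathcal H_p$ is the set of measurable $h:\mathbb X_T\to[0,\infty)$ for which there is $\delta>0$ with $\int_\Gamma e^{\delta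 h^p}\,d\nu_T<\infty$ for every measurable $\Gamma\subset\mathbb X_T$ with $\nu_T(\Gamma)<\infty$. For $N\in\mathbb N$ let $S^N$ be the set of measurable $g:\mathbb X_T\to[0,\infty)$ with $\int_{\mathbb X_T}(g\log g-g+1)\,d\nu_T\le N$, and let $\nu_T^g(A)=\int_A g\,d\nu_T$. Each $\nu^g_T$ is finite on compact sets, and $S^N$ carries the topology induced by $g\mapsto\nu_T^g$ from the vague topology (the weakest one making $m\mapsto\int\varphi\,dm$ continuous for every $\varphi\in C_c(\mathbb X_T)$). **Theorem.** (i) For every $N$ and $g\in S^N$ the skeleton equation $$X_t=x+\int_0^t\mathcal A(s,X_s)\,ds+\int_0^t\int_{\mathbb X}f(s,X_s,z)(g(s,z)-1)\,\nu(dz)\,ds\quad\text{in }V^*,\ t\in[0,T],$$ has a unique solution in $C([0,T],H)\cap L^\alpha([0,T],V)$, and it depends on $g$ only through $\nu_T^g$; call it $\mathcal G^0(\nu_T^g)$. (ii) For every $N\in\mathbb N$ and all $g_n,g\in S^N$ with $g_n\to g$ in $S^N$ as $n\to\infty$, $$\lim_{n\to\infty}\ \sup_{t\in[0,T]}\big\|\mathcal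 G^0(\nu_T^{g_n})(t)-\mathcal G^0(\nu_T^{g})(t)\big\|_H=0 .$$ -/

import Mathlib

open MeasureTheory Filter Topology
open scoped NNReal ENNReal CompactlySupported

noncomputable section

namespace Skeleton

/-! ### Locally finite measures with the vague topology -/

/-- Measures on `Y` that are finite on compact sets. -/
def MFC (Y : Type*) [TopologicalSpace Y] [MeasurableSpace Y] : Type _ :=
  {m : Measure Y // IsFiniteMeasureOnCompacts m}

/-- The weakest topology for which `m ↦ ∫ φ dm` is continuous for every `φ ∈ C_c(Y)`. -/
instance MFC.instTopologicalSpace (Y : Type*) [TopologicalSpace Y] [MeasurableSpace Y] :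
    TopologicalSpace (MFC Y) :=
  ⨅ φ : C_c(Y, ℝ),
    TopologicalSpace.induced (fun m : MFC Y => ∫ y, φ y ∂m.1) inferInstance

/-! ### The time-space domain and the sets `S^N` -/

/-- The time interval `[0,T]`. -/
abbrev Time (T : ℝ) : Type := Set.Icc (0 : ℝ) T

/-- Lebesgue measure `λ_T` on `[0,T]`. -/
def leb (T : ℝ) : Measure (Time T) :=
  Measure.comap Subtype.val (volume : Measure ℝ)

instance leb.instIsFiniteMeasure (T : ℝ) : IsFiniteMeasure (leb T) :=
  ⟨by
    have h := comap_subtype_coe_apply (measurableSet_Icc (a := (0 : ℝ)) (b := T))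
      (volume : Measure ℝ) Set.univ
    rw [leb, h, Set.image_univ, Subtype.range_coe]
    exact measure_Icc_lt_top⟩

variable {T : ℝ} {X : Type*} [MeasurableSpace X]

/-- `ν_T = λ_T ⊗ ν` on `[0,T] × X`. -/
def nuT (T : ℝ) (ν : Measure X) : Measure (Time T × X) :=
  (leb T).prod ν

/-- `L_T(g) = ∫ l(g) dν_T` with `l(r) = r log r - r + 1`. -/
def entropy (ν : Measure X) (g : Time T × X → ℝ≥0) : ℝ≥0∞ :=
  ∫⁻ p, ENNReal.ofReal ((g p : ℝ) * Real.log (g p) - (g p : ℝ) + 1) ∂(nuT T ν)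

/-- `S^N`: the measurable `g : [0,T] × X → [0,∞)` with `L_T(g) ≤ N`. -/
def S (T : ℝ) (ν : Measure X) (N : ℕ) : Type _ :=
  {g : Time T × X → ℝ≥0 // Measurable g ∧ entropy ν g ≤ N}

/-- The measure `ν_T^g(A) = ∫_A g dν_T`. -/
def tilt (ν : Measure X) (g : Time T × X → ℝ≥0) : Measure (Time T × X) :=
  (nuT T ν).withDensity (fun p => (g p : ℝ≥0∞))

/-- Elementary bound showing that `L_T(g) < ∞` forces local integrability of `g`. -/
theorem le_entropy_density (r : ℝ≥0) :
    (r : ℝ≥0∞) ≤ ENNReal.ofReal (Real.exp 2) +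
      ENNReal.ofReal ((r : ℝ) * Real.log r - (r : ℝ) + 1) := by
  by_cases h : (r : ℝ) ≤ Real.exp 2
  · refine le_trans ?_ le_self_add
    rw [← ENNReal.ofReal_coe_nnreal]
    exact ENNReal.ofReal_le_ofReal h
  · push Not at h
    refine le_trans ?_ le_add_self
    rw [← ENNReal.ofReal_coe_nnreal]
    refine ENNReal.ofReal_le_ofReal ?_
    have hl : 2 ≤ Real.log r := by
      rw [← Real.log_exp 2]
      exact Real.log_le_log (Real.exp_pos 2) h.le
    nlinarith [r.coe_nonneg]

section Topological

variable [TopologicalSpace X] [PolishSpace X] [LocallyCompactSpace X] [BorelSpace X]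
  (ν : Measure X) [IsFiniteMeasureOnCompacts ν]

/-- The identification of `g ∈ S^N` with the measure `ν_T^g`. -/
def S.toMFC {N : ℕ} (g : S T ν N) : MFC (Time T × X) :=
  ⟨tilt ν g.1, ⟨fun K hK => by
    have hfin : nuT T ν K < ∞ := hK.measure_lt_top (μ := (leb T).prod ν)
    have hKm : MeasurableSet K := hK.measurableSet
    rw [tilt, withDensity_apply _ hKm]
    calc ∫⁻ p in K, (g.1 p : ℝ≥0∞) ∂(nuT T ν)
        ≤ ∫⁻ p in K, (ENNReal.ofReal (Real.exp 2) +
            ENNReal.ofReal ((g.1 p : ℝ) * Real.log (g.1 p) - (g.1 p : ℝ) + 1)) ∂(nuT T ν) :=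
          lintegral_mono fun p => le_entropy_density _
      _ = ENNReal.ofReal (Real.exp 2) * nuT T ν K + ∫⁻ p in K,
            ENNReal.ofReal ((g.1 p : ℝ) * Real.log (g.1 p) - (g.1 p : ℝ) + 1) ∂(nuT T ν) := by
          rw [lintegral_add_left measurable_const, setLIntegral_const]
      _ ≤ ENNReal.ofReal (Real.exp 2) * nuT T ν K + entropy ν g.1 := by
          gcongr
          exact setLIntegral_le_lintegral _ _
      _ < ∞ := ENNReal.add_lt_top.2 ⟨ENNReal.mul_lt_top ENNReal.ofReal_lt_top hfin,
          lt_of_le_of_lt g.2.2 (ENNReal.natCast_lt_top N)⟩⟩⟩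

/-- `S^N` carries the topology induced by `g ↦ ν_T^g`. -/
instance S.instTopologicalSpace (N : ℕ) : TopologicalSpace (S T ν N) :=
  TopologicalSpace.induced (S.toMFC ν) inferInstance

end Topological

/-- The class `ℋ_p` of nonnegative `h` on `[0,T] × X` (measurable up to `ν_T`-null sets) that have
an exponential moment of `h^p` over all sets of finite `ν_T`-measure. -/
def ExpClass (ν : Measure X) (p : ℝ) (h : Time T × X → ℝ) : Prop :=
  AEMeasurable h (nuT T ν) ∧ (∀ q, 0 ≤ h q) ∧
    ∃ δ : ℝ, 0 < δ ∧ ∀ Γ : Set (Time T × X), MeasurableSet Γ → nuT T ν Γ < ∞ →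
      ∫⁻ q in Γ, ENNReal.ofReal (Real.exp (δ * h q ^ p)) ∂(nuT T ν) < ∞

/-! ### The Gelfand triple `V ⊂ H ⊂ V*` and the assumptions on the coefficients -/

variable {V : Type*} [NormedAddCommGroup V] [NormedSpace ℝ V]
  {H : Type*} [NormedAddCommGroup H] [InnerProductSpace ℝ H]

/-- Reflexivity: the canonical map into the bidual is onto. -/
def IsReflexive (V : Type*) [NormedAddCommGroup V] [NormedSpace ℝ V] : Prop :=
  Function.Surjective (NormedSpace.inclusionInDoubleDual ℝ V)

/-- The embedding `H ⊂ V*`, `h ↦ (v ↦ ⟨h, v⟩_H)`, where `ι : V → H` is the inclusion. -/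
def toVDual (ι : V →L[ℝ] H) (h : H) : StrongDual ℝ V :=
  (innerSL ℝ h).comp ι

/-- (H1) -/
def Hemicontinuity (A : Time T → V → StrongDual ℝ V) : Prop :=
  ∀ (t : Time T) (v₁ v₂ v : V), Continuous fun s : ℝ => A t (v₁ + s • v₂) v

/-- (H2) -/
def LocalMonotonicity (ι : V →L[ℝ] H) (A : Time T → V → StrongDual ℝ V)
    (f : Time T → V → X → H) (ν : Measure X) (K : Time T → ℝ) (ρ : V → ℝ) : Prop :=
  ∀ (t : Time T) (v₁ v₂ : V),
    Integrable (fun z => ‖f t v₁ z - f t v₂ z‖ ^ 2) ν ∧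
    2 * (A t v₁ - A t v₂) (v₁ - v₂) + ∫ z, ‖f t v₁ z - f t v₂ z‖ ^ 2 ∂ν
      ≤ (K t + ρ v₂) * ‖ι (v₁ - v₂)‖ ^ 2

/-- (H3) -/
def Coercivity (ι : V →L[ℝ] H) (A : Time T → V → StrongDual ℝ V) (α θ : ℝ)
    (F : Time T → ℝ) : Prop :=
  ∀ (t : Time T) (v : V), 2 * A t v v + θ * ‖v‖ ^ α ≤ F t * (1 + ‖ι v‖ ^ 2)

/-- (H4) -/
def Growth (ι : V →L[ℝ] H) (A : Time T → V → StrongDual ℝ V) (α β C : ℝ)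
    (F : Time T → ℝ) : Prop :=
  ∀ (t : Time T) (v : V),
    ‖A t v‖ ^ (α / (α - 1)) ≤ (F t + C * ‖v‖ ^ α) * (1 + ‖ι v‖ ^ β)

/-- The exponent `Υ`. -/
def upsilon (α β η₀ : ℝ) : ℝ :=
  max (max (max (2 * β * (α - 1) * (α + η₀) / α) (4 * (α - 1) * (α + η₀) / α)) 4) (β + 2)

/-- (H5) -/
def JumpGrowth (ι : V →L[ℝ] H) (f : Time T → V → X → H) (ν : Measure X) (α β : ℝ) : Prop :=
  ∃ (η₀ p : ℝ) (Lf : Time T × X → ℝ), 0 < η₀ ∧ upsilon α β η₀ ≤ p ∧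
    MemLp Lf 2 (nuT T ν) ∧ MemLp Lf 4 (nuT T ν) ∧
    MemLp Lf (ENNReal.ofReal (β + 2)) (nuT T ν) ∧
    MemLp Lf (ENNReal.ofReal (upsilon α β η₀)) (nuT T ν) ∧
    MemLp Lf (ENNReal.ofReal (upsilon α β η₀ / 2)) (nuT T ν) ∧
    ExpClass ν p Lf ∧
    ∀ t v z, ‖f t v z‖ ≤ Lf (t, z) * (1 + ‖ι v‖)

/-- (H6) -/
def JumpLipschitz (ι : V →L[ℝ] H) (f : Time T → V → X → H) (ν : Measure X) : Prop :=
  ∃ Gf : Time T × X → ℝ, MemLp Gf 2 (nuT T ν) ∧ ExpClass ν 2 Gf ∧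
    ∀ t v₁ v₂ z, ‖f t v₁ z - f t v₂ z‖ ≤ Gf (t, z) * ‖ι (v₁ - v₂)‖

/-! ### The skeleton equation and the map `𝒢⁰` -/

/-- `u ∈ C([0,T],H) ∩ L^α([0,T],V)` solves, in `V*` and for all `t ∈ [0,T]`,
`u_t = x + ∫_0^t A(s,u_s) ds + ∫_0^t ∫_X f(s,u_s,z) (g(s,z) - 1) ν(dz) ds`.
Here `w` is the `V`-valued `L^α` version of `u`. -/
def IsSkeletonSolution (ι : V →L[ℝ] H) (A : Time T → V → StrongDual ℝ V)
    (f : Time T → V → X → H) (ν : Measure X) (α : ℝ) (x : H) (g : Time T × X → ℝ≥0)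
    (u : C(Time T, H)) : Prop :=
  ∃ w : Time T → V,
    MemLp w (ENNReal.ofReal α) (leb T) ∧
    (∀ᵐ s ∂(leb T), ι (w s) = u s) ∧
    Integrable (fun s => A s (w s)) (leb T) ∧
    Integrable (fun p : Time T × X => ((g p : ℝ) - 1) • f p.1 (w p.1) p.2) (nuT T ν) ∧
    ∀ t : Time T, toVDual ι (u t) = toVDual ι x + (∫ s in Set.Iic t, A s (w s) ∂(leb T)) +
      toVDual ι (∫ s in Set.Iic t, ∫ z, ((g (s, z) : ℝ) - 1) • f s (w s) z ∂ν ∂(leb T))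

open Classical in
/-- `𝒢⁰(ν_T^g)` is the solution of the skeleton equation with control `g ∈ S = ⋃_N S^N`
(and `0` at measures that are not of the form `ν_T^g` with `g ∈ S` having a solution). -/
def G0 [TopologicalSpace X] [PolishSpace X] [LocallyCompactSpace X] [BorelSpace X]
    (ι : V →L[ℝ] H) (A : Time T → V → StrongDual ℝ V) (f : Time T → V → X → H)
    (ν : Measure X) [IsFiniteMeasureOnCompacts ν] (α : ℝ) (x : H)
    (m : MFC (Time T × X)) : C(Time T, H) :=
  if h : ∃ u : C(Time T, H), ∃ (N : ℕ) (g : S T ν N),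
      g.toMFC ν = m ∧ IsSkeletonSolution ι A f ν α x g.1 u
  then h.choose else 0

end Skeleton

end

open Skeleton

/-!
# The skeleton equation: well-posedness and stability in the control

For a fixed control `g` the term `∫ f(s, v, z) (g(s, z) - 1) ν(dz)` is a lower-order perturbation of
the operator `A`: it has values in `H`, and it is Lipschitz in the norm of `H` with the constant
`∫ |G(s, z)| |g(s, z) - 1| ν(dz)`. This constant is integrable in time, with a bound that depends on
`g` through its entropy only. The reason is the duality of the entropy density `r log r - r + 1` and
the gauge `e^|x| - 1 - |x|` (`mul_abs_sub_one_le`, `EntropyLe.integrable_mul`), together with the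
fact that square-integrable functions with exponential moments of order two on sets of finite
measure have multiples of all sizes in the gauge class (`expIntegrable_of_memLp`). So the skeleton
equation is an evolution equation with a locally monotone, coercive operator whose coefficients are
integrable in time (`SkeletonData.exists_evolutionData`).

Such equations are solved by Euler–Galerkin approximations (`EvolutionData.exists_galerkin`), which
are bounded in `L^∞([0,T],H) ∩ L^α([0,T],V)` and have a subsequence that converges weakly in `H` at
every time. No compactness of `V ⊂ H` is available to identify the limit. Instead, the energy
inequality of the approximations and the local monotonicity, compared at the limit and at small
perturbations of it, give `WeakLimit.minty_inequality`. Here the limit, whose energy identity is not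
yet known, is replaced by a step function in time with values taken from the limit itself, and
summation by parts leaves the squared increments of the limit as an additional nonnegative term. The
inequality yields at once the strong convergence of the approximations (with Gronwall's inequality),
the continuity of the limit (from the squared increments), and the equation (by Minty's argument).

Uniqueness and stability rest on the energy identity in the Gelfand triple (`energy_identity`), also
proved with step functions along well-chosen partitions. It shows that the difference `u_n - u` of
solutions with controls `g_n` and `g` satisfies a Gronwall inequality (`SolutionPair.norm_sub_sq_le`)
whose source is `∫ ⟪∫ f(s, u, z) (g_n - g)(s, z) ν(dz), u_n - u⟫ ds`, with the coefficient `f` along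
the *limiting* solution. For equal controls the source vanishes, which is uniqueness. In general it
tends to zero (`SkeletonData.eventually_inner_driftDiff_le`): up to a small error, uniform over
controls with bounded entropy, the perturbation may be projected to a finite-dimensional subspace of
`V`. Vague convergence with bounded entropy implies convergence against all functions of the gauge
class (`tendsto_integral_mul_sub`), so the time integrals of the projected perturbation tend to zero
uniformly. The projections of `u_n - u` have bounded variation in time, uniformly in `n`, and the
product is integrated by parts. Finally, the tilted measure determines the control almost everywhere
(`S.ae_eq_of_toMFC_eq`), and solutions are insensitive to null sets, so `G0` is the solution map.
-/

set_option linter.unusedSectionVars false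

noncomputable section

namespace Skeleton

section

open Set

/-! ### Lebesgue measure on the time interval -/

variable {T : ℝ}

theorem leb_apply (s : Set (Time T)) : leb T s = volume (Subtype.val '' s) :=
  comap_subtype_coe_apply measurableSet_Icc _ _

instance leb_nullSingletonClass : NullSingletonClass (leb T) :=
  ⟨fun x => by simp [leb_apply]⟩

theorem map_val_leb : (leb T).map Subtype.val = (volume : Measure ℝ).restrict (Icc 0 T) :=
  map_comap_subtype_coe measurableSet_Icc _

theorem lintegral_leb (f : ℝ → ℝ≥0∞) (s : Set ℝ) :
    ∫⁻ r in Subtype.val ⁻¹' s, f r ∂leb T = ∫⁻ r in s ∩ Icc 0 T, f r := by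
  rw [← (MeasurableEmbedding.subtype_coe measurableSet_Icc).lintegral_map f (μ := (leb T).restrict _),
    ← (MeasurableEmbedding.subtype_coe measurableSet_Icc).restrict_map, map_val_leb,
    Measure.restrict_restrict₀' measurableSet_Icc.nullMeasurableSet]

theorem integral_leb {E : Type*} [NormedAddCommGroup E] [NormedSpace ℝ E] (f : ℝ → E) (s : Set ℝ) :
    ∫ r in Subtype.val ⁻¹' s, f r ∂leb T = ∫ r in s ∩ Icc 0 T, f r := by
  rw [← (MeasurableEmbedding.subtype_coe measurableSet_Icc).integral_map f (μ := (leb T).restrict _),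
    ← (MeasurableEmbedding.subtype_coe measurableSet_Icc).restrict_map, map_val_leb,
    Measure.restrict_restrict₀' measurableSet_Icc.nullMeasurableSet]

theorem continuous_integral_Iic {E : Type*} [NormedAddCommGroup E] [NormedSpace ℝ E]
    {f : Time T → E} (hf : Integrable f (leb T)) :
    Continuous fun t => ∫ s in Iic t, f s ∂leb T := by
  simp_rw [← integral_indicator measurableSet_Iic]
  refine continuous_iff_continuousAt.2 fun t₀ => ?_
  refine continuousAt_of_dominated (bound := fun s => ‖f s‖)
    (Eventually.of_forall fun t => hf.aestronglyMeasurable.indicator measurableSet_Iic)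
    (Eventually.of_forall fun t => Eventually.of_forall fun s => norm_indicator_le_norm_self _ _)
    hf.norm ?_
  filter_upwards [(measure_eq_zero_iff_ae_notMem.1 (measure_singleton (μ := leb T) t₀))] with s hs
  rcases lt_or_gt_of_ne (fun h => hs h : s ≠ t₀) with h | h
  · refine continuousAt_const.congr (f := fun _ => f s) ?_
    filter_upwards [lt_mem_nhds h] with t ht
    exact (indicator_of_mem (show s ∈ Iic t from ht.le) f).symm
  · refine continuousAt_const.congr (f := fun _ => 0) ?_
    filter_upwards [gt_mem_nhds h] with t ht
    exact (indicator_of_notMem (show s ∉ Iic t from not_le.2 ht) f).symm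

theorem setIntegral_Iic_sub {E : Type*} [NormedAddCommGroup E] [NormedSpace ℝ E]
    {f : Time T → E} (hf : Integrable f (leb T)) {s t : Time T} (hst : s ≤ t) :
    ∫ r in Ioc s t, f r ∂leb T = (∫ r in Iic t, f r ∂leb T) - ∫ r in Iic s, f r ∂leb T := by
  rw [← Iic_union_Ioc_eq_Iic hst, setIntegral_union (Iic_disjoint_Ioc le_rfl) measurableSet_Ioc
    hf.integrableOn hf.integrableOn]
  abel

/-- Uniform absolute continuity of `t ↦ ∫₀ᵗ f`. -/
theorem exists_norm_setIntegral_Ioc_le {E : Type*} [NormedAddCommGroup E] [NormedSpace ℝ E]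
    {f : Time T → E} (hf : Integrable f (leb T)) {ε : ℝ} (hε : 0 < ε) :
    ∃ δ > 0, ∀ s t : Time T, s ≤ t → (t : ℝ) - s < δ → ‖∫ r in Ioc s t, f r ∂leb T‖ ≤ ε := by
  have huc := CompactSpace.uniformContinuous_of_continuous (continuous_integral_Iic hf)
  obtain ⟨δ, hδ, h⟩ := Metric.uniformContinuous_iff.1 huc ε hε
  refine ⟨δ, hδ, fun s t hst hd => ?_⟩
  rw [setIntegral_Iic_sub hf hst, ← dist_eq_norm]
  refine (h ?_).le
  rw [Subtype.dist_eq, Real.dist_eq, abs_of_nonneg (sub_nonneg.2 (Subtype.coe_le_coe.2 hst))]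
  exact hd

/-! ### A Gronwall inequality with an integrable coefficient -/

/-- The fundamental theorem of calculus for `(1 + ∫₀ᵗ k)^(p+1)`, which is absolutely continuous when
`k` is merely integrable. -/
theorem integral_mul_pow_primitive {k : ℝ → ℝ} {t : ℝ} (hk : IntervalIntegrable k volume 0 t)
    (p : ℕ) : ∫ s in 0..t, (p + 1) * (k s * (1 + ∫ r in 0..s, k r) ^ p)
      = (1 + ∫ r in 0..t, k r) ^ (p + 1) - 1 := by
  set κ : ℝ → ℝ := fun s => 1 + ∫ r in 0..s, k r with hκ
  have h1 : AbsolutelyContinuousOnInterval κ 0 t := by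
    have hc : AbsolutelyContinuousOnInterval (fun _ : ℝ => (1 : ℝ)) 0 t :=
      (contDiff_const.contDiffOn).absolutelyContinuousOnInterval
    exact hc.add (hk.absolutelyContinuousOnInterval_intervalIntegral (by simp))
  have hpow : ∀ n : ℕ, AbsolutelyContinuousOnInterval (fun s => κ s ^ (n + 1)) 0 t := by
    intro n
    induction n with
    | zero => simpa using h1
    | succ n ih =>
      have h := ih.mul h1
      rwa [show (fun s => κ s ^ (n + 1)) * κ = fun s => κ s ^ (n + 1 + 1) from
        funext fun s => (pow_succ (κ s) (n + 1)).symm] at h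
  have h2 := (hpow p).integral_deriv_eq_sub
  have h3 : κ 0 = 1 := by simp [hκ]
  simp only [h3, one_pow] at h2
  rw [← h2]
  refine intervalIntegral.integral_congr_ae ?_
  filter_upwards [hk.ae_hasDerivAt_integral] with s hs hs'
  have hd : HasDerivAt κ (k s) s :=
    (hs (uIoc_subset_uIcc hs') 0 (by simp)).const_add 1
  rw [show (fun s => κ s ^ (p + 1)) = κ ^ (p + 1) from rfl, (hd.pow (p + 1)).deriv]
  simp only [hκ]
  push_cast
  ring

theorem setIntegral_Iic_eq_intervalIntegral (hT : 0 ≤ T) (k : Time T → ℝ) (t : Time T) :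
    ∫ s in Iic t, k s ∂leb T = ∫ s in 0..(t : ℝ), IccExtend hT k s := by
  have h := integral_leb (T := T) (IccExtend hT k) (Iic (t : ℝ))
  rw [intervalIntegral.integral_of_le t.2.1, ← integral_Icc_eq_integral_Ioc]
  have h2 : Iic (t : ℝ) ∩ Icc 0 T = Icc 0 (t : ℝ) := by
    ext r; simp only [mem_inter_iff, mem_Iic, mem_Icc]
    exact ⟨fun h => ⟨h.2.1, h.1⟩, fun h => ⟨h.2, h.1, h.2.trans t.2.2⟩⟩
  rw [h2] at h
  rw [← h]
  refine setIntegral_congr_fun measurableSet_Iic fun s _ => ?_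
  simp

theorem intervalIntegrable_IccExtend (hT : 0 ≤ T) {k : Time T → ℝ} (hk : Integrable k (leb T)) :
    IntervalIntegrable (IccExtend hT k) volume 0 T := by
  rw [intervalIntegrable_iff_integrableOn_Icc_of_le hT, IntegrableOn, ← map_val_leb,
    (MeasurableEmbedding.subtype_coe measurableSet_Icc).integrable_map_iff]
  refine hk.congr (Eventually.of_forall fun s => ?_)
  simp

theorem setIntegral_mul_pow_primitive_le (hT : 0 ≤ T) {k : Time T → ℝ}
    (hk : Integrable k (leb T)) (p : ℕ) (t : Time T) :
    (p + 1) * ∫ s in Iic t, k s * (1 + ∫ r in Iic s, k r ∂leb T) ^ p ∂leb T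
      ≤ (1 + ∫ r in Iic t, k r ∂leb T) ^ (p + 1) - 1 := by
  have hI : IntervalIntegrable (IccExtend hT k) volume 0 (t : ℝ) :=
    (intervalIntegrable_IccExtend hT hk).mono_set (by
      rw [uIcc_of_le hT, uIcc_of_le t.2.1]; exact Icc_subset_Icc_right t.2.2)
  rw [setIntegral_Iic_eq_intervalIntegral hT k t, ← integral_mul_pow_primitive hI p,
    setIntegral_Iic_eq_intervalIntegral hT (fun s => k s * (1 + ∫ r in Iic s, k r ∂leb T) ^ p) t,
    ← intervalIntegral.integral_const_mul]
  refine le_of_eq (intervalIntegral.integral_congr fun s hs => ?_)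
  rw [uIcc_of_le t.2.1] at hs
  have hs' : s ∈ Icc 0 T := ⟨hs.1, hs.2.trans t.2.2⟩
  simp only [IccExtend_of_mem hT _ hs', setIntegral_Iic_eq_intervalIntegral hT k]

/-- The constant in the Gronwall inequality for coefficients of total mass at most `c`. -/
def gronwallConst (c : ℝ) : ℝ := 2 * (1 + c) ^ (⌈2 * (1 + c)⌉₊)

theorem gronwallConst_nonneg {c : ℝ} (hc : 0 ≤ c) : 0 ≤ gronwallConst c := by
  unfold gronwallConst; positivity

/-- Gronwall's inequality for bounded functions and an integrable coefficient `k`. The function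
`g` under the integral may be evaluated at earlier times. The proof compares `f` with the weight
`(1 + ∫₀ᵗ k)^p` for a large power `p`. No measurability of `g` is needed: an integral that is not
defined has the value zero, which the comparison allows. -/
theorem gronwall (hT : 0 ≤ T) {k : Time T → ℝ} (hk : Integrable k (leb T)) (hk0 : ∀ s, 0 ≤ k s)
    {c : ℝ} (hkc : ∫ s, k s ∂leb T ≤ c) {f g : Time T → ℝ} {M a : ℝ} (ha : 0 ≤ a)
    (hfM : ∀ t, f t ≤ M) (hfg : ∀ s, ∃ r ≤ s, g s ≤ f r)
    (hf : ∀ t, f t ≤ a + ∫ s in Iic t, k s * g s ∂leb T) (t : Time T) :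
    f t ≤ gronwallConst c * a := by
  have hc0 : 0 ≤ c := (integral_nonneg hk0).trans hkc
  set κ : Time T → ℝ := fun t => ∫ s in Iic t, k s ∂leb T with hκ
  have hκ0 : ∀ t, 0 ≤ κ t := fun t => integral_nonneg hk0
  have hκmono : Monotone κ := fun s t hst => setIntegral_mono_set hk.integrableOn
    (Eventually.of_forall hk0) (Iic_subset_Iic.2 hst).eventuallyLE
  have hκc : ∀ t, κ t ≤ c := fun t => (setIntegral_le_integral hk
    (Eventually.of_forall hk0)).trans hkc
  -- with this exponent the weight `ψ` satisfies `∫ k ψ ≤ ψ / 2`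
  set p : ℕ := ⌈2 * (1 + c)⌉₊ with hp
  have hpc : 2 * (1 + c) ≤ p := Nat.le_ceil _
  set ψ : Time T → ℝ := fun t => (1 + κ t) ^ p with hψ
  have hψ1 : ∀ t, 1 ≤ ψ t := fun t => one_le_pow₀ (by linarith [hκ0 t])
  have hψmono : Monotone ψ := fun s t hst => pow_le_pow_left₀ (by linarith [hκ0 s])
    (by linarith [hκmono hst]) _
  have hψint : ∀ t, ∫ s in Iic t, k s * ψ s ∂leb T ≤ ψ t / 2 := by
    intro t
    have h := setIntegral_mul_pow_primitive_le hT hk p t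
    have h1 : (1 + κ t) ^ (p + 1) = ψ t * (1 + κ t) := pow_succ _ _
    have h2 : (1 + κ t) ^ (p + 1) ≤ ψ t * (1 + c) := by
      rw [h1]; have := hκc t; have := hψ1 t; gcongr
    have h3 : ((p : ℝ) + 1) * ∫ s in Iic t, k s * ψ s ∂leb T ≤ ((p : ℝ) + 1) * (ψ t / 2) := by
      refine h.trans ?_
      have := hψ1 t
      change (1 + κ t) ^ (p + 1) - 1 ≤ _
      nlinarith
    exact le_of_mul_le_mul_left h3 (by positivity)
  -- the least `S ≥ 0` with `f ≤ S ψ` satisfies `S ≤ a + S / 2`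
  set S : ℝ := max 0 (⨆ t, f t / ψ t) with hS
  have hbdd : BddAbove (range fun t => f t / ψ t) := by
    refine ⟨|M|, ?_⟩
    rintro _ ⟨t, rfl⟩
    have h1 := hψ1 t
    rw [div_le_iff₀ (by linarith)]
    have := hfM t; have := le_abs_self M; have := abs_nonneg M
    nlinarith
  have hfS : ∀ t, f t ≤ S * ψ t := fun t => by
    have h1 := hψ1 t
    rw [← div_le_iff₀ (by linarith)]
    exact (le_ciSup hbdd t).trans (le_max_right _ _)
  have hS0 : 0 ≤ S := le_max_left _ _
  have hψm : Measurable ψ := hψmono.measurable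
  have hψI : Integrable (fun s => k s * ψ s) (leb T) := by
    refine hk.mul_bdd (c := (1 + c) ^ p) hψm.aestronglyMeasurable (Eventually.of_forall fun s => ?_)
    rw [Real.norm_of_nonneg (by linarith [hψ1 s])]
    exact pow_le_pow_left₀ (by linarith [hκ0 s]) (by linarith [hκc s]) _
  have hkey : ∀ t, f t ≤ a + S * (ψ t / 2) := by
    intro t
    refine (hf t).trans ?_
    have h1 : ∫ s in Iic t, k s * g s ∂leb T ≤ ∫ s in Iic t, S * (k s * ψ s) ∂leb T := by
      by_cases hI : IntegrableOn (fun s => k s * g s) (Iic t) (leb T)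
      · refine setIntegral_mono hI (hψI.const_mul S).integrableOn fun s => ?_
        obtain ⟨r, hr, hgr⟩ := hfg s
        have h2 : g s ≤ S * ψ s := hgr.trans ((hfS r).trans
          (mul_le_mul_of_nonneg_left (hψmono hr) hS0))
        calc k s * g s ≤ k s * (S * ψ s) := mul_le_mul_of_nonneg_left h2 (hk0 s)
          _ = S * (k s * ψ s) := by ring
      · rw [integral_undef hI]
        exact integral_nonneg fun s => mul_nonneg hS0 (mul_nonneg (hk0 s) (by linarith [hψ1 s]))
    rw [integral_const_mul] at h1
    have := mul_le_mul_of_nonneg_left (hψint t) hS0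
    linarith
  have hSa : S ≤ a + S / 2 := by
    refine max_le (by positivity) ?_
    have : Nonempty (Time T) := ⟨t⟩
    refine ciSup_le fun t => ?_
    have h1 := hψ1 t
    rw [div_le_iff₀ (by linarith)]
    have := hkey t
    nlinarith
  have h4 : S ≤ 2 * a := by linarith
  calc f t ≤ S * ψ t := hfS t
    _ ≤ 2 * a * (1 + c) ^ p := by
        refine mul_le_mul h4 (pow_le_pow_left₀ (by linarith [hκ0 t]) (by linarith [hκc t]) _)
          (by linarith [hψ1 t]) (by positivity)
    _ = gronwallConst c * a := by rw [gronwallConst]; ring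

/-! ### Approximation by step functions -/

variable {T : ℝ} {E : Type*} [NormedAddCommGroup E]

/-- Continuity of translations in `L^p`. -/
theorem exists_lintegral_translate_le {W : ℝ → E} {p : ℝ} (hp : 1 ≤ p)
    (hW : MemLp W (ENNReal.ofReal p) volume) {η : ℝ≥0∞} (hη : 0 < η) :
    ∃ δ : ℝ, 0 < δ ∧ ∀ σ : ℝ, |σ| < δ → ∫⁻ b, ‖W (b + σ) - W b‖ₑ ^ p ≤ η := by
  have hp1 : Fact (1 ≤ ENNReal.ofReal p) := ⟨by simpa using ENNReal.ofReal_le_ofReal hp⟩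
  have hp0 : ENNReal.ofReal p ≠ 0 := (one_pos.trans_le hp1.out).ne'
  have hptop : ENNReal.ofReal p ≠ ∞ := ENNReal.ofReal_ne_top
  have hpr : (ENNReal.ofReal p).toReal = p := ENNReal.toReal_ofReal (by linarith)
  have hmp : ∀ σ : ℝ, MeasurePreserving (fun b : ℝ => b + σ) volume volume :=
    fun σ => measurePreserving_add_right volume σ
  let g : ℝ → C(ℝ, ℝ) := fun σ => ⟨fun b => b + σ, by fun_prop⟩
  have hg : Continuous g := by
    refine ContinuousMap.continuous_of_continuous_uncurry _ ?_
    change Continuous fun q : ℝ × ℝ => q.2 + q.1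
    fun_prop
  have hcont : Continuous fun σ => Lp.compMeasurePreserving (g σ) (hmp σ) (hW.toLp W) :=
    Continuous.compMeasurePreservingLp continuous_const hg hmp hptop
  have hid : ∀ σ, Lp.compMeasurePreserving (g σ) (hmp σ) (hW.toLp W)
      = (hW.comp_measurePreserving (hmp σ)).toLp (fun b => W (b + σ)) := fun σ =>
    Lp.toLp_compMeasurePreserving hW (hmp σ)
  have hlim := hcont.tendsto 0
  rw [EMetric.tendsto_nhds] at hlim
  obtain ⟨ε, hε, hεη⟩ : ∃ ε : ℝ≥0∞, 0 < ε ∧ ε ^ p ≤ η := by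
    refine ⟨η ^ (1 / p), ?_, ?_⟩
    · by_cases htop : η = ∞
      · rw [htop, ENNReal.top_rpow_of_pos (by positivity)]; simp
      · exact ENNReal.rpow_pos hη htop
    · rw [← ENNReal.rpow_mul, one_div_mul_cancel (by linarith), ENNReal.rpow_one]
  obtain ⟨δ, hδ, hδ'⟩ := Metric.eventually_nhds_iff.1 (hlim ε hε)
  refine ⟨δ, hδ, fun σ hσ => ?_⟩
  have h1 := hδ' (y := σ) (by simpa using hσ)
  rw [hid, hid, Lp.edist_toLp_toLp] at h1
  rw [eLpNorm_eq_eLpNorm' hp0 hptop, hpr] at h1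
  have h2 := lintegral_rpow_enorm_eq_rpow_eLpNorm' (μ := (volume : Measure ℝ)) (q := p)
    (f := (fun b => W (b + σ)) - fun b => W (b + 0)) (by linarith)
  simp only [Pi.sub_apply, add_zero] at h2
  rw [h2]
  refine (ENNReal.rpow_le_rpow ?_ (by linarith)).trans hεη
  simpa using h1.le

/-- The translates of `(0, h)` by multiples of `h` are disjoint. -/
theorem sum_lintegral_translate_le {φ : ℝ → ℝ≥0∞} {h : ℝ} (hh : 0 < h) (M : ℕ) :
    ∑ k ∈ Finset.range M, ∫⁻ a in Ioo 0 h, φ (a + k * h) ≤ ∫⁻ b, φ b := by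
  have h1 : ∀ k : ℕ, ∫⁻ a in Ioo 0 h, φ (a + k * h)
      = ∫⁻ b in Ioo ((k : ℝ) * h) ((k + 1) * h), φ b := by
    intro k
    have h2 : Ioo 0 h = (fun a : ℝ => a + k * h) ⁻¹' Ioo ((k : ℝ) * h) ((k + 1) * h) := by
      ext a
      simp only [mem_Ioo, mem_preimage]
      constructor <;> rintro ⟨h3, h4⟩ <;> constructor <;> linarith
    rw [h2]
    exact (measurePreserving_add_right volume ((k : ℝ) * h)).setLIntegral_comp_preimage_emb
      (measurableEmbedding_addRight _) φ _
  simp_rw [h1]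
  rw [← lintegral_biUnion_finset]
  · exact setLIntegral_le_lintegral _ _
  · intro i _ j _ hij
    refine disjoint_left.2 fun b hb hb' => hij ?_
    have h3 : (i : ℝ) < j + 1 := by
      by_contra hc
      push Not at hc
      have := mul_le_mul_of_nonneg_right hc hh.le
      linarith [hb.1, hb'.2]
    have h4 : (j : ℝ) < i + 1 := by
      by_contra hc
      push Not at hc
      have := mul_le_mul_of_nonneg_right hc hh.le
      linarith [hb'.1, hb.2]
    norm_cast at h3 h4
    omega
  · exact fun _ _ => measurableSet_Ioo

/-- A shift for which the grid `a + k h` is good: the values of `W` at the left and at the right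
grid points approximate `W` in `L^p`, and the grid avoids a null set. On average over `a ∈ (0, h)`
the error is the mean over `σ ∈ (0, h)` of the `L^p` distances of `W` and its translates, so some
`a` outside any null set does as well. -/
theorem exists_good_shift {W : ℝ → E} (hWm : StronglyMeasurable W) {p : ℝ}
    {h : ℝ} (hh : 0 < h) {η : ℝ≥0∞}
    (hη : ∀ σ : ℝ, |σ| ≤ h → ∫⁻ b, ‖W (b + σ) - W b‖ₑ ^ p ≤ η) {Z : Set ℝ} (hZ : volume Z = 0)
    (M : ℕ) :
    ∃ a ∈ Ioo 0 h, (∀ k < M, a + k * h ∉ Z) ∧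
      ∑ k ∈ Finset.range M, ∫⁻ σ in Ioc 0 h, (‖W (a + k * h + σ) - W (a + k * h)‖ₑ ^ p
        + ‖W (a + k * h + σ) - W (a + k * h + h)‖ₑ ^ p) ≤ 2 * η := by
  set L : ℝ → ℝ → ℝ≥0∞ := fun b σ => ‖W (b + σ) - W b‖ₑ ^ p + ‖W (b + σ) - W (b + h)‖ₑ ^ p with hL
  have hLm : Measurable fun q : ℝ × ℝ => L q.1 q.2 := by
    have m1 : StronglyMeasurable fun q : ℝ × ℝ => W (q.1 + q.2) :=
      hWm.comp_measurable (by fun_prop)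
    have m2 : StronglyMeasurable fun q : ℝ × ℝ => W q.1 := hWm.comp_measurable (by fun_prop)
    have m3 : StronglyMeasurable fun q : ℝ × ℝ => W (q.1 + h) :=
      hWm.comp_measurable (by fun_prop)
    exact ((m1.sub m2).enorm.pow_const p).add ((m1.sub m3).enorm.pow_const p)
  have hLint : ∀ σ ∈ Ioc 0 h, ∫⁻ b, L b σ ≤ 2 * η := by
    intro σ hσ
    simp only [hL]
    rw [lintegral_add_left, two_mul]
    · gcongr
      · exact hη σ (by rw [abs_of_pos hσ.1]; exact hσ.2)
      · have h1 := lintegral_add_right_eq_self (μ := (volume : Measure ℝ))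
          (fun b => ‖W (b + (σ - h)) - W b‖ₑ ^ p) h
        have h2 : ∀ b : ℝ, b + h + (σ - h) = b + σ := fun b => by ring
        simp only [h2] at h1
        rw [h1]
        exact hη _ (by rw [abs_le]; constructor <;> linarith [hσ.1, hσ.2])
    · have m1 : StronglyMeasurable fun b : ℝ => W (b + σ) := hWm.comp_measurable (by fun_prop)
      exact (m1.sub hWm).enorm.pow_const p
  set G : ℝ → ℝ≥0∞ := fun a => ∑ k ∈ Finset.range M, ∫⁻ σ in Ioc 0 h, L (a + k * h) σ with hG
  have hGk : ∀ k : ℕ, Measurable fun q : ℝ × ℝ => L (q.1 + k * h) q.2 := fun k =>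
    hLm.comp (f := fun q : ℝ × ℝ => (q.1 + k * h, q.2)) (by fun_prop)
  have hGm : Measurable G := by
    refine Finset.measurable_sum _ fun k _ => ?_
    exact (hGk k).lintegral_prod_right'
  have hGint : ∫⁻ a in Ioo 0 h, G a ≤ 2 * η * ENNReal.ofReal h := by
    calc ∫⁻ a in Ioo 0 h, G a
        = ∑ k ∈ Finset.range M, ∫⁻ a in Ioo 0 h, ∫⁻ σ in Ioc 0 h, L (a + k * h) σ :=
          lintegral_finsetSum _ fun k _ => (hGk k).lintegral_prod_right'
      _ = ∑ k ∈ Finset.range M, ∫⁻ σ in Ioc 0 h, ∫⁻ a in Ioo 0 h, L (a + k * h) σ :=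
          Finset.sum_congr rfl fun k _ => lintegral_lintegral_swap (hGk k).aemeasurable
      _ = ∫⁻ σ in Ioc 0 h, ∑ k ∈ Finset.range M, ∫⁻ a in Ioo 0 h, L (a + k * h) σ :=
          (lintegral_finsetSum _ fun k _ => (hGk k).lintegral_prod_left').symm
      _ ≤ ∫⁻ σ in Ioc 0 h, 2 * η := setLIntegral_mono measurable_const fun σ hσ =>
          (sum_lintegral_translate_le (φ := fun b => L b σ) hh M).trans (hLint σ hσ)
      _ = 2 * η * ENNReal.ofReal h := by simp
  have hvol : (volume : Measure ℝ).restrict (Ioo 0 h) ≠ 0 := by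
    rw [Ne, Measure.restrict_eq_zero]
    simpa using hh
  have hN : (volume : Measure ℝ).restrict (Ioo 0 h)
      ((Ioo 0 h)ᶜ ∪ ⋃ k ∈ Finset.range M, (fun a : ℝ => a + k * h) ⁻¹' Z) = 0 := by
    rw [measure_union_null_iff]
    constructor
    · rw [Measure.restrict_apply measurableSet_Ioo.compl]; simp
    · refine (measure_biUnion_null_iff (Finset.countable_toSet _)).2 fun k _ => ?_
      refine le_antisymm ((Measure.restrict_apply_le _ _).trans ?_) bot_le
      rw [measure_preimage_add_right, hZ]
  obtain ⟨a, haN, ha⟩ := exists_notMem_null_le_laverage hvol hGm.aemeasurable hN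
  simp only [mem_union, not_or, mem_compl_iff, not_not, mem_iUnion, not_exists, Finset.mem_range,
    mem_preimage] at haN
  refine ⟨a, haN.1, haN.2, ha.trans ?_⟩
  rw [laverage_eq]
  refine ENNReal.div_le_of_le_mul ?_
  simpa using hGint

/-- Step-function approximation of an `L^p` function `w` along a partition
`0 = τ₀ < τ₁ < ⋯ < τ_N < T = τ_{N+1} = ⋯` whose interior points avoid a null set, by the values of
`w` at the left end points, and (except on the last interval) at the right end points. The first
interval is left out, as no value of `w` at time `0` is available. -/
theorem exists_partition (hT : 0 < T) {p : ℝ} (hp : 1 ≤ p) {w : Time T → E}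
    (hw : MemLp w (ENNReal.ofReal p) (leb T)) {P : Time T → Prop} (hP : ∀ᵐ s ∂leb T, P s)
    {ε : ℝ≥0∞} (hε : 0 < ε) {δ : ℝ} (hδ : 0 < δ) :
    ∃ (N : ℕ) (τ : ℕ → Time T), 1 ≤ N ∧ Monotone τ ∧ (τ 0 : ℝ) = 0 ∧ (∀ k, N < k → (τ k : ℝ) = T) ∧
      (∀ k, 1 ≤ k → k ≤ N → P (τ k)) ∧ (∀ k, (τ (k + 1) : ℝ) - τ k < δ) ∧
      ∑ k ∈ Finset.range N, ∫⁻ s in Ioc (τ (k + 1)) (τ (k + 2)), ‖w s - w (τ (k + 1))‖ₑ ^ p ∂leb T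
        ≤ ε ∧
      ∀ k, k + 1 < N → ∑ j ∈ Finset.range (k + 1),
        ∫⁻ s in Ioc (τ (j + 1)) (τ (j + 2)), ‖w s - w (τ (j + 2))‖ₑ ^ p ∂leb T ≤ ε := by
  -- replace `w` by a strongly measurable version, extended by zero to the real line
  obtain ⟨w', hw'm, hww'⟩ := hw.1
  set W : ℝ → E := (Icc 0 T).indicator (IccExtend hT.le w') with hW
  have hWval : ∀ s : Time T, W s = w' s := fun s => by
    rw [hW, indicator_of_mem s.2, IccExtend_val]
  have hWm : StronglyMeasurable W :=
    (hw'm.comp_measurable (continuous_projIcc (h := hT.le)).measurable).indicator measurableSet_Icc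
  have hWLp : MemLp W (ENNReal.ofReal p) volume := by
    rw [hW, memLp_indicator_iff_restrict measurableSet_Icc, ← map_val_leb,
      (MeasurableEmbedding.subtype_coe measurableSet_Icc).memLp_map_measure_iff]
    refine (memLp_congr_ae hww').1 hw |>.ae_eq (Eventually.of_forall fun s => ?_)
    simp
  obtain ⟨δ₀, hδ₀, htr⟩ := exists_lintegral_translate_le hp hWLp
    (η := ε / 2) (ENNReal.half_pos hε.ne')
  -- a mesh below `δ` and below the scale at which translations of `W` are `L^p`-small
  obtain ⟨M, hM⟩ := exists_nat_gt (T / min δ δ₀)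
  have hmin : 0 < min δ δ₀ := lt_min hδ hδ₀
  have hM0 : (0 : ℝ) < M := (div_pos hT hmin).trans hM
  set h : ℝ := T / M with hh
  have hh0 : 0 < h := div_pos hT hM0
  have hhM : M * h = T := by rw [hh]; field_simp
  have hhδ : h < min δ δ₀ := by rw [hh, div_lt_iff₀ hM0]; rwa [div_lt_iff₀' hmin] at hM
  set Z : Set ℝ := Subtype.val '' {s : Time T | ¬ (P s ∧ w s = w' s)} with hZ
  have hZ0 : volume Z = 0 := by
    rw [hZ, ← leb_apply]
    exact (hP.and hww')
  obtain ⟨a, ha, haZ, haS⟩ := exists_good_shift hWm hh0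
    (fun σ hσ => htr σ (hσ.trans_lt (hhδ.trans_le (min_le_right _ _)))) hZ0 M
  have hpt : ∀ k : ℕ, k < M → a + k * h ∈ Icc 0 T := fun k hk => by
    have h1 : ((k : ℝ) + 1) * h ≤ M * h := by
      gcongr; exact_mod_cast hk
    constructor
    · have := ha.1; positivity
    · linarith [ha.2]
  -- the grid points in `[0, T]`, shifted by one place to make room for the end point `0`
  set t : ℕ → ℝ := fun k => if k = 0 then 0 else min (a + (k - 1 : ℝ) * h) T with ht
  have ht0 : t 0 = 0 := by simp [ht]
  have hts : ∀ k : ℕ, t (k + 1) = min (a + k * h) T := fun k => by simp [ht]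
  have htIcc : ∀ k, t k ∈ Icc 0 T := by
    rintro (_ | k)
    · rw [ht0]; exact ⟨le_rfl, hT.le⟩
    · rw [hts]
      exact ⟨le_min (by have := ha.1; positivity) hT.le, min_le_right _ _⟩
  have htk : ∀ k : ℕ, k < M → t (k + 1) = a + k * h := fun k hk => by
    rw [hts, min_eq_left (hpt k hk).2]
  set τ : ℕ → Time T := fun k => ⟨t k, htIcc k⟩ with hτ
  have hMpos : 1 ≤ M := by exact_mod_cast hM0
  have hZk : ∀ k, k < M → P (τ (k + 1)) ∧ w (τ (k + 1)) = w' (τ (k + 1)) := by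
    intro k hk
    by_contra hc
    refine haZ k hk ⟨τ (k + 1), hc, ?_⟩
    exact htk k hk
  -- comparison of the integrals over the cells with integrals over shifts
  have hcell : ∀ k : ℕ, k < M → ∀ c : E, ∫⁻ s in Ioc (τ (k + 1)) (τ (k + 2)), ‖w s - c‖ₑ ^ p ∂leb T
      ≤ ∫⁻ σ in Ioc 0 h, ‖W (a + k * h + σ) - c‖ₑ ^ p := by
    intro k hk c
    have h1 : ∫⁻ s in Ioc (τ (k + 1)) (τ (k + 2)), ‖w s - c‖ₑ ^ p ∂leb T
        = ∫⁻ s in Ioc (τ (k + 1)) (τ (k + 2)), ‖W s - c‖ₑ ^ p ∂leb T := by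
      refine lintegral_congr_ae (ae_restrict_of_ae ?_)
      filter_upwards [hww'] with s hs
      rw [hs, hWval]
    rw [h1]
    have h2 := lintegral_leb (T := T) (fun r => ‖W r - c‖ₑ ^ p) (Ioc (t (k + 1)) (t (k + 2)))
    change ∫⁻ s in Subtype.val ⁻¹' (Ioc (t (k + 1)) (t (k + 2))), ‖W s - c‖ₑ ^ p ∂leb T ≤ _
    rw [h2]
    have h3 : Ioc (t (k + 1)) (t (k + 2)) ∩ Icc 0 T ⊆ Ioc (a + k * h) (a + k * h + h) := by
      rintro r ⟨⟨hr1, hr2⟩, -⟩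
      rw [htk k hk] at hr1
      refine ⟨hr1, hr2.trans ?_⟩
      rw [hts (k + 1)]
      refine (min_le_left _ _).trans ?_
      push_cast; linarith
    refine (lintegral_mono_set h3).trans (le_of_eq ?_)
    have h4 : Ioc 0 h = (fun σ : ℝ => a + k * h + σ) ⁻¹' Ioc (a + k * h) (a + k * h + h) := by
      ext σ; simp
    rw [h4]
    exact ((measurePreserving_add_left volume (a + k * h)).setLIntegral_comp_preimage_emb
      (measurableEmbedding_addLeft _) _ _).symm
  have hwW : ∀ k, k < M → w (τ (k + 1)) = W (a + k * h) := fun k hk => by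
    rw [(hZk k hk).2, ← hWval]
    exact congrArg W (htk k hk)
  have hsum : ∑ k ∈ Finset.range M, ∫⁻ σ in Ioc 0 h, (‖W (a + k * h + σ) - W (a + k * h)‖ₑ ^ p
        + ‖W (a + k * h + σ) - W (a + k * h + h)‖ₑ ^ p) ≤ ε := by
    refine haS.trans (le_of_eq ?_)
    rw [ENNReal.mul_div_cancel] <;> simp
  refine ⟨M, τ, hMpos, monotone_nat_of_le_succ fun k => ?_, ht0, fun k hk => ?_, fun k hk1 hk => ?_,
    fun k => ?_, ?_, fun k hk => ?_⟩
  · rw [← Subtype.coe_le_coe]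
    change t k ≤ t (k + 1)
    rcases k with _ | k
    · rw [ht0]; exact (htIcc _).1
    · rw [hts, hts]
      refine min_le_min_right _ ?_
      push_cast; nlinarith
  · obtain ⟨j, rfl⟩ : ∃ j, k = j + 1 := ⟨k - 1, by omega⟩
    change t (j + 1) = T
    rw [hts, min_eq_right]
    have : (M : ℝ) ≤ j := by exact_mod_cast Nat.lt_succ_iff.1 hk
    have := mul_le_mul_of_nonneg_right this hh0.le
    linarith [ha.1]
  · obtain ⟨j, rfl⟩ : ∃ j, k = j + 1 := ⟨k - 1, by omega⟩
    exact (hZk j hk).1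
  · change t (k + 1) - t k < δ
    have hhd : h < δ := hhδ.trans_le (min_le_left _ _)
    rcases k with _ | k
    · rw [ht0, hts]
      have := min_le_left (a + ((0 : ℕ) : ℝ) * h) T
      simp only [Nat.cast_zero, zero_mul, add_zero] at this ⊢
      linarith [ha.2]
    · rw [hts, hts]
      have h1 : a + ((k + 1 : ℕ) : ℝ) * h = a + k * h + h := by push_cast; ring
      rw [h1]
      rcases le_total (a + k * h) T with h2 | h2
      · rw [min_eq_left h2]
        linarith [min_le_left (a + k * h + h) T]
      · rw [min_eq_right h2, min_eq_right (by linarith)]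
        linarith
  · refine (Finset.sum_le_sum fun k hk => ?_).trans hsum
    have hk' := Finset.mem_range.1 hk
    rw [hwW k hk']
    exact (hcell k hk' _).trans (lintegral_mono fun σ => le_self_add)
  · refine le_trans ?_ ((Finset.sum_le_sum_of_subset (f := fun k : ℕ =>
      ∫⁻ σ in Ioc 0 h, (‖W (a + k * h + σ) - W (a + k * h)‖ₑ ^ p
        + ‖W (a + k * h + σ) - W (a + k * h + h)‖ₑ ^ p))
      (Finset.range_subset_range.2 (show k + 1 ≤ M by omega))).trans hsum)
    refine Finset.sum_le_sum fun j hj => ?_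
    have hj' := Finset.mem_range.1 hj
    have h1 : w (τ (j + 2)) = W (a + j * h + h) := by
      rw [hwW (j + 1) (by omega)]
      congr 1; push_cast; ring
    rw [h1]
    exact (hcell j (by omega) _).trans (lintegral_mono fun σ => le_add_self)

/-! ### Step functions and Young's inequality in integrated form -/

section RealPartition

variable {T : ℝ} {E : Type*} [NormedAddCommGroup E]

theorem integrable_norm_sub_rpow {p : ℝ} (hp : 1 ≤ p) {w v : Time T → E}
    (hw : MemLp w (ENNReal.ofReal p) (leb T)) (hv : MemLp v (ENNReal.ofReal p) (leb T)) :
    Integrable (fun s => ‖w s - v s‖ ^ p) (leb T) := by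
  have h := (hw.sub hv).integrable_norm_rpow (by simp; linarith) ENNReal.ofReal_ne_top
  simpa [ENNReal.toReal_ofReal (zero_le_one.trans hp)] using h

theorem setIntegral_norm_rpow_eq_toReal {p : ℝ} (hp : 0 ≤ p) {v : Time T → E}
    (hv : AEStronglyMeasurable v (leb T)) (S : Set (Time T)) :
    ∫ s in S, ‖v s‖ ^ p ∂leb T = (∫⁻ s in S, ‖v s‖ₑ ^ p ∂leb T).toReal := by
  rw [integral_eq_lintegral_of_nonneg_ae (Eventually.of_forall fun s => by positivity)
    (hv.restrict.norm.aemeasurable.pow_const p).aestronglyMeasurable]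
  congr 1
  refine lintegral_congr fun s => ?_
  rw [← ENNReal.ofReal_rpow_of_nonneg (norm_nonneg _) hp, ofReal_norm]

/-- Version of `exists_partition` with Bochner integrals. -/
theorem exists_partition_real (hT : 0 < T) {p : ℝ} (hp : 1 ≤ p) {w : Time T → E}
    (hw : MemLp w (ENNReal.ofReal p) (leb T)) {P : Time T → Prop} (hP : ∀ᵐ s ∂leb T, P s)
    {ε : ℝ} (hε : 0 < ε) {δ : ℝ} (hδ : 0 < δ) :
    ∃ (N : ℕ) (τ : ℕ → Time T), 1 ≤ N ∧ Monotone τ ∧ (τ 0 : ℝ) = 0 ∧ (∀ k, N < k → (τ k : ℝ) = T) ∧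
      (∀ k, 1 ≤ k → k ≤ N → P (τ k)) ∧ (∀ k, (τ (k + 1) : ℝ) - τ k < δ) ∧
      ∑ k ∈ Finset.range N, ∫ s in Ioc (τ (k + 1)) (τ (k + 2)), ‖w s - w (τ (k + 1))‖ ^ p ∂leb T
        ≤ ε ∧
      ∀ k, k + 1 < N → ∑ j ∈ Finset.range (k + 1),
        ∫ s in Ioc (τ (j + 1)) (τ (j + 2)), ‖w s - w (τ (j + 2))‖ ^ p ∂leb T ≤ ε := by
  obtain ⟨N, τ, h1, h2, h3, h4, h5, h6, h7, h8⟩ := exists_partition hT hp hw hP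
    (ENNReal.ofReal_pos.2 hε) hδ
  have hp0 : 0 ≤ p := zero_le_one.trans hp
  have key : ∀ (n : ℕ) (c : ℕ → E), ∑ k ∈ Finset.range n,
      ∫⁻ s in Ioc (τ (k + 1)) (τ (k + 2)), ‖w s - c k‖ₑ ^ p ∂leb T ≤ ENNReal.ofReal ε →
      ∑ k ∈ Finset.range n, ∫ s in Ioc (τ (k + 1)) (τ (k + 2)), ‖w s - c k‖ ^ p ∂leb T ≤ ε := by
    intro n c h
    have hm : ∀ k, AEStronglyMeasurable (fun s => w s - c k) (leb T) := fun k =>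
      hw.1.sub aestronglyMeasurable_const
    have hle := ENNReal.toReal_mono ENNReal.ofReal_ne_top h
    rw [ENNReal.toReal_ofReal hε.le, ENNReal.toReal_sum] at hle
    · refine le_of_eq_of_le (Finset.sum_congr rfl fun k _ => ?_) hle
      exact setIntegral_norm_rpow_eq_toReal hp0 (hm k) _
    · intro k hk
      exact (lt_of_le_of_lt ((Finset.single_le_sum (f := fun k =>
        ∫⁻ s in Ioc (τ (k + 1)) (τ (k + 2)), ‖w s - c k‖ₑ ^ p ∂leb T)
        (fun _ _ => bot_le) hk).trans h) ENNReal.ofReal_lt_top).ne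
  exact ⟨N, τ, h1, h2, h3, h4, h5, h6, key N _ h7, fun k hk => key (k + 1) _ (h8 k hk)⟩

theorem sum_setIntegral_Ioc {F : Type*} [NormedAddCommGroup F] [NormedSpace ℝ F] {f : Time T → F}
    (hf : Integrable f (leb T)) {τ : ℕ → Time T} (hτ : Monotone τ) (n : ℕ) :
    ∑ k ∈ Finset.range n, ∫ s in Ioc (τ k) (τ (k + 1)), f s ∂leb T
      = ∫ s in Ioc (τ 0) (τ n), f s ∂leb T := by
  rw [setIntegral_Iic_sub hf (hτ (Nat.zero_le n)),
    ← Finset.sum_range_sub (fun k => ∫ s in Iic (τ k), f s ∂leb T)]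
  exact Finset.sum_congr rfl fun k _ => setIntegral_Iic_sub hf (hτ (Nat.le_succ k))

end RealPartition

/-- Young's inequality with a small constant. -/
theorem exists_young {α : ℝ} (hα : 1 < α) {ε : ℝ} (hε : 0 < ε) :
    ∃ C : ℝ, 0 ≤ C ∧ ∀ a b : ℝ, 0 ≤ a → 0 ≤ b → a * b ≤ ε * a ^ (α / (α - 1)) + C * b ^ α := by
  have hc : α.HolderConjugate (α / (α - 1)) := Real.HolderConjugate.conjExponent hα
  set q := α / (α - 1) with hq
  have hq1 : 1 < q := hc.symm.lt
  set η : ℝ := ε ^ (1 / q) with hη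
  have hη0 : 0 < η := Real.rpow_pos_of_pos hε _
  have hηq : η ^ q = ε := by
    rw [hη, ← Real.rpow_mul hε.le, one_div_mul_cancel (by linarith), Real.rpow_one]
  refine ⟨(η⁻¹) ^ α, by positivity, fun a b ha hb => ?_⟩
  have h := Real.young_inequality_of_nonneg (a := η * a) (b := η⁻¹ * b) (by positivity)
    (by positivity) hc.symm
  have h1 : η * a * (η⁻¹ * b) = a * b := by field_simp
  rw [h1, Real.mul_rpow hη0.le ha, Real.mul_rpow (by positivity) hb, hηq] at h
  have h2 : ε * a ^ q / q ≤ ε * a ^ q := div_le_self (by positivity) hq1.le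
  have h3 : η⁻¹ ^ α * b ^ α / α ≤ η⁻¹ ^ α * b ^ α := div_le_self (by positivity) hα.le
  linarith

/-! ### The energy identity -/

section Energy

variable {T : ℝ} {V : Type*} [NormedAddCommGroup V] [NormedSpace ℝ V]
  {H : Type*} [NormedAddCommGroup H] [InnerProductSpace ℝ H]

theorem toVDual_apply (ι : V →L[ℝ] H) (h : H) (v : V) : toVDual ι h v = inner ℝ h (ι v) := rfl

theorem toVDual_sub (ι : V →L[ℝ] H) (h h' : H) :
    toVDual ι (h - h') = toVDual ι h - toVDual ι h' := by
  ext v; simp [toVDual_apply, inner_sub_left]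

theorem toVDual_injective {ι : V →L[ℝ] H} (hι : DenseRange ι) :
    Function.Injective (toVDual ι) := by
  intro h h' hh
  refine hι.eq_of_inner_left ℝ ?_
  exact fun v => DFunLike.congr_fun hh v

theorem integrable_of_rpow {E : Type*} [NormedAddCommGroup E] {q : ℝ} (hq : 1 ≤ q)
    {a : Time T → E} (ha : AEStronglyMeasurable a (leb T))
    (ha' : Integrable (fun s => ‖a s‖ ^ q) (leb T)) : Integrable a (leb T) := by
  refine Integrable.mono' ((integrable_const (1 : ℝ)).add ha') ha (Eventually.of_forall fun s => ?_)
  rcases le_total ‖a s‖ 1 with h | h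
  · have : 0 ≤ ‖a s‖ ^ q := by positivity
    simp only [Pi.add_apply]; linarith
  · have : ‖a s‖ ≤ ‖a s‖ ^ q := Real.self_le_rpow_of_one_le h hq
    simp only [Pi.add_apply]; linarith

/-- The pairing of `a ∈ L^{α'}([0,T],V*)` and `w ∈ L^α([0,T],V)` is integrable. -/
theorem integrable_dual_apply {α : ℝ} (hα : 1 < α) {w : Time T → V}
    (hw : MemLp w (ENNReal.ofReal α) (leb T)) {a : Time T → StrongDual ℝ V}
    (ha : AEStronglyMeasurable a (leb T))
    (ha' : Integrable (fun s => ‖a s‖ ^ (α / (α - 1))) (leb T)) :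
    Integrable (fun s => a s (w s)) (leb T) := by
  obtain ⟨C, hC, hY⟩ := exists_young hα one_pos
  have hwi : Integrable (fun s => ‖w s‖ ^ α) (leb T) := by
    simpa using integrable_norm_sub_rpow hα.le hw (v := 0) (MemLp.zero)
  refine Integrable.mono' ((ha'.const_mul 1).add (hwi.const_mul C)) ?_
    (Eventually.of_forall fun s => ?_)
  · exact (ContinuousLinearMap.apply ℝ ℝ : V →L[ℝ] _).flip.aestronglyMeasurable_comp₂ ha hw.1
  · exact ((a s).le_opNorm _).trans (hY _ _ (norm_nonneg _) (norm_nonneg _))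

theorem setIntegral_toVDual [CompleteSpace H] (ι : V →L[ℝ] H) {b : Time T → H}
    (hb : Integrable b (leb T)) (S : Set (Time T)) :
    toVDual ι (∫ s in S, b s ∂leb T) = ∫ s in S, toVDual ι (b s) ∂leb T := by
  have h := ((ContinuousLinearMap.compL ℝ V H ℝ).flip ι ∘L innerSL ℝ).integral_comp_comm
    (hb.integrableOn (s := S))
  exact h.symm

/-- The increments of a solution of `u' = a + b` in `V*`, tested with an element of `V`. -/
theorem inner_sub_eq_setIntegral [CompleteSpace H] (ι : V →L[ℝ] H) {u : Time T → H} {x : H}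
    {a : Time T → StrongDual ℝ V} {b : Time T → H} (ha : Integrable a (leb T))
    (hb : Integrable b (leb T))
    (heq : ∀ t, toVDual ι (u t) = toVDual ι x + (∫ s in Iic t, a s ∂leb T)
      + toVDual ι (∫ s in Iic t, b s ∂leb T)) {s t : Time T} (hst : s ≤ t) (v : V) :
    inner ℝ (u t - u s) (ι v) = ∫ r in Ioc s t, (a r v + inner ℝ (b r) (ι v)) ∂leb T := by
  have h1 : toVDual ι (u t - u s) = (∫ r in Ioc s t, a r ∂leb T)
      + ∫ r in Ioc s t, toVDual ι (b r) ∂leb T := by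
    rw [← setIntegral_toVDual ι hb, toVDual_sub, heq t, heq s, setIntegral_Iic_sub ha hst,
      setIntegral_Iic_sub hb hst, toVDual_sub]
    abel
  have hb' : Integrable (fun r => toVDual ι (b r)) (leb T) :=
    ((ContinuousLinearMap.compL ℝ V H ℝ).flip ι ∘L innerSL ℝ).integrable_comp hb
  rw [← toVDual_apply, h1, add_apply,
    ContinuousLinearMap.integral_apply ha.integrableOn,
    ContinuousLinearMap.integral_apply hb'.integrableOn, ← integral_add]
  · rfl
  · exact (ha.apply_continuousLinearMap v).integrableOn
  · exact (hb'.apply_continuousLinearMap v).integrableOn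

/-- The energy identity: if `u ∈ C([0,T],H) ∩ L^α([0,T],V)` and `u' = a + b` in `V*` with
`a ∈ L^{α'}([0,T],V*)` and `b ∈ L¹([0,T],H)`, then `(‖u‖²)' = 2 (⟨a, u⟩ + ⟨b, u⟩)`.
For points `s < t` at which `u` takes values in `V` one has
`‖u t‖² - ‖u s‖² = ∫ₛᵗ ⟨u', u s + u t⟩`; summing this over fine partitions, along which `u` is
approximated in `L^α([0,T],V)` by its values at both end points, gives the claim. -/
theorem energy_identity [CompleteSpace H] (hT : 0 < T) {α : ℝ} (hα : 1 < α) {ι : V →L[ℝ] H}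
    (hι : DenseRange ι) {w : Time T → V} (hw : MemLp w (ENNReal.ofReal α) (leb T))
    {u : Time T → H} (hu : Continuous u) (hwu : ∀ᵐ s ∂leb T, ι (w s) = u s) {x : H}
    {a : Time T → StrongDual ℝ V} {b : Time T → H} (ha : AEStronglyMeasurable a (leb T))
    (ha' : Integrable (fun s => ‖a s‖ ^ (α / (α - 1))) (leb T)) (hb : Integrable b (leb T))
    (heq : ∀ t, toVDual ι (u t) = toVDual ι x + (∫ s in Iic t, a s ∂leb T)
      + toVDual ι (∫ s in Iic t, b s ∂leb T)) (t : Time T) :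
    ‖u t‖ ^ 2 = ‖x‖ ^ 2 + 2 * ∫ s in Iic t, (a s (w s) + inner ℝ (b s) (u s)) ∂leb T := by
  have hq : 1 ≤ α / (α - 1) := (Real.HolderConjugate.conjExponent hα).symm.lt.le
  have hai : Integrable a (leb T) := integrable_of_rpow hq ha ha'
  have haw := integrable_dual_apply hα hw ha ha'
  have hum : AEStronglyMeasurable u (leb T) := hu.aestronglyMeasurable
  obtain ⟨R, hR⟩ : ∃ R, ∀ s, ‖u s‖ ≤ R := by
    obtain ⟨R, hR⟩ := (isCompact_range hu).isBounded.exists_norm_le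
    exact ⟨R, fun s => hR _ ⟨s, rfl⟩⟩
  have hbu : Integrable (fun s => inner ℝ (b s) (u s)) (leb T) := by
    refine Integrable.mono' (hb.norm.mul_const R) (hb.1.inner hum) (Eventually.of_forall fun s => ?_)
    exact (norm_inner_le_norm _ _).trans (mul_le_mul_of_nonneg_left (hR s) (norm_nonneg _))
  have hy := haw.add hbu
  set Y : Time T → ℝ := fun s => a s (w s) + inner ℝ (b s) (u s) with hY
  have hYi : Integrable Y (leb T) := hy
  set Ψ : Time T → ℝ := fun t => ‖u t‖ ^ 2 - 2 * ∫ s in Iic t, Y s ∂leb T with hΨ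
  have hΨc : Continuous Ψ :=
    (hu.norm.pow 2).sub (continuous_const.mul (continuous_integral_Iic hYi))
  set t₀ : Time T := ⟨0, le_rfl, hT.le⟩ with ht₀
  have hIic0 : leb T (Iic t₀) = 0 := by
    have : Iic t₀ = {t₀} := by
      ext s
      simp only [mem_Iic, mem_singleton_iff]
      exact ⟨fun h => le_antisymm h s.2.1, fun h => h.le⟩
    rw [this, measure_singleton]
  have hu0 : u t₀ = x := by
    refine toVDual_injective hι ?_
    rw [heq t₀, setIntegral_measure_zero _ hIic0, setIntegral_measure_zero _ hIic0]
    ext v; simp [toVDual_apply]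
  -- it suffices to show that `Ψ` is constant
  suffices h : Ψ t = Ψ t₀ by
    simp only [hΨ, hu0, setIntegral_measure_zero _ hIic0] at h
    linarith
  have hsmall : ∀ ε > 0, dist (Ψ t) (Ψ t₀) ≤ 3 * ε := by
    intro ε hε
    obtain ⟨δ₁, hδ₁, hΨu⟩ := Metric.uniformContinuous_iff.1
      (CompactSpace.uniformContinuous_of_continuous hΨc) ε hε
    set A := ∫ s, ‖a s‖ ^ (α / (α - 1)) ∂leb T with hA
    set B := ∫ s, ‖b s‖ ∂leb T with hB
    have hA0 : 0 ≤ A := integral_nonneg fun s => by positivity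
    have hB0 : 0 ≤ B := integral_nonneg fun s => by positivity
    obtain ⟨ω, hω, hωB⟩ : ∃ ω > 0, 4 * ω * B ≤ ε / 3 := by
      refine ⟨ε / (12 * (B + 1)), by positivity, ?_⟩
      rw [show 4 * (ε / (12 * (B + 1))) * B = ε / 3 * (B / (B + 1)) by field_simp; ring]
      exact mul_le_of_le_one_right (by positivity) (div_le_one_of_le₀ (by linarith) (by linarith))
    obtain ⟨η, hη, hηA⟩ : ∃ η > 0, 4 * η * A ≤ ε / 3 := by
      refine ⟨ε / (12 * (A + 1)), by positivity, ?_⟩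
      rw [show 4 * (ε / (12 * (A + 1))) * A = ε / 3 * (A / (A + 1)) by field_simp; ring]
      exact mul_le_of_le_one_right (by positivity) (div_le_one_of_le₀ (by linarith) (by linarith))
    obtain ⟨C, hC, hYoung⟩ := exists_young hα hη
    obtain ⟨κ, hκ, hκC⟩ : ∃ κ > 0, 4 * C * κ ≤ ε / 3 := by
      refine ⟨ε / (12 * (C + 1)), by positivity, ?_⟩
      rw [show 4 * C * (ε / (12 * (C + 1))) = ε / 3 * (C / (C + 1)) by field_simp; ring]
      exact mul_le_of_le_one_right (by positivity) (div_le_one_of_le₀ (by linarith) (by linarith))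
    obtain ⟨δ₂, hδ₂, huu⟩ := Metric.uniformContinuous_iff.1
      (CompactSpace.uniformContinuous_of_continuous hu) ω hω
    obtain ⟨N, τ, hN, hτm, hτ0, hτT, hτP, hτδ, hL, hRt⟩ := exists_partition_real hT hα.le hw hwu
      hκ (lt_min hδ₁ hδ₂)
    have hdist : ∀ {r s : Time T} {c : ℝ}, r ≤ s → (s : ℝ) - r < c → dist s r < c := by
      intro r s c hrs h
      rw [Subtype.dist_eq, Real.dist_eq, abs_of_nonneg (sub_nonneg.2 (Subtype.coe_le_coe.2 hrs))]
      exact h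
    -- the error on one cell of the partition
    have hwa : ∀ c : V, Integrable (fun s => ‖w s - c‖ ^ α) (leb T) := fun c =>
      integrable_norm_sub_rpow hα.le hw (memLp_const c)
    have hcell : ∀ k, k + 2 ≤ N → |Ψ (τ (k + 2)) - Ψ (τ (k + 1))| ≤
        ∫ s in Ioc (τ (k + 1)) (τ (k + 2)), (2 * η * ‖a s‖ ^ (α / (α - 1)) + 2 * ω * ‖b s‖) ∂leb T
        + (C * (∫ s in Ioc (τ (k + 1)) (τ (k + 2)), ‖w s - w (τ (k + 1))‖ ^ α ∂leb T)
        + C * (∫ s in Ioc (τ (k + 1)) (τ (k + 2)), ‖w s - w (τ (k + 2))‖ ^ α ∂leb T)) := by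
      intro k hk
      set r := τ (k + 1) with hr
      set s' := τ (k + 2) with hs'
      have hrs : r ≤ s' := hτm (Nat.le_succ _)
      have hPr : ι (w r) = u r := hτP _ (by omega) (by omega)
      have hPs : ι (w s') = u s' := hτP _ (by omega) hk
      have e1 : ‖u s'‖ ^ 2 - ‖u r‖ ^ 2 = inner ℝ (u s' - u r) (ι (w r + w s')) := by
        rw [map_add, hPr, hPs, inner_add_right, inner_sub_left, inner_sub_left,
          real_inner_self_eq_norm_sq, real_inner_self_eq_norm_sq, real_inner_comm (u r) (u s')]
        ring
      have i1 : Integrable (fun q => a q (w r + w s') + inner ℝ (b q) (ι (w r + w s'))) (leb T) :=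
        (hai.apply_continuousLinearMap _).add (hb.inner_const _)
      have e2 : Ψ s' - Ψ r = ∫ q in Ioc r s', ((a q (w r + w s') + inner ℝ (b q) (ι (w r + w s')))
          - 2 * Y q) ∂leb T := by
        rw [integral_sub i1.integrableOn (hYi.const_mul 2).integrableOn,
          ← inner_sub_eq_setIntegral ι hai hb heq hrs, ← e1, integral_const_mul,
          setIntegral_Iic_sub hYi hrs]
        simp only [hΨ]; ring
      have i2 : Integrable (fun s => 2 * η * ‖a s‖ ^ (α / (α - 1)) + 2 * ω * ‖b s‖) (leb T) :=
        (ha'.const_mul _).add (hb.norm.const_mul _)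
      have i3 : Integrable (fun s => C * ‖w s - w r‖ ^ α + C * ‖w s - w s'‖ ^ α) (leb T) :=
        ((hwa _).const_mul _).add ((hwa _).const_mul _)
      rw [e2, ← integral_const_mul, ← integral_const_mul,
        ← integral_add ((hwa _).const_mul _).integrableOn ((hwa _).const_mul _).integrableOn,
        ← integral_add i2.integrableOn i3.integrableOn, ← Real.norm_eq_abs]
      refine norm_integral_le_of_norm_le (i2.add i3).integrableOn ?_
      refine (ae_restrict_iff' measurableSet_Ioc).2 (Eventually.of_forall fun q hq => ?_)
      have e3 : (a q (w r + w s') + inner ℝ (b q) (ι (w r + w s'))) - 2 * Y q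
          = -(a q (w q - w r)) - a q (w q - w s') + inner ℝ (b q) (u r - u q)
            + inner ℝ (b q) (u s' - u q) := by
        simp only [hY, map_add, hPr, hPs, inner_add_right, inner_sub_right, map_sub]
        ring
      have hqr : r ≤ q := hq.1.le
      have d1 : ‖u r - u q‖ ≤ ω := by
        rw [← dist_eq_norm, dist_comm]
        refine (huu (hdist hqr ?_)).le
        have h1 := hτδ (k + 1)
        have h2 : (q : ℝ) ≤ s' := hq.2
        exact lt_of_le_of_lt (by linarith) (h1.trans_le (min_le_right _ _))
      have d2 : ‖u s' - u q‖ ≤ ω := by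
        rw [← dist_eq_norm]
        refine (huu (hdist hq.2 ?_)).le
        have h1 := hτδ (k + 1)
        have h2 : (r : ℝ) ≤ q := hqr
        exact lt_of_le_of_lt (by linarith) (h1.trans_le (min_le_right _ _))
      have y1 := ((a q).le_opNorm (w q - w r)).trans (hYoung _ _ (norm_nonneg _) (norm_nonneg _))
      have y2 := ((a q).le_opNorm (w q - w s')).trans (hYoung _ _ (norm_nonneg _) (norm_nonneg _))
      have y3 := (norm_inner_le_norm (𝕜 := ℝ) (b q) (u r - u q)).trans
        (mul_le_mul_of_nonneg_left d1 (norm_nonneg _))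
      have y4 := (norm_inner_le_norm (𝕜 := ℝ) (b q) (u s' - u q)).trans
        (mul_le_mul_of_nonneg_left d2 (norm_nonneg _))
      rw [e3]
      rw [Real.norm_eq_abs, abs_le] at *
      constructor <;> linarith [y1.1, y1.2, y2.1, y2.2, y3.1, y3.2, y4.1, y4.2]
    -- summation of the errors; the first cell is not included
    have hstep : ∀ j, 1 ≤ j → j ≤ N → dist (Ψ (τ j)) (Ψ (τ 1)) ≤ ε := by
      intro j hj hjN
      obtain ⟨m, rfl⟩ : ∃ m, j = m + 1 := ⟨j - 1, by omega⟩
      rcases m with _ | m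
      · simpa using hε.le
      rw [Real.dist_eq, ← Finset.sum_range_sub (fun k => Ψ (τ (k + 1))) (m + 1)]
      have hYp : Integrable (fun s => 2 * η * ‖a s‖ ^ (α / (α - 1)) + 2 * ω * ‖b s‖) (leb T) :=
        (ha'.const_mul _).add (hb.norm.const_mul _)
      have b1 : ∑ k ∈ Finset.range (m + 1), ∫ s in Ioc (τ (k + 1)) (τ (k + 2)),
          (2 * η * ‖a s‖ ^ (α / (α - 1)) + 2 * ω * ‖b s‖) ∂leb T ≤ 2 * η * A + 2 * ω * B := by
        rw [sum_setIntegral_Ioc hYp (τ := fun k => τ (k + 1)) (fun i j h => hτm (by omega))]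
        refine (setIntegral_le_integral hYp (Eventually.of_forall fun s => ?_)).trans (le_of_eq ?_)
        · simp only [Pi.zero_apply]; positivity
        · rw [integral_add (ha'.const_mul _) (hb.norm.const_mul _), integral_const_mul,
            integral_const_mul]
      have b2 : ∑ k ∈ Finset.range (m + 1), ∫ s in Ioc (τ (k + 1)) (τ (k + 2)),
          ‖w s - w (τ (k + 1))‖ ^ α ∂leb T ≤ κ := by
        refine le_trans (Finset.sum_le_sum_of_subset_of_nonneg (Finset.range_subset_range.2
          (show m + 1 ≤ N by omega)) fun k _ _ => ?_) hL
        exact integral_nonneg fun s => by positivity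
      have b3 := hRt m (by omega)
      refine (Finset.abs_sum_le_sum_abs _ _).trans ((Finset.sum_le_sum fun k hk =>
        hcell k (by have := Finset.mem_range.1 hk; omega)).trans ?_)
      rw [Finset.sum_add_distrib, Finset.sum_add_distrib, ← Finset.mul_sum, ← Finset.mul_sum]
      have b2' := mul_le_mul_of_nonneg_left b2 hC
      have b3' := mul_le_mul_of_nonneg_left b3 hC
      nlinarith
    -- choose a point of the partition close to `t`
    have hτ1 : dist (Ψ (τ 1)) (Ψ t₀) ≤ ε := by
      refine (hΨu (hdist (show t₀ ≤ τ 1 from (τ 1).2.1) ?_)).le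
      have := hτδ 0
      rw [hτ0] at this
      exact this.trans_le (min_le_left _ _)
    obtain ⟨j, hj1, hjN, hjt⟩ : ∃ j, 1 ≤ j ∧ j ≤ N ∧ dist (Ψ t) (Ψ (τ j)) ≤ ε := by
      by_cases h1 : t ≤ τ 1
      · refine ⟨1, le_rfl, hN, ?_⟩
        rw [dist_comm]
        refine (hΨu (hdist h1 ?_)).le
        have h2 := hτδ 0
        rw [hτ0] at h2
        have := t.2.1
        exact lt_of_le_of_lt (by simp only [zero_add] at *; linarith) (h2.trans_le (min_le_left _ _))
      · push Not at h1
        obtain ⟨j, hj⟩ : ∃ j, j = Nat.findGreatest (fun j => τ j ≤ t) N := ⟨_, rfl⟩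
        have hj1 : 1 ≤ j := hj ▸ Nat.le_findGreatest hN h1.le
        have hjN : j ≤ N := hj ▸ Nat.findGreatest_le N
        have hjt : τ j ≤ t := by
          rw [hj]
          exact Nat.findGreatest_spec (P := fun j => τ j ≤ t) hN h1.le
        have hjt' : t ≤ τ (j + 1) := by
          rcases hjN.lt_or_eq with h2 | h2
          · have h3 := Nat.findGreatest_is_greatest (P := fun j => τ j ≤ t) (n := N) (k := j + 1)
              (by omega) (by omega)
            exact (not_le.1 h3).le
          · rw [← Subtype.coe_le_coe, hτT (j + 1) (by omega)]
            exact t.2.2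
        refine ⟨j, hj1, hjN, (hΨu (hdist hjt ?_)).le⟩
        have h2 := hτδ j
        have h3 : (t : ℝ) ≤ τ (j + 1) := hjt'
        exact lt_of_le_of_lt (by linarith) (h2.trans_le (min_le_left _ _))
    have h1 := dist_triangle (Ψ t) (Ψ (τ j)) (Ψ t₀)
    have h2 := dist_triangle (Ψ (τ j)) (Ψ (τ 1)) (Ψ t₀)
    have h3 := hstep j hj1 hjN
    linarith
  refine eq_of_dist_eq_zero (le_antisymm (le_of_forall_pos_le_add fun ε hε => ?_) dist_nonneg)
  have := hsmall (ε / 3) (by positivity)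
  linarith

end Energy

/-! ### Reflexive Gelfand triples and finite-rank approximation -/

section Triple

variable {V : Type*} [NormedAddCommGroup V] [NormedSpace ℝ V]
  {H : Type*} [NormedAddCommGroup H] [InnerProductSpace ℝ H]

/-- The embedding `H ⊂ V*` as a continuous linear map. -/
def toVDualL (ι : V →L[ℝ] H) : H →L[ℝ] StrongDual ℝ V :=
  (ContinuousLinearMap.compL ℝ V H ℝ).flip ι ∘L innerSL ℝ

theorem toVDualL_apply (ι : V →L[ℝ] H) (h : H) : toVDualL ι h = toVDual ι h := rfl

/-- `H` is dense in `V*` when `V` is reflexive. -/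
theorem denseRange_toVDual (hV : IsReflexive V) {ι : V →L[ℝ] H} (hι : Function.Injective ι) :
    DenseRange (toVDual ι) := by
  have hR : (range (toVDual ι)) = ((toVDualL ι).range : Set (StrongDual ℝ V)) := rfl
  rw [DenseRange, hR]
  by_contra hc
  obtain ⟨ξ, hξ⟩ : ∃ ξ, ξ ∉ closure ((toVDualL ι).range : Set (StrongDual ℝ V)) := by
    by_contra h
    push Not at h
    exact hc h
  obtain ⟨f, u, h1, h2⟩ := geometric_hahn_banach_closed_point
    (Submodule.convex ((toVDualL ι).range).topologicalClosure) isClosed_closure hξ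
  obtain ⟨v, rfl⟩ := hV f
  have hu : 0 < u := by simpa using h1 0 (Submodule.zero_mem _)
  have hv : v = 0 := by
    by_contra hv0
    have hιv : 0 < ‖ι v‖ ^ 2 := by
      have : ι v ≠ 0 := fun h => hv0 (hι (by rw [h, map_zero]))
      positivity
    have h3 := h1 (toVDualL ι ((u / ‖ι v‖ ^ 2) • ι v)) (subset_closure ⟨_, rfl⟩)
    simp only [NormedSpace.dual_def, toVDualL_apply, toVDual_apply, real_inner_smul_left,
      real_inner_self_eq_norm_sq] at h3
    rw [div_mul_cancel₀ _ hιv.ne'] at h3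
    exact lt_irrefl _ h3
  rw [hv, map_zero] at h2
  simp only [zero_apply] at h2
  linarith

/-- `V*` is separable, as it contains the separable space `H` as a dense subspace. -/
theorem secondCountable_dual (hV : IsReflexive V) {ι : V →L[ℝ] H} (hι : Function.Injective ι)
    [TopologicalSpace.SeparableSpace H] : SecondCountableTopology (StrongDual ℝ V) := by
  have : TopologicalSpace.SeparableSpace (StrongDual ℝ V) :=
    (denseRange_toVDual hV hι).separableSpace (toVDualL ι).continuous
  exact UniformSpace.secondCountable_of_separable _

/-- Balls of the reflexive space `V` are weakly sequentially closed in `H`. -/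
theorem exists_preimage_of_weak_limit (hV : IsReflexive V) {ι : V →L[ℝ] H}
    {v : ℕ → V} {h : H} {r : ℝ} (hr : ∃ᶠ n in atTop, ‖v n‖ ≤ r)
    (hv : ∀ h' : H, Tendsto (fun n => inner ℝ (ι (v n)) h') atTop (𝓝 (inner ℝ h h'))) :
    ∃ v₀ : V, ι v₀ = h ∧ ‖v₀‖ ≤ r := by
  have hne : (atTop ⊓ 𝓟 {n | ‖v n‖ ≤ r}).NeBot := frequently_mem_iff_neBot.1 hr
  let U : Ultrafilter ℕ := Ultrafilter.of (atTop ⊓ 𝓟 {n | ‖v n‖ ≤ r})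
  have hU : (U : Filter ℕ) ≤ atTop ⊓ 𝓟 {n | ‖v n‖ ≤ r} := Ultrafilter.of_le _
  let J : ℕ → WeakDual ℝ (StrongDual ℝ V) := fun n =>
    StrongDual.toWeakDual (NormedSpace.inclusionInDoubleDual ℝ V (v n))
  have hJ : ∀ᶠ n in (U : Filter ℕ), J n ∈ WeakDual.toStrongDual ⁻¹'
      Metric.closedBall (0 : StrongDual ℝ (StrongDual ℝ V)) r := by
    filter_upwards [hU (mem_inf_of_right (mem_principal_self _))] with n hn
    refine (mem_closedBall_zero_iff (a := NormedSpace.inclusionInDoubleDual ℝ V (v n))).2 ?_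
    exact (NormedSpace.double_dual_bound ℝ V (v n)).trans hn
  obtain ⟨ξ, hξ, hlim⟩ := (WeakDual.isCompact_closedBall (𝕜 := ℝ)
    (0 : StrongDual ℝ (StrongDual ℝ V)) r).ultrafilter_le_nhds (U.map J) (le_principal_iff.2 hJ)
  obtain ⟨v₀, hv₀⟩ := hV (WeakDual.toStrongDual ξ)
  have hev : ∀ φ : StrongDual ℝ V, Tendsto (fun n => φ (v n)) U (𝓝 (φ v₀)) := by
    intro φ
    have h1 : Tendsto (fun n => J n φ) U (𝓝 (ξ φ)) :=
      ((WeakDual.eval_continuous φ).tendsto ξ).comp hlim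
    have h2 : ξ φ = φ v₀ := by
      have := DFunLike.congr_fun hv₀ φ
      simpa using this.symm
    rw [← h2]
    exact h1
  refine ⟨v₀, ?_, ?_⟩
  · refine ext_inner_right ℝ fun h' => ?_
    have h1 := hev (toVDual ι h')
    have h2 := (hv h').mono_left (hU.trans inf_le_left)
    simp only [toVDual_apply, real_inner_comm _ h'] at h1
    exact tendsto_nhds_unique h1 h2
  · have h1 : ‖WeakDual.toStrongDual ξ‖ ≤ r := by simpa using hξ
    rw [← hv₀] at h1
    rwa [← (NormedSpace.inclusionInDoubleDualLi ℝ (E := V)).norm_map v₀]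

/-- Bounded sequences in a Hilbert space that converge weakly against a dense set of vectors. -/
theorem exists_weak_limit [CompleteSpace H] {y : ℕ → H} {R : ℝ} (hy : ∀ n, ‖y n‖ ≤ R) {D : Set H}
    (hD : Dense D) (hconv : ∀ d ∈ D, ∃ l : ℝ, Tendsto (fun n => inner ℝ (y n) d) atTop (𝓝 l)) :
    ∃ y₀ : H, ‖y₀‖ ≤ R ∧ ∀ h : H, Tendsto (fun n => inner ℝ (y n) h) atTop (𝓝 (inner ℝ y₀ h)) := by
  have hR : 0 ≤ R := (norm_nonneg _).trans (hy 0)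
  have hall : ∀ h : H, ∃ l : ℝ, Tendsto (fun n => inner ℝ (y n) h) atTop (𝓝 l) := by
    intro h
    refine cauchySeq_tendsto_of_complete (Metric.cauchySeq_iff'.2 fun ε hε => ?_)
    obtain ⟨d, hdh, hd⟩ := Metric.dense_iff.1 hD h (ε / (4 * (R + 1))) (by positivity)
    obtain ⟨l, hl⟩ := hconv d hd
    obtain ⟨N, hN⟩ := Metric.cauchySeq_iff'.1 hl.cauchySeq (ε / 2) (by positivity)
    refine ⟨N, fun n hn => ?_⟩
    have h1 := hN n hn
    rw [Real.dist_eq] at h1 ⊢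
    have h2 : ∀ n, |inner ℝ (y n) (h - d)| ≤ ε / 4 := fun n => by
      refine (abs_real_inner_le_norm _ _).trans ?_
      have h3 : ‖h - d‖ ≤ ε / (4 * (R + 1)) := by
        rw [Metric.mem_ball, dist_comm, dist_eq_norm] at hdh
        exact hdh.le
      calc ‖y n‖ * ‖h - d‖ ≤ R * (ε / (4 * (R + 1))) := mul_le_mul (hy n) h3 (norm_nonneg _) hR
        _ = ε / 4 * (R / (R + 1)) := by field_simp
        _ ≤ ε / 4 := mul_le_of_le_one_right (by positivity)
            (div_le_one_of_le₀ (by linarith) (by linarith))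
    have h4 : (inner ℝ (y n) h : ℝ) - inner ℝ (y N) h = (inner ℝ (y n) d - inner ℝ (y N) d)
        + inner ℝ (y n) (h - d) - inner ℝ (y N) (h - d) := by
      simp only [inner_sub_right]; ring
    have h5 := abs_le.1 (h2 n)
    have h6 := abs_le.1 (h2 N)
    have h7 := abs_lt.1 h1
    rw [h4, abs_lt]
    constructor <;> linarith [h5.1, h5.2, h6.1, h6.2, h7.1, h7.2]
  choose l hl using hall
  let L : H →ₗ[ℝ] ℝ :=
    { toFun := l
      map_add' := fun a b => tendsto_nhds_unique (hl (a + b))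
        (by simpa only [inner_add_right] using (hl a).add (hl b))
      map_smul' := fun c a => tendsto_nhds_unique (hl (c • a))
        (by simpa only [real_inner_smul_right, smul_eq_mul, RingHom.id_apply] using (hl a).const_mul c) }
  have hLb : ∀ h, ‖L h‖ ≤ R * ‖h‖ := fun h =>
    le_of_tendsto (hl h).norm (Eventually.of_forall fun n =>
      (norm_inner_le_norm _ _).trans (mul_le_mul_of_nonneg_right (hy n) (norm_nonneg _)))
  let L' : StrongDual ℝ H := L.mkContinuous R hLb
  refine ⟨(InnerProductSpace.toDual ℝ H).symm L', ?_, fun h => ?_⟩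
  · rw [LinearIsometryEquiv.norm_map]
    exact L.mkContinuous_norm_le hR hLb
  · rw [InnerProductSpace.toDual_symm_apply]
    exact hl h

/-- A sequence of finite-rank maps `Q m : H → V` approximating the inverse of `ι`: the composition
`ι ∘ Q m` is an orthogonal projection, and `Q m ∘ ι` is eventually the identity on each vector of
a dense sequence `d` of `V`. -/
structure FiniteRankApprox (ι : V →L[ℝ] H) (d : ℕ → V) (Q : ℕ → H →L[ℝ] V) : Prop where
  dense : DenseRange d
  norm_le : ∀ m h, ‖ι (Q m h)‖ ≤ ‖h‖
  symm : ∀ m h h', (inner ℝ (ι (Q m h)) h' : ℝ) = inner ℝ h (ι (Q m h'))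
  apply_eq : ∀ j m, j < m → Q m (ι (d j)) = d j
  finite_rank : ∀ m, ∃ (n : ℕ) (e : Fin n → H) (v : Fin n → V), ∀ h, Q m h = ∑ i, inner ℝ (e i) h • v i

/-- `Q m` is the orthogonal projection of `H` onto the span of the first `m` vectors of a dense sequence
of `V`, regarded as a map into `V`. The injectivity of `ι` makes this possible. -/
theorem exists_finiteRankApprox [TopologicalSpace.SeparableSpace V] {ι : V →L[ℝ] H}
    (hι : Function.Injective ι) : ∃ (d : ℕ → V) (Q : ℕ → H →L[ℝ] V), FiniteRankApprox ι d Q := by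
  let d := TopologicalSpace.denseSeq V
  let W : ℕ → Submodule ℝ V := fun m => Submodule.span ℝ (d '' Iio m)
  have hWfin : ∀ m, FiniteDimensional ℝ (W m) := fun m =>
    FiniteDimensional.span_of_finite ℝ ((finite_Iio m).image d)
  let U : ℕ → Submodule ℝ H := fun m => (W m).map (ι : V →ₗ[ℝ] H)
  have hUfin : ∀ m, FiniteDimensional ℝ (U m) := fun m => by
    have := hWfin m
    infer_instance
  let e : ∀ m, W m ≃ₗ[ℝ] U m := fun m => Submodule.equivMapOfInjective (ι : V →ₗ[ℝ] H) hι (W m)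
  let L : ∀ m, U m →L[ℝ] V := fun m =>
    LinearMap.toContinuousLinearMap ((W m).subtype ∘ₗ ((e m).symm : U m →ₗ[ℝ] W m))
  have hL : ∀ m (u : U m), ι (L m u) = u := fun m u => by
    have h1 : ((e m ((e m).symm u) : U m) : H) = ι ((e m).symm u : W m) :=
      Submodule.coe_equivMapOfInjective_apply _ _ _ _
    rw [(e m).apply_symm_apply] at h1
    exact h1.symm
  let Q : ℕ → H →L[ℝ] V := fun m => (L m) ∘L (U m).orthogonalProjectionOnto
  have hQ : ∀ m h, ι (Q m h) = (U m).starProjection h := fun m h => hL m _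
  refine ⟨d, Q, TopologicalSpace.denseRange_denseSeq V, fun m h => ?_, fun m h h' => ?_,
    fun j m hj => ?_, fun m => ?_⟩
  · rw [hQ]; exact (U m).norm_starProjection_apply_le h
  · rw [hQ, hQ]; exact (U m).starProjection_isSymmetric h h'
  · refine hι ?_
    rw [hQ, Submodule.starProjection_eq_self_iff]
    exact ⟨d j, Submodule.subset_span ⟨j, hj, rfl⟩, rfl⟩
  · let b := stdOrthonormalBasis ℝ (U m)
    refine ⟨_, fun i => (b i : H), fun i => L m (b i), fun h => ?_⟩
    change L m ((U m).orthogonalProjectionOnto h) = _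
    simp only [b.orthogonalProjectionOnto_apply_eq_sum, map_sum, map_smul]

variable {ι : V →L[ℝ] H} {d : ℕ → V} {Q : ℕ → H →L[ℝ] V}

theorem FiniteRankApprox.tendsto (hQ : FiniteRankApprox ι d Q) (hι : DenseRange ι) (h : H) :
    Tendsto (fun m => ι (Q m h)) atTop (𝓝 h) := by
  have hdense : DenseRange (ι ∘ d) := hι.comp hQ.dense ι.continuous
  rw [Metric.tendsto_atTop]
  intro ε hε
  obtain ⟨j, hj⟩ := hdense.exists_dist_lt h (ε := ε / 2) (by positivity)
  refine ⟨j + 1, fun m hm => ?_⟩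
  have h1 : ι (Q m (ι (d j))) = ι (d j) := by rw [hQ.apply_eq j m (by omega)]
  have h2 : ‖ι (Q m (h - ι (d j)))‖ ≤ ‖h - ι (d j)‖ := hQ.norm_le _ _
  rw [map_sub, map_sub, h1] at h2
  rw [Function.comp_apply, dist_eq_norm] at hj
  rw [dist_eq_norm]
  calc ‖ι (Q m h) - h‖ = ‖(ι (Q m h) - ι (d j)) - (h - ι (d j))‖ := by congr 1; abel
    _ ≤ _ := norm_sub_le _ _
    _ < ε := by linarith

/-- Weakly measurable functions into a Hilbert space with a finite-rank approximation are
measurable. -/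
theorem FiniteRankApprox.measurable [MeasurableSpace H] [BorelSpace H] {Ω : Type*}
    [SecondCountableTopology H]
    [MeasurableSpace Ω] (hQ : FiniteRankApprox ι d Q) (hι : DenseRange ι) {u : Ω → H}
    (hu : ∀ h : H, Measurable fun ω => (inner ℝ (u ω) h : ℝ)) : Measurable u := by
  refine measurable_of_tendsto_metrizable (f := fun m ω => ι (Q m (u ω))) (fun m => ?_)
    (tendsto_pi_nhds.2 fun ω => hQ.tendsto hι (u ω))
  obtain ⟨n, e, v, hev⟩ := hQ.finite_rank m
  simp only [hev, map_sum, map_smul]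
  refine Finset.measurable_sum _ fun i _ => ?_
  simp_rw [real_inner_comm _ (e i)]
  exact (hu (e i)).smul_const _

end Triple

/-! ### Euler–Galerkin approximation -/

/-- Explicit Euler scheme with exact time integration for `u' = φ(s, u)` in a Hilbert space, with
`φ` dominated by an integrable function: `v` is the piecewise constant interpolation of `u`. -/
theorem exists_euler {T : ℝ} (hT : 0 < T) {H : Type*} [NormedAddCommGroup H] [NormedSpace ℝ H]
    [CompleteSpace H] [SecondCountableTopology H] [MeasurableSpace H] [BorelSpace H]
    {φ : Time T → H → H} (hφ : Measurable fun q : Time T × H => φ q.1 q.2)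
    {M : Time T → ℝ} (hM : Integrable M (leb T)) (hφM : ∀ s y, ‖φ s y‖ ≤ M s) (x : H)
    {δ : ℝ} (hδ : 0 < δ) :
    ∃ v : Time T → H, Measurable v ∧ Integrable (fun s => φ s (v s)) (leb T) ∧
      ∀ s, ‖(x + ∫ r in Iic s, φ r (v r) ∂leb T) - v s‖ ≤ δ ∧
        ∃ r ≤ s, v s = x + ∫ q in Iic r, φ q (v q) ∂leb T := by
  obtain ⟨η, hη, hMη⟩ := exists_norm_setIntegral_Ioc_le hM hδ
  set h : ℝ := η / 2 with hh
  have hh0 : 0 < h := by positivity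
  set t : ℕ → Time T := fun k => ⟨min (k * h) T, le_min (by positivity) hT.le, min_le_right _ _⟩
    with ht
  set y : ℕ → H := fun k => Nat.rec x
    (fun k z => z + ∫ s in Ioc (t k) (t (k + 1)), φ s z ∂leb T) k with hy
  have hys : ∀ k, y (k + 1) = y k + ∫ s in Ioc (t k) (t (k + 1)), φ s (y k) ∂leb T := fun k => rfl
  have hy0 : y 0 = x := rfl
  set v : Time T → H := fun s => y (⌈(s : ℝ) / h⌉₊ - 1) with hv
  have hvm : Measurable v := by
    refine (measurable_from_nat (f := fun k => y (k - 1))).comp ?_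
    exact Nat.measurable_ceil.comp (measurable_subtype_coe.div_const h)
  have hφv : Integrable (fun s => φ s (v s)) (leb T) := by
    refine Integrable.mono' hM ?_ (Eventually.of_forall fun s => hφM s _)
    exact (hφ.comp (measurable_id.prodMk hvm)).aestronglyMeasurable
  have htmono : Monotone t := fun i j hij => by
    rw [← Subtype.coe_le_coe]
    refine min_le_min_right _ ?_
    gcongr
  have hcell : ∀ k, ∀ s ∈ Ioc (t k) (t (k + 1)), v s = y k := by
    rintro k s ⟨hs1, hs2⟩
    have h1 : min (k * h) T < s := hs1
    have h2 : (s : ℝ) ≤ min ((k + 1 : ℕ) * h) T := hs2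
    have h3 : k * h < s := by
      rcases min_lt_iff.1 h1 with h4 | h4
      · exact h4
      · exact absurd h4 (not_lt.2 s.2.2)
    have h5 : ⌈(s : ℝ) / h⌉₊ = k + 1 := by
      rw [Nat.ceil_eq_iff (by omega)]
      constructor
      · rw [lt_div_iff₀ hh0]; simpa using h3
      · rw [div_le_iff₀ hh0]; exact h2.trans (min_le_left _ _)
    simp only [hv, h5, Nat.add_sub_cancel]
  have hIic0 : leb T (Iic (t 0)) = 0 := by
    have : Iic (t 0) ⊆ {t 0} := fun s hs => by
      refine le_antisymm hs ?_
      rw [← Subtype.coe_le_coe]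
      exact (min_le_left _ _).trans (by simpa using s.2.1)
    exact measure_mono_null this (measure_singleton _)
  have hut : ∀ k, x + ∫ r in Iic (t k), φ r (v r) ∂leb T = y k := by
    intro k
    induction k with
    | zero => rw [setIntegral_measure_zero _ hIic0, add_zero, hy0]
    | succ k ih =>
      rw [hys, ← setIntegral_congr_fun measurableSet_Ioc
        (fun s hs => by simp only [hcell k s hs] : EqOn (fun s => φ s (v s)) (fun s => φ s (y k)) _),
        setIntegral_Iic_sub hφv (htmono (Nat.le_succ k)), ← ih]
      abel
  refine ⟨v, hvm, hφv, fun s => ?_⟩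
  obtain ⟨k, hk⟩ : ∃ k, k = ⌈(s : ℝ) / h⌉₊ - 1 := ⟨_, rfl⟩
  have hvk : v s = y k := by rw [hk]
  have hks : (k : ℝ) * h ≤ s := by
    rcases Nat.eq_zero_or_pos ⌈(s : ℝ) / h⌉₊ with h1 | h1
    · rw [hk, h1]; simpa using s.2.1
    · have h2 := Nat.ceil_lt_add_one (div_nonneg s.2.1 hh0.le)
      have h3 : (k : ℝ) + 1 = ⌈(s : ℝ) / h⌉₊ := by
        rw [hk]; push_cast [Nat.cast_sub h1]; ring
      rw [← le_div_iff₀ hh0]; linarith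
  have hsk : (s : ℝ) ≤ k * h + h := by
    have h1 := Nat.le_ceil ((s : ℝ) / h)
    have h2 : ⌈(s : ℝ) / h⌉₊ ≤ k + 1 := by omega
    have h3 : (s : ℝ) / h ≤ k + 1 := h1.trans (by exact_mod_cast h2)
    rw [div_le_iff₀ hh0] at h3
    linarith
  have htk : (t k : ℝ) = k * h := min_eq_left (hks.trans s.2.2)
  have htks : t k ≤ s := by rw [← Subtype.coe_le_coe, htk]; exact hks
  refine ⟨?_, t k, htks, ?_⟩
  · rw [hvk, ← hut k, add_sub_add_left_eq_sub, ← setIntegral_Iic_sub hφv htks]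
    refine (norm_integral_le_of_norm_le hM.integrableOn
      (Eventually.of_forall fun r => hφM r _)).trans ?_
    refine (le_abs_self _).trans (hMη _ _ htks ?_)
    rw [htk]; linarith
  · rw [hvk, hut]

variable {T : ℝ} {V : Type*} [NormedAddCommGroup V] [NormedSpace ℝ V]
  {H : Type*} [NormedAddCommGroup H] [InnerProductSpace ℝ H]

/-- A locally monotone, coercive evolution operator `A + b`, with a principal part `A` with values
in `V*` and a lower-order part `b` with values in `H`. The local monotonicity and the coercivity
concern the sum. -/
structure EvolutionData (ι : V →L[ℝ] H) [MeasurableSpace V] [MeasurableSpace H]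
    (A : Time T → V → StrongDual ℝ V) (b : Time T → V → H) (α β θ C : ℝ) (k F c : Time T → ℝ) :
    Prop where
  one_lt : 1 < α
  beta_nonneg : 0 ≤ β
  theta_pos : 0 < θ
  C_nonneg : 0 ≤ C
  measurable_A : Measurable fun q : Time T × V => A q.1 q.2
  measurable_b : Measurable fun q : Time T × V => b q.1 q.2
  k_nonneg : ∀ t, 0 ≤ k t
  F_nonneg : ∀ t, 0 ≤ F t
  c_nonneg : ∀ t, 0 ≤ c t
  k_int : Integrable k (leb T)
  F_int : Integrable F (leb T)
  c_int : Integrable c (leb T)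
  hemi_A : ∀ (t : Time T) (v₁ v₂ v : V), Continuous fun s : ℝ => A t (v₁ + s • v₂) v
  hemi_b : ∀ (t : Time T) (v₁ v₂ : V), Continuous fun s : ℝ => b t (v₁ + s • v₂)
  mono : ∀ (t : Time T) (v₁ v₂ : V), 2 * (A t v₁ - A t v₂) (v₁ - v₂)
    + 2 * inner ℝ (b t v₁ - b t v₂) (ι (v₁ - v₂))
      ≤ (k t + C * (1 + ‖v₂‖ ^ α) * (1 + ‖ι v₂‖ ^ β)) * ‖ι (v₁ - v₂)‖ ^ 2
  coer : ∀ (t : Time T) (v : V), 2 * A t v v + 2 * inner ℝ (b t v) (ι v) + θ * ‖v‖ ^ α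
    ≤ F t * (1 + ‖ι v‖ ^ 2)
  growth : ∀ (t : Time T) (v : V),
    ‖A t v‖ ^ (α / (α - 1)) ≤ (F t + C * ‖v‖ ^ α) * (1 + ‖ι v‖ ^ β)
  growth_b : ∀ (t : Time T) (v : V), ‖b t v‖ ≤ c t * (1 + ‖ι v‖)

/-- The operator `A + b` with values in `V*`. -/
def total (ι : V →L[ℝ] H) (A : Time T → V → StrongDual ℝ V) (b : Time T → V → H) (t : Time T)
    (v : V) : StrongDual ℝ V := A t v + toVDualL ι (b t v)

theorem total_apply (ι : V →L[ℝ] H) (A : Time T → V → StrongDual ℝ V) (b : Time T → V → H)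
    (t : Time T) (v y : V) : total ι A b t v y = A t v y + inner ℝ (b t v) (ι y) := rfl

/-- The adjoint `V* → H` of a continuous linear map `Q : H → V`. -/
def adjointMap [CompleteSpace H] (Q : H →L[ℝ] V) (ξ : StrongDual ℝ V) : H :=
  (InnerProductSpace.toDual ℝ H).symm (ξ.comp Q)

theorem inner_adjointMap [CompleteSpace H] (Q : H →L[ℝ] V) (ξ : StrongDual ℝ V) (h : H) :
    inner ℝ (adjointMap Q ξ) h = ξ (Q h) := by
  rw [adjointMap, InnerProductSpace.toDual_symm_apply]; rfl

theorem norm_adjointMap_le [CompleteSpace H] (Q : H →L[ℝ] V) (ξ : StrongDual ℝ V) :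
    ‖adjointMap Q ξ‖ ≤ ‖ξ‖ * ‖Q‖ := by
  rw [adjointMap, LinearIsometryEquiv.norm_map]
  exact ContinuousLinearMap.opNorm_comp_le _ _

theorem continuous_adjointMap [CompleteSpace H] (Q : H →L[ℝ] V) : Continuous (adjointMap Q) :=
  (InnerProductSpace.toDual ℝ H).symm.continuous.comp
    ((ContinuousLinearMap.compL ℝ H V ℝ).flip Q).continuous

theorem le_one_add_rpow {a q : ℝ} (ha : 0 ≤ a) (hq : 1 ≤ q) : a ≤ 1 + a ^ q := by
  rcases le_total a 1 with h | h
  · have : 0 ≤ a ^ q := by positivity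
    linarith
  · have := Real.self_le_rpow_of_one_le h hq
    linarith

section

variable {ι : V →L[ℝ] H} [MeasurableSpace V] [MeasurableSpace H]
    {A : Time T → V → StrongDual ℝ V} {b : Time T → V → H} {α β θ C : ℝ} {k F c : Time T → ℝ}

theorem EvolutionData.one_le_conj (hE : EvolutionData ι A b α β θ C k F c) : 1 ≤ α / (α - 1) :=
  (Real.HolderConjugate.conjExponent hE.one_lt).symm.lt.le

theorem EvolutionData.norm_A_le (hE : EvolutionData ι A b α β θ C k F c) (t : Time T) (v : V) :
    ‖A t v‖ ≤ 1 + (F t + C * ‖v‖ ^ α) * (1 + ‖ι v‖ ^ β) :=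
  (le_one_add_rpow (norm_nonneg _) hE.one_le_conj).trans (by linarith [hE.growth t v])

theorem EvolutionData.measurable_total [BorelSpace H] [SecondCountableTopology (StrongDual ℝ V)]
    (hE : EvolutionData ι A b α β θ C k F c) :
    Measurable fun q : Time T × V => total ι A b q.1 q.2 :=
  hE.measurable_A.add ((toVDualL ι).continuous.measurable.comp hE.measurable_b)

theorem EvolutionData.two_mul_total_le (hE : EvolutionData ι A b α β θ C k F c) (t : Time T)
    (v : V) : 2 * total ι A b t v v + θ * ‖v‖ ^ α ≤ F t * (1 + ‖ι v‖ ^ 2) := by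
  rw [total_apply]; linarith [hE.coer t v]

theorem EvolutionData.norm_total_le (hE : EvolutionData ι A b α β θ C k F c) {R r : ℝ}
    (t : Time T) {v : V} (hv : ‖v‖ ≤ r) (hR : ‖ι v‖ ≤ R) :
    ‖total ι A b t v‖ ≤ 1 + (F t + C * r ^ α) * (1 + R ^ β) + ‖toVDualL ι‖ * (c t * (1 + R)) := by
  have hα := hE.one_lt
  have hβ := hE.beta_nonneg
  have hC := hE.C_nonneg
  have hF := hE.F_nonneg t
  have hc := hE.c_nonneg t
  refine (norm_add_le _ _).trans (add_le_add ((hE.norm_A_le t v).trans ?_)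
    (((toVDualL ι).le_opNorm _).trans ?_))
  · have h0 : 0 ≤ ‖v‖ := norm_nonneg v
    have h1 : 0 ≤ r := h0.trans hv
    have h2 : 0 ≤ F t + C * r ^ α := by positivity
    gcongr
  · have := hE.growth_b t v
    have : c t * (1 + ‖ι v‖) ≤ c t * (1 + R) := by gcongr
    gcongr
    linarith

/-- An approximate solution with values in the range of a projection `Q`. The bounds `R` and `C₁` are
independent of `Q` and of the accuracy `ε`. The function `w = Q v` is piecewise constant in time,
and `u` is the primitive of the vector field `Q* (A + b)(s, w s)`. The vector field is truncated
outside the ball of radius `R`, which gives it an integrable bound; the energy identity in `H`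
and Gronwall's inequality show that the truncation is never active. -/
theorem EvolutionData.exists_galerkin [BorelSpace V] [BorelSpace H] [CompleteSpace H]
    [SecondCountableTopology H] [SecondCountableTopology (StrongDual ℝ V)]
    (hE : EvolutionData ι A b α β θ C k F c) (hT : 0 < T) (x : H) :
    ∃ R C₁ : ℝ, 0 ≤ R ∧ 0 ≤ C₁ ∧ ∀ (Q : H →L[ℝ] V), (∀ h, ‖ι (Q h)‖ ≤ ‖h‖) → ∀ ε : ℝ, 0 < ε →
      ∃ (w : Time T → V) (u : Time T → H), Measurable w ∧ Continuous u ∧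
        (∀ s, ‖u s‖ ≤ R) ∧ (∀ s, ‖ι (w s)‖ ≤ R) ∧ (∀ s, ‖ι (w s) - ι (Q (u s))‖ ≤ ε) ∧
        MemLp w (ENNReal.ofReal α) (leb T) ∧ ∫ s, ‖w s‖ ^ α ∂leb T ≤ C₁ ∧
        (∀ t h, inner ℝ (u t - x) h = ∫ r in Iic t, total ι A b r (w r) (Q h) ∂leb T) ∧
        (∀ t, ‖u t‖ ^ 2 ≤ ‖x‖ ^ 2 + 2 * ∫ r in Iic t, total ι A b r (w r) (w r) ∂leb T + ε) := by
  have hα := hE.one_lt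
  have hF0 : 0 ≤ ∫ s, F s ∂leb T := integral_nonneg hE.F_nonneg
  set g := gronwallConst (∫ s, F s ∂leb T) with hg
  have hg0 : 0 ≤ g := gronwallConst_nonneg hF0
  set a₀ : ℝ := ‖x‖ ^ 2 + 1 + ∫ s, F s ∂leb T with ha₀
  have ha₀0 : 0 ≤ a₀ := by positivity
  set R : ℝ := Real.sqrt (g * a₀) with hR
  have hR0 : 0 ≤ R := Real.sqrt_nonneg _
  have hR2 : R ^ 2 = g * a₀ := Real.sq_sqrt (by positivity)
  refine ⟨R, (‖x‖ ^ 2 + 1 + (1 + R ^ 2) * ∫ s, F s ∂leb T) / θ, hR0,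
    div_nonneg (by positivity) hE.theta_pos.le, fun Q hQ ε hε => ?_⟩
  -- the truncated finite-dimensional vector field
  set φ : Time T → H → H := fun s y =>
    if ‖y‖ ≤ R then adjointMap Q (total ι A b s (Q y)) else 0 with hφ
  have hφm : Measurable fun q : Time T × H => φ q.1 q.2 := by
    refine Measurable.ite (measurableSet_le measurable_snd.norm measurable_const) ?_
      measurable_const
    have h1 : Measurable fun q : Time T × H => (q.1, Q q.2) :=
      measurable_fst.prodMk (Q.continuous.measurable.comp measurable_snd)
    exact (continuous_adjointMap Q).measurable.comp (hE.measurable_total.comp h1)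
  set M : Time T → ℝ := fun t => (1 + (F t + C * (‖Q‖ * R) ^ α) * (1 + R ^ β)
    + ‖toVDualL ι‖ * (c t * (1 + R))) * ‖Q‖ with hM
  have hMi : Integrable M (leb T) := by
    have h1 := hE.F_int
    have h2 := hE.c_int
    refine Integrable.mul_const ?_ _
    exact ((integrable_const _).add ((h1.add (integrable_const _)).mul_const _)).add
      ((h2.mul_const _).const_mul _)
  have hM0 : ∀ t, 0 ≤ M t := fun t => by
    have := hE.F_nonneg t; have := hE.c_nonneg t; have := hE.C_nonneg
    simp only [hM]; positivity
  have hφM : ∀ s y, ‖φ s y‖ ≤ M s := by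
    intro s y
    simp only [hφ]
    split_ifs with hy
    · refine (norm_adjointMap_le _ _).trans (mul_le_mul_of_nonneg_right ?_ (norm_nonneg _))
      refine hE.norm_total_le s ((Q.le_opNorm y).trans ?_) ((hQ y).trans hy)
      gcongr
    · simpa using hM0 s
  -- the mesh is chosen so that the energy error is at most `min ε 1`
  set I : ℝ := ∫ s, M s ∂leb T with hI
  have hI0 : 0 ≤ I := integral_nonneg hM0
  set e : ℝ := min ε 1 with he
  have he0 : 0 < e := lt_min hε one_pos
  obtain ⟨v, hvm, hφv, hv⟩ := exists_euler hT hφm hMi hφM x (δ := e / (2 * I + 1)) (by positivity)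
  set u : Time T → H := fun t => x + ∫ s in Iic t, φ s (v s) ∂leb T with hu
  have huc : Continuous u := continuous_const.add (continuous_integral_Iic hφv)
  have huv : ∀ s, ‖u s - v s‖ ≤ e / (2 * I + 1) := fun s => (hv s).1
  have hde : e / (2 * I + 1) ≤ e := div_le_self he0.le (by linarith)
  have hvu : ∀ s, ∃ r ≤ s, v s = u r := fun s => (hv s).2
  obtain ⟨R', hR'⟩ : ∃ R', ∀ s, ‖u s‖ ≤ R' := by
    obtain ⟨R', hR'⟩ := (isCompact_range huc).isBounded.exists_norm_le
    exact ⟨R', fun s => hR' _ ⟨s, rfl⟩⟩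
  have hvR' : ∀ s, ‖v s‖ ≤ R' := fun s => by
    obtain ⟨r, -, h⟩ := hvu s
    rw [h]; exact hR' r
  have hR'0 : ∀ s : Time T, 0 ≤ R' := fun s => (norm_nonneg _).trans (hR' s)
  have huLp : MemLp u (ENNReal.ofReal 2) (leb T) :=
    MemLp.of_bound huc.aestronglyMeasurable R' (Eventually.of_forall hR')
  have henergy : ∀ t, ‖u t‖ ^ 2 = ‖x‖ ^ 2 + 2 * ∫ s in Iic t, inner ℝ (φ s (v s)) (u s) ∂leb T := by
    intro t
    have h := energy_identity hT one_lt_two (ι := ContinuousLinearMap.id ℝ H)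
      (Function.surjective_id.denseRange) huLp huc (Eventually.of_forall fun s => rfl) (x := x)
      (a := 0) (b := fun s => φ s (v s)) aestronglyMeasurable_zero (by simp) hφv
      (fun t => by
        ext h
        simp [toVDual_apply, hu, inner_add_left]) t
    simpa using h
  have hφvi : Integrable (fun s => inner ℝ (φ s (v s)) (v s)) (leb T) := by
    refine Integrable.mono' (hMi.mul_const R') (hφv.1.inner hvm.aestronglyMeasurable)
      (Eventually.of_forall fun s => ?_)
    exact (norm_inner_le_norm _ _).trans (mul_le_mul (hφM _ _) (hvR' s) (norm_nonneg _) (hM0 s))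
  have hφui : Integrable (fun s => inner ℝ (φ s (v s)) (u s - v s)) (leb T) := by
    refine Integrable.mono' (hMi.mul_const (e / (2 * I + 1)))
      (hφv.1.inner (huc.aestronglyMeasurable.sub hvm.aestronglyMeasurable))
      (Eventually.of_forall fun s => ?_)
    exact (norm_inner_le_norm _ _).trans (mul_le_mul (hφM _ _) (huv s) (norm_nonneg _) (hM0 s))
  have hen2 : ∀ t, ‖u t‖ ^ 2 ≤ ‖x‖ ^ 2 + 2 * ∫ s in Iic t, inner ℝ (φ s (v s)) (v s) ∂leb T + e := by
    intro t
    have h1 : ∫ s in Iic t, inner ℝ (φ s (v s)) (u s) ∂leb T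
        = (∫ s in Iic t, inner ℝ (φ s (v s)) (v s) ∂leb T)
          + ∫ s in Iic t, inner ℝ (φ s (v s)) (u s - v s) ∂leb T := by
      rw [← integral_add hφvi.integrableOn hφui.integrableOn]
      refine integral_congr_ae (Eventually.of_forall fun s => ?_)
      simp only [inner_sub_right]; ring
    have h2 : ∫ s in Iic t, inner ℝ (φ s (v s)) (u s - v s) ∂leb T ≤ e / 2 := by
      calc ∫ s in Iic t, inner ℝ (φ s (v s)) (u s - v s) ∂leb T
          ≤ ∫ s in Iic t, M s * (e / (2 * I + 1)) ∂leb T := by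
            refine integral_mono hφui.integrableOn (hMi.mul_const _).integrableOn fun s => ?_
            exact (real_inner_le_norm _ _).trans
              (mul_le_mul (hφM _ _) (huv s) (norm_nonneg _) (hM0 s))
        _ ≤ ∫ s, M s * (e / (2 * I + 1)) ∂leb T :=
            setIntegral_le_integral (hMi.mul_const _) (Eventually.of_forall fun s =>
              mul_nonneg (hM0 s) (by positivity))
        _ = e / 2 * (2 * I / (2 * I + 1)) := by rw [integral_mul_const]; field_simp; rfl
        _ ≤ e / 2 := mul_le_of_le_one_right (by positivity)
            (div_le_one_of_le₀ (by linarith) (by linarith))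
    rw [henergy, h1]; linarith
  -- the a priori bound, which makes the truncation inactive
  have hFv : Integrable (fun s => F s * ‖v s‖ ^ 2) (leb T) := by
    refine hE.F_int.mul_bdd (c := R' ^ 2) (hvm.norm.pow_const 2).aestronglyMeasurable
      (Eventually.of_forall fun s => ?_)
    rw [norm_pow, norm_norm]
    exact pow_le_pow_left₀ (norm_nonneg _) (hvR' s) 2
  have hpt : ∀ s, 2 * inner ℝ (φ s (v s)) (v s) ≤ F s + F s * ‖v s‖ ^ 2 := by
    intro s
    have hFs := hE.F_nonneg s
    simp only [hφ]
    split_ifs with h1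
    · rw [inner_adjointMap]
      have h2 := hE.two_mul_total_le s (Q (v s))
      have h3 : 0 ≤ θ * ‖Q (v s)‖ ^ α := mul_nonneg hE.theta_pos.le (by positivity)
      have h4 : F s * ‖ι (Q (v s))‖ ^ 2 ≤ F s * ‖v s‖ ^ 2 := by
        have := hQ (v s)
        gcongr
      linarith
    · rw [inner_zero_left, mul_zero]
      positivity
  have huR : ∀ t, ‖u t‖ ^ 2 ≤ R ^ 2 := by
    intro t
    rw [hR2, hg]
    refine gronwall hT.le hE.F_int hE.F_nonneg le_rfl (f := fun t => ‖u t‖ ^ 2)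
      (g := fun s => ‖v s‖ ^ 2) (M := R' ^ 2) ha₀0
      (fun t => pow_le_pow_left₀ (norm_nonneg _) (hR' t) 2) (fun s => ?_) (fun t => ?_) t
    · obtain ⟨r, hr, h⟩ := hvu s
      exact ⟨r, hr, by rw [h]⟩
    · have h1 : 2 * ∫ s in Iic t, inner ℝ (φ s (v s)) (v s) ∂leb T
          ≤ (∫ s in Iic t, F s ∂leb T) + ∫ s in Iic t, F s * ‖v s‖ ^ 2 ∂leb T := by
        rw [← integral_const_mul, ← integral_add hE.F_int.integrableOn hFv.integrableOn]
        exact integral_mono (hφvi.const_mul 2).integrableOn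
          (hE.F_int.add hFv).integrableOn hpt
      have h2 : ∫ s in Iic t, F s ∂leb T ≤ ∫ s, F s ∂leb T :=
        setIntegral_le_integral hE.F_int (Eventually.of_forall hE.F_nonneg)
      have h3 : e ≤ 1 := min_le_right _ _
      have := hen2 t
      rw [ha₀]; linarith
  have huR' : ∀ t, ‖u t‖ ≤ R := fun t => le_of_sq_le_sq (huR t) hR0
  have hvR : ∀ s, ‖v s‖ ≤ R := fun s => by
    obtain ⟨r, -, h⟩ := hvu s
    rw [h]; exact huR' r
  have hφeq : ∀ s, φ s (v s) = adjointMap Q (total ι A b s (Q (v s))) := fun s => by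
    simp only [hφ, if_pos (hvR s)]
  have hwm : Measurable fun s => Q (v s) := Q.continuous.measurable.comp hvm
  have hwb : ∀ s, ‖Q (v s)‖ ≤ ‖Q‖ * R := fun s => (Q.le_opNorm _).trans (by gcongr; exact hvR s)
  have hwLp : MemLp (fun s => Q (v s)) (ENNReal.ofReal α) (leb T) :=
    MemLp.of_bound (Q.continuous.comp_aestronglyMeasurable hvm.aestronglyMeasurable) (‖Q‖ * R)
      (Eventually.of_forall hwb)
  have hwα : Integrable (fun s => ‖Q (v s)‖ ^ α) (leb T) := by
    simpa using integrable_norm_sub_rpow hα.le hwLp (v := 0) MemLp.zero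
  refine ⟨fun s => Q (v s), u, hwm, huc, huR', fun s => (hQ _).trans (hvR s), fun s => ?_, hwLp,
    ?_, fun t h => ?_, fun t => ?_⟩
  · rw [← map_sub, ← map_sub]
    refine (hQ _).trans ?_
    rw [norm_sub_rev]
    exact (huv s).trans (hde.trans (min_le_left _ _))
  · rw [le_div_iff₀ hE.theta_pos, mul_comm, ← integral_const_mul]
    have h1 := hen2 ⟨T, hT.le, le_rfl⟩
    have h2 : (Iic (⟨T, hT.le, le_rfl⟩ : Time T)) = univ := by
      ext s; simp only [mem_Iic, mem_univ, iff_true]; exact s.2.2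
    rw [h2, setIntegral_univ] at h1
    have h3 : ∫ s, θ * ‖Q (v s)‖ ^ α ∂leb T + 2 * ∫ s, inner ℝ (φ s (v s)) (v s) ∂leb T
        ≤ (1 + R ^ 2) * ∫ s, F s ∂leb T := by
      rw [← integral_const_mul, ← integral_const_mul,
        ← integral_add (hwα.const_mul _) (hφvi.const_mul 2)]
      refine integral_mono ((hwα.const_mul _).add (hφvi.const_mul 2)) (hE.F_int.const_mul _)
        fun s => ?_
      simp only [hφeq, inner_adjointMap]
      have h4 := hE.two_mul_total_le s (Q (v s))
      have h5 : F s * ‖ι (Q (v s))‖ ^ 2 ≤ F s * R ^ 2 := by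
        have := (hQ (v s)).trans (hvR s)
        have := hE.F_nonneg s
        gcongr
      linarith
    have h4 : e ≤ 1 := min_le_right _ _
    have h5 : 0 ≤ ‖u ⟨T, hT.le, le_rfl⟩‖ ^ 2 := by positivity
    linarith
  · have h1 : u t - x = ∫ s in Iic t, φ s (v s) ∂leb T := by simp only [hu]; abel
    rw [h1, real_inner_comm, ← integral_inner hφv.integrableOn]
    refine integral_congr_ae (Eventually.of_forall fun s => ?_)
    simp only
    rw [real_inner_comm, hφeq, inner_adjointMap]
  · refine (hen2 t).trans ?_
    have h1 : ∫ s in Iic t, inner ℝ (φ s (v s)) (v s) ∂leb T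
        = ∫ r in Iic t, total ι A b r (Q (v r)) (Q (v r)) ∂leb T := by
      refine integral_congr_ae (Eventually.of_forall fun s => ?_)
      simp only [hφeq, inner_adjointMap]
    rw [h1]
    have : e ≤ ε := min_le_left _ _
    linarith

end

/-! ### Weak limits of the approximations -/

section

variable {T : ℝ} {V : Type*} [NormedAddCommGroup V] [NormedSpace ℝ V]
  {H : Type*} [NormedAddCommGroup H] [InnerProductSpace ℝ H]
  {ι : V →L[ℝ] H} [MeasurableSpace V] [MeasurableSpace H]
  {A : Time T → V → StrongDual ℝ V} {b : Time T → V → H} {α β θ C : ℝ} {k F c : Time T → ℝ}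

/-- A sequence of Euler–Galerkin approximations: `w n` takes values in `V` and `u n` in `H`; the
integral equation and the energy inequality hold up to the projections `Q n` and errors `ε n`.
The bounds `R` and `C₁` do not depend on `n`. -/
structure GalerkinSeq (ι : V →L[ℝ] H) (A : Time T → V → StrongDual ℝ V) (b : Time T → V → H)
    (α : ℝ) (d : ℕ → V) (x : H) (R C₁ : ℝ) (ε : ℕ → ℝ) (Q : ℕ → H →L[ℝ] V)
    (w : ℕ → Time T → V) (u : ℕ → Time T → H) : Prop where
  Q_norm : ∀ n h, ‖ι (Q n h)‖ ≤ ‖h‖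
  Q_symm : ∀ n h h', (inner ℝ (ι (Q n h)) h' : ℝ) = inner ℝ h (ι (Q n h'))
  Q_eq : ∀ j, ∀ᶠ n in atTop, Q n (ι (d j)) = d j
  Q_tendsto : ∀ h, Tendsto (fun n => ι (Q n h)) atTop (𝓝 h)
  eps_tendsto : Tendsto ε atTop (𝓝 0)
  R_nonneg : 0 ≤ R
  C₁_nonneg : 0 ≤ C₁
  w_meas : ∀ n, Measurable (w n)
  u_cont : ∀ n, Continuous (u n)
  u_le : ∀ n s, ‖u n s‖ ≤ R
  w_le : ∀ n s, ‖ι (w n s)‖ ≤ R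
  close : ∀ n s, ‖ι (w n s) - ι (Q n (u n s))‖ ≤ ε n
  memLp : ∀ n, MemLp (w n) (ENNReal.ofReal α) (leb T)
  int_le : ∀ n, ∫ s, ‖w n s‖ ^ α ∂leb T ≤ C₁
  eqn : ∀ n t h, inner ℝ (u n t - x) h = ∫ r in Iic t, total ι A b r (w n r) (Q n h) ∂leb T
  energy : ∀ n t, ‖u n t‖ ^ 2
    ≤ ‖x‖ ^ 2 + 2 * ∫ r in Iic t, total ι A b r (w n r) (w n r) ∂leb T + ε n

variable {d : ℕ → V} {x : H} {R C₁ : ℝ} {ε : ℕ → ℝ} {Q : ℕ → H →L[ℝ] V}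
  {w : ℕ → Time T → V} {u : ℕ → Time T → H}

theorem GalerkinSeq.comp (hG : GalerkinSeq ι A b α d x R C₁ ε Q w u) {σ : ℕ → ℕ}
    (hσ : Tendsto σ atTop atTop) :
    GalerkinSeq ι A b α d x R C₁ (ε ∘ σ) (Q ∘ σ) (w ∘ σ) (u ∘ σ) where
  Q_norm _ := hG.Q_norm _
  Q_symm _ := hG.Q_symm _
  Q_eq j := hσ.eventually (hG.Q_eq j)
  Q_tendsto h := (hG.Q_tendsto h).comp hσ
  eps_tendsto := hG.eps_tendsto.comp hσ
  R_nonneg := hG.R_nonneg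
  C₁_nonneg := hG.C₁_nonneg
  w_meas _ := hG.w_meas _
  u_cont _ := hG.u_cont _
  u_le _ := hG.u_le _
  w_le _ := hG.w_le _
  close _ := hG.close _
  memLp _ := hG.memLp _
  int_le _ := hG.int_le _
  eqn _ := hG.eqn _
  energy _ := hG.energy _

theorem EvolutionData.exists_galerkinSeq [BorelSpace V] [BorelSpace H] [CompleteSpace H]
    [SecondCountableTopology H] [SecondCountableTopology (StrongDual ℝ V)]
    (hE : EvolutionData ι A b α β θ C k F c) (hT : 0 < T) (hι : DenseRange ι)
    (hQ : FiniteRankApprox ι d Q) (x : H) : ∃ (R C₁ : ℝ) (ε : ℕ → ℝ) (w : ℕ → Time T → V)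
      (u : ℕ → Time T → H), GalerkinSeq ι A b α d x R C₁ ε Q w u := by
  obtain ⟨R, C₁, hR, hC₁, h⟩ := hE.exists_galerkin hT x
  choose w u h1 h2 h3 h4 h5 h6 h7 h8 h9 using fun n : ℕ =>
    h (Q n) (hQ.norm_le n) (1 / ((n : ℝ) + 1)) (by positivity)
  exact ⟨R, C₁, _, w, u, hQ.norm_le, hQ.symm, fun j => (eventually_gt_atTop j).mono fun n hn =>
    hQ.apply_eq j n hn, hQ.tendsto hι, tendsto_one_div_add_atTop_nhds_zero_nat, hR, hC₁, h1, h2,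
    h3, h4, h5, h6, h7, h8, h9⟩

/-- The uniform bound for `∫ ‖A(s, w n s)‖^{α'} ds`. -/
def dualBound (β C C₁ R : ℝ) (F : Time T → ℝ) : ℝ :=
  ((∫ s, F s ∂leb T) + C * C₁) * (1 + R ^ β)

theorem EvolutionData.dualBound_nonneg (hE : EvolutionData ι A b α β θ C k F c) (hC₁ : 0 ≤ C₁)
    (hR : 0 ≤ R) : 0 ≤ dualBound β C C₁ R F := by
  have h1 : 0 ≤ ∫ s, F s ∂leb T := integral_nonneg hE.F_nonneg
  have h2 := hE.C_nonneg
  unfold dualBound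
  positivity

theorem integrable_norm_rpow {E : Type*} [NormedAddCommGroup E] (hα : 1 ≤ α) {v : Time T → E}
    (hv : MemLp v (ENNReal.ofReal α) (leb T)) : Integrable (fun s => ‖v s‖ ^ α) (leb T) := by
  simpa using integrable_norm_sub_rpow hα hv (v := 0) MemLp.zero

/-- The principal part along a function in `L^α([0,T],V) ∩ L^∞([0,T],H)` is in
`L^{α'}([0,T],V*)`. -/
theorem EvolutionData.integrable_A_rpow [BorelSpace V] [SecondCountableTopology (StrongDual ℝ V)]
    (hE : EvolutionData ι A b α β θ C k F c) {v : Time T → V} (hv : Measurable v)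
    (hvα : MemLp v (ENNReal.ofReal α) (leb T)) (hR : 0 ≤ R) (hvR : ∀ᵐ s ∂leb T, ‖ι (v s)‖ ≤ R)
    (hvC : ∫ s, ‖v s‖ ^ α ∂leb T ≤ C₁) :
    AEStronglyMeasurable (fun s => A s (v s)) (leb T) ∧
    Integrable (fun s => ‖A s (v s)‖ ^ (α / (α - 1))) (leb T) ∧
    ∫ s, ‖A s (v s)‖ ^ (α / (α - 1)) ∂leb T ≤ dualBound β C C₁ R F := by
  have hm : Measurable fun s => A s (v s) := hE.measurable_A.comp (measurable_id.prodMk hv)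
  have hvi := integrable_norm_rpow hE.one_lt.le hvα
  have hC := hE.C_nonneg
  have hβ := hE.beta_nonneg
  have hdom : Integrable (fun s => (F s + C * ‖v s‖ ^ α) * (1 + R ^ β)) (leb T) :=
    (hE.F_int.add (hvi.const_mul _)).mul_const _
  have hle : ∀ᵐ s ∂leb T, ‖A s (v s)‖ ^ (α / (α - 1)) ≤ (F s + C * ‖v s‖ ^ α) * (1 + R ^ β) := by
    filter_upwards [hvR] with s hs
    have hF := hE.F_nonneg s
    refine (hE.growth s (v s)).trans ?_
    gcongr
  have hint : Integrable (fun s => ‖A s (v s)‖ ^ (α / (α - 1))) (leb T) := by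
    refine hdom.mono' (hm.norm.pow_const _).aestronglyMeasurable ?_
    filter_upwards [hle] with s hs
    rwa [Real.norm_of_nonneg (by positivity)]
  refine ⟨hm.aestronglyMeasurable, hint, (integral_mono_ae hint hdom hle).trans ?_⟩
  rw [integral_mul_const, integral_add hE.F_int (hvi.const_mul _), integral_const_mul, dualBound]
  gcongr

variable [BorelSpace V] [BorelSpace H] [SecondCountableTopology H]
  [SecondCountableTopology (StrongDual ℝ V)]

/-- Continuity of `y ↦ ∫ (A + b)(s, v s) y(s) ds` on `L^α([0,T],V)`, uniformly over the functions
`v` that satisfy the a priori bounds. -/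
theorem EvolutionData.exists_total_bound (hE : EvolutionData ι A b α β θ C k F c)
    (hC₁ : 0 ≤ C₁) (hR : 0 ≤ R) {η : ℝ} (hη : 0 < η) :
    ∃ K : ℝ, 0 ≤ K ∧ ∀ v : Time T → V, Measurable v → MemLp v (ENNReal.ofReal α) (leb T) →
      (∀ᵐ s ∂leb T, ‖ι (v s)‖ ≤ R) → ∫ s, ‖v s‖ ^ α ∂leb T ≤ C₁ →
      ∀ y : Time T → V, MemLp y (ENNReal.ofReal α) (leb T) → ∀ R' : ℝ,
      (∀ᵐ s ∂leb T, ‖ι (y s)‖ ≤ R') →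
      Integrable (fun s => total ι A b s (v s) (y s)) (leb T) ∧ ∀ S : Set (Time T),
      |∫ s in S, total ι A b s (v s) (y s) ∂leb T| ≤ η + K * ∫ s in S, ‖y s‖ ^ α ∂leb T
        + (1 + R) * ∫ s in S, c s * ‖ι (y s)‖ ∂leb T := by
  have hα := hE.one_lt
  set D := dualBound β C C₁ R F with hD
  have hD0 : 0 ≤ D := hE.dualBound_nonneg hC₁ hR
  obtain ⟨K, hK, hY⟩ := exists_young hα (ε := η / (D + 1)) (by positivity)
  refine ⟨K, hK, fun v hv hvα hvR hvC y hy R' hyR => ?_⟩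
  obtain ⟨hA1, hA2, hA3⟩ := hE.integrable_A_rpow hv hvα hR hvR hvC
  have hbm : Measurable fun s => b s (v s) := hE.measurable_b.comp (measurable_id.prodMk hv)
  have hιy : AEStronglyMeasurable (fun s => ι (y s)) (leb T) :=
    ι.continuous.comp_aestronglyMeasurable hy.1
  have hyi := integrable_norm_rpow hα.le hy
  have hcy : Integrable (fun s => c s * ‖ι (y s)‖) (leb T) :=
    hE.c_int.mul_bdd (c := R') hιy.norm (hyR.mono fun s hs => by rwa [norm_norm])
  have hb1 : ∀ᵐ s ∂leb T, ‖(inner ℝ (b s (v s)) (ι (y s)) : ℝ)‖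
      ≤ (1 + R) * (c s * ‖ι (y s)‖) := by
    filter_upwards [hvR] with s hs
    refine (norm_inner_le_norm _ _).trans ?_
    have h1 := hE.growth_b s (v s)
    have h2 := hE.c_nonneg s
    calc ‖b s (v s)‖ * ‖ι (y s)‖ ≤ (c s * (1 + R)) * ‖ι (y s)‖ := by
          gcongr
          exact h1.trans (by gcongr)
      _ = _ := by ring
  have hbi : Integrable (fun s => (inner ℝ (b s (v s)) (ι (y s)) : ℝ)) (leb T) :=
    (hcy.const_mul (1 + R)).mono' (hbm.aestronglyMeasurable.inner hιy) hb1
  have hAi := integrable_dual_apply hα hy hA1 hA2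
  have hti : Integrable (fun s => total ι A b s (v s) (y s)) (leb T) := hAi.add hbi
  refine ⟨hti, fun S => ?_⟩
  have hA4 : ∫ s in S, η / (D + 1) * ‖A s (v s)‖ ^ (α / (α - 1)) ∂leb T ≤ η := by
    calc ∫ s in S, η / (D + 1) * ‖A s (v s)‖ ^ (α / (α - 1)) ∂leb T
        ≤ ∫ s, η / (D + 1) * ‖A s (v s)‖ ^ (α / (α - 1)) ∂leb T :=
          setIntegral_le_integral (hA2.const_mul _) (Eventually.of_forall fun s => by
            simp only [Pi.zero_apply]; positivity)
      _ ≤ η / (D + 1) * D := by rw [integral_const_mul]; gcongr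
      _ = η * (D / (D + 1)) := by ring
      _ ≤ η := mul_le_of_le_one_right hη.le (div_le_one_of_le₀ (by linarith) (by linarith))
  have hle : |∫ s in S, total ι A b s (v s) (y s) ∂leb T|
      ≤ ∫ s in S, ((η / (D + 1) * ‖A s (v s)‖ ^ (α / (α - 1)) + K * ‖y s‖ ^ α)
        + (1 + R) * (c s * ‖ι (y s)‖)) ∂leb T := by
    rw [← Real.norm_eq_abs]
    refine norm_integral_le_of_norm_le (((hA2.const_mul _).add (hyi.const_mul _)).add
      (hcy.const_mul _)).integrableOn (ae_restrict_of_ae ?_)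
    filter_upwards [hb1] with s hs
    rw [total_apply]
    refine (norm_add_le _ _).trans (add_le_add ?_ hs)
    exact ((A s (v s)).le_opNorm _).trans (hY _ _ (norm_nonneg _) (norm_nonneg _))
  refine hle.trans ?_
  have i12 : Integrable (fun s => η / (D + 1) * ‖A s (v s)‖ ^ (α / (α - 1)) + K * ‖y s‖ ^ α)
    (leb T) := (hA2.const_mul _).add (hyi.const_mul _)
  rw [integral_add i12.integrableOn (hcy.const_mul _).integrableOn,
    integral_add (hA2.const_mul _).integrableOn (hyi.const_mul _).integrableOn,
    integral_const_mul K, integral_const_mul (1 + R)]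
  linarith

theorem GalerkinSeq.integrable_total (hG : GalerkinSeq ι A b α d x R C₁ ε Q w u)
    (hE : EvolutionData ι A b α β θ C k F c) (n : ℕ) (v : V) :
    Integrable (fun s => total ι A b s (w n s) v) (leb T) := by
  obtain ⟨K, -, h⟩ := hE.exists_total_bound hG.C₁_nonneg hG.R_nonneg one_pos
  exact (h (w n) (hG.w_meas n) (hG.memLp n) (Eventually.of_forall (hG.w_le n)) (hG.int_le n)
    (fun _ => v) (memLp_const v) ‖ι v‖ (Eventually.of_forall fun _ => le_rfl)).1

theorem GalerkinSeq.inner_sub (hG : GalerkinSeq ι A b α d x R C₁ ε Q w u)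
    (hE : EvolutionData ι A b α β θ C k F c) (n : ℕ) {s t : Time T} (hst : s ≤ t) (h : H) :
    inner ℝ (u n t - u n s) h = ∫ r in Ioc s t, total ι A b r (w n r) (Q n h) ∂leb T := by
  rw [setIntegral_Iic_sub (hG.integrable_total hE n _) hst, ← hG.eqn n t, ← hG.eqn n s,
    ← inner_sub_left, sub_sub_sub_cancel_right]

/-- The approximations are equicontinuous in time when tested with the vectors `d j`. -/
theorem GalerkinSeq.equicontinuous (hG : GalerkinSeq ι A b α d x R C₁ ε Q w u)
    (hE : EvolutionData ι A b α β θ C k F c) (j : ℕ) {e : ℝ} (he : 0 < e) :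
    ∃ δ > 0, ∀ᶠ n in atTop, ∀ s t : Time T, s ≤ t → (t : ℝ) - s < δ →
      |inner ℝ (u n t - u n s) (ι (d j))| ≤ e := by
  obtain ⟨K, hK, h⟩ := hE.exists_total_bound hG.C₁_nonneg hG.R_nonneg (η := e / 2) (by positivity)
  have hi : Integrable (fun s => K * ‖d j‖ ^ α + (1 + R) * (c s * ‖ι (d j)‖)) (leb T) :=
    (integrable_const _).add ((hE.c_int.mul_const _).const_mul _)
  obtain ⟨δ, hδ, hδ'⟩ := exists_norm_setIntegral_Ioc_le hi (ε := e / 2) (by positivity)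
  refine ⟨δ, hδ, (hG.Q_eq j).mono fun n hn s t hst hd => ?_⟩
  rw [hG.inner_sub hE n hst, hn]
  have h1 := (h (w n) (hG.w_meas n) (hG.memLp n) (Eventually.of_forall (hG.w_le n)) (hG.int_le n)
    (fun _ => d j) (memLp_const _) ‖ι (d j)‖ (Eventually.of_forall fun _ => le_rfl)).2 (Ioc s t)
  have h2 := hδ' s t hst hd
  have h3 := (le_abs_self _).trans h2
  have h4 : ∫ r in Ioc s t, (K * ‖d j‖ ^ α + (1 + R) * (c r * ‖ι (d j)‖)) ∂leb T
      = K * ∫ r in Ioc s t, ‖d j‖ ^ α ∂leb T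
        + (1 + R) * ∫ r in Ioc s t, c r * ‖ι (d j)‖ ∂leb T := by
    rw [integral_add (integrable_const _) ((hE.c_int.mul_const _).const_mul _).integrableOn,
      integral_const_mul (1 + R), ← integral_const_mul K]
  linarith

/-- A subsequence converges weakly in `H` at every time: a diagonal argument gives convergence, tested
with the vectors `d j`, at a dense set of times, and the equicontinuity extends it to all times. -/
theorem GalerkinSeq.exists_subseq [CompleteSpace H]
    (hG : GalerkinSeq ι A b α d x R C₁ ε Q w u) (hT : 0 < T) (hι : DenseRange ι)
    (hd : DenseRange d) (hE : EvolutionData ι A b α β θ C k F c) :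
    ∃ (σ : ℕ → ℕ) (u₀ : Time T → H), StrictMono σ ∧ (∀ t, ‖u₀ t‖ ≤ R) ∧
      ∀ t h, Tendsto (fun n => inner ℝ (u (σ n) t) h) atTop (𝓝 (inner ℝ (u₀ t) h)) := by
  have : Nonempty (Time T) := ⟨⟨0, le_rfl, hT.le⟩⟩
  set q := TopologicalSpace.denseSeq (Time T) with hq
  -- a diagonal subsequence along which the tested approximations converge at a dense set of times
  let a : ℕ → ℕ × ℕ → ℝ := fun n p => inner ℝ (u n (q p.1)) (ι (d p.2))
  have hcomp : IsCompact (univ.pi fun p : ℕ × ℕ => Icc (-(R * ‖ι (d p.2)‖)) (R * ‖ι (d p.2)‖)) :=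
    isCompact_univ_pi fun _ => isCompact_Icc
  have ha : ∀ n, a n ∈ univ.pi fun p : ℕ × ℕ =>
      Icc (-(R * ‖ι (d p.2)‖)) (R * ‖ι (d p.2)‖) := fun n p _ => by
    rw [mem_Icc, ← abs_le]
    exact (abs_real_inner_le_norm _ _).trans
      (mul_le_mul_of_nonneg_right (hG.u_le _ _) (norm_nonneg _))
  obtain ⟨l, -, σ, hσ, hl⟩ := hcomp.tendsto_subseq ha
  rw [tendsto_pi_nhds] at hl
  have hGσ := hG.comp hσ.tendsto_atTop
  have hconv : ∀ (t : Time T) (j : ℕ),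
      ∃ z : ℝ, Tendsto (fun n => inner ℝ (u (σ n) t) (ι (d j))) atTop (𝓝 z) := by
    intro t j
    refine cauchySeq_tendsto_of_complete (Metric.cauchySeq_iff'.2 fun e he => ?_)
    obtain ⟨δ, hδ, heq⟩ := hGσ.equicontinuous hE j (e := e / 8) (by positivity)
    obtain ⟨i, hi⟩ := (TopologicalSpace.denseRange_denseSeq (Time T)).exists_dist_lt t hδ
    rw [← hq, Subtype.dist_eq, Real.dist_eq] at hi
    have hclose : ∀ᶠ n in atTop,
        |(inner ℝ (u (σ n) t) (ι (d j)) : ℝ) - inner ℝ (u (σ n) (q i)) (ι (d j))| ≤ e / 8 := by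
      filter_upwards [heq] with n hn
      rw [← inner_sub_left]
      rcases le_total (q i) t with h1 | h1
      · exact hn _ _ h1 ((le_abs_self _).trans_lt hi)
      · rw [← neg_sub, inner_neg_left, abs_neg]
        refine hn _ _ h1 ((le_abs_self _).trans_lt ?_)
        rwa [abs_sub_comm]
    obtain ⟨N, hN⟩ := Metric.cauchySeq_iff.1 (hl (i, j)).cauchySeq (e / 8) (by positivity)
    obtain ⟨N', hN'⟩ := eventually_atTop.1 hclose
    refine ⟨max N N', fun n hn => ?_⟩
    have h1 := abs_le.1 (hN' n (le_of_max_le_right hn))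
    have h2 := abs_le.1 (hN' (max N N') (le_max_right _ _))
    have h3 := hN n (le_of_max_le_left hn) (max N N') (le_max_left _ _)
    rw [Real.dist_eq] at h3 ⊢
    have h3' := abs_lt.1 h3
    simp only [Function.comp_apply, a] at h3'
    rw [abs_lt]
    constructor <;> linarith [h1.1, h1.2, h2.1, h2.2, h3'.1, h3'.2]
  have hdense : DenseRange (ι ∘ d) := hι.comp hd ι.continuous
  have hlim : ∀ t, ∃ y₀ : H, ‖y₀‖ ≤ R ∧ ∀ h : H,
      Tendsto (fun n => inner ℝ (u (σ n) t) h) atTop (𝓝 (inner ℝ y₀ h)) := fun t =>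
    exists_weak_limit (fun n => hG.u_le (σ n) t) hdense (by
      rintro _ ⟨j, rfl⟩
      exact hconv t j)
  choose u₀ h1 h2 using hlim
  exact ⟨σ, u₀, hσ, h1, h2⟩

/-- The weak limits have values in `V` for almost every time, and lie in `L^α([0,T],V)`: by Fatou's
lemma the norms in `V` are bounded along a subsequence for almost every time. -/
theorem GalerkinSeq.exists_limit [CompleteSpace H] [CompleteSpace V]
    [TopologicalSpace.SeparableSpace V]
    (hG : GalerkinSeq ι A b α d x R C₁ ε Q w u) (hV : IsReflexive V) (hι : Function.Injective ι)
    (hι' : DenseRange ι) {Q' : ℕ → H →L[ℝ] V} (hQ' : FiniteRankApprox ι d Q')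
    (hE : EvolutionData ι A b α β θ C k F c) {u₀ : Time T → H}
    (hu₀ : ∀ t h, Tendsto (fun n => inner ℝ (u n t) h) atTop (𝓝 (inner ℝ (u₀ t) h))) :
    Measurable u₀ ∧
    (∀ t h, Tendsto (fun n => inner ℝ (ι (w n t)) h) atTop (𝓝 (inner ℝ (u₀ t) h))) ∧
    ∃ w₀ : Time T → V, Measurable w₀ ∧ MemLp w₀ (ENNReal.ofReal α) (leb T) ∧
      ∫ s, ‖w₀ s‖ ^ α ∂leb T ≤ C₁ ∧ ∀ᵐ s ∂leb T, ι (w₀ s) = u₀ s := by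
  have hα := hE.one_lt
  have hα0 : 0 < α := by linarith
  have hum : Measurable u₀ := by
    refine hQ'.measurable hι' fun h => ?_
    exact measurable_of_tendsto_metrizable
      (fun n => ((hG.u_cont n).inner continuous_const).measurable)
      (tendsto_pi_nhds.2 fun t => hu₀ t h)
  have hwlim : ∀ t h, Tendsto (fun n => inner ℝ (ι (w n t)) h) atTop (𝓝 (inner ℝ (u₀ t) h)) := by
    intro t h
    have h1 : Tendsto (fun n => inner ℝ (ι (w n t) - ι (Q n (u n t))) h) atTop (𝓝 (0 : ℝ)) := by
      refine squeeze_zero_norm (a := fun n => ε n * ‖h‖) (fun n => ?_)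
        (by simpa using hG.eps_tendsto.mul_const ‖h‖)
      exact (norm_inner_le_norm _ _).trans
        (mul_le_mul_of_nonneg_right (hG.close n t) (norm_nonneg _))
    have h2 : Tendsto (fun n => inner ℝ (u n t) (ι (Q n h) - h)) atTop (𝓝 (0 : ℝ)) := by
      refine squeeze_zero_norm (a := fun n => R * ‖ι (Q n h) - h‖) (fun n => ?_) ?_
      · exact (norm_inner_le_norm _ _).trans
          (mul_le_mul_of_nonneg_right (hG.u_le n t) (norm_nonneg _))
      · have h3 := ((hG.Q_tendsto h).sub_const h).norm.const_mul R
        simpa using h3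
    have h3 := (h1.add h2).add (hu₀ t h)
    rw [zero_add, zero_add] at h3
    refine h3.congr fun n => ?_
    rw [inner_sub_left, inner_sub_right, hG.Q_symm]
    ring
  refine ⟨hum, hwlim, ?_⟩
  have hemb : MeasurableEmbedding ι := ι.continuous.measurableEmbedding hι
  set w₀ : Time T → V := fun s => hemb.invFun (u₀ s) with hw₀
  have hw₀m : Measurable w₀ := hemb.measurable_invFun.comp hum
  have hwlint : ∀ n, ∫⁻ s, ‖w n s‖ₑ ^ α ∂leb T ≤ ENNReal.ofReal C₁ := by
    intro n
    have h1 := integrable_norm_rpow hα.le (hG.memLp n)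
    have h2 := ENNReal.ofReal_le_ofReal (hG.int_le n)
    rw [ofReal_integral_eq_lintegral_ofReal h1 (Eventually.of_forall fun s => by positivity)] at h2
    refine le_of_eq_of_le (lintegral_congr fun s => ?_) h2
    rw [← ENNReal.ofReal_rpow_of_nonneg (norm_nonneg _) hα0.le, ofReal_norm]
  have hwm : ∀ n, Measurable fun s => ‖w n s‖ₑ ^ α := fun n => (hG.w_meas n).enorm.pow_const α
  have hfatou : ∫⁻ s, liminf (fun n => ‖w n s‖ₑ ^ α) atTop ∂leb T ≤ ENNReal.ofReal C₁ := by
    refine (lintegral_liminf_le hwm).trans ?_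
    refine liminf_le_of_le (by isBoundedDefault) fun z hz => ?_
    obtain ⟨n, hn⟩ := hz.exists
    exact hn.trans (hwlint n)
  have hfin : ∀ᵐ s ∂leb T, liminf (fun n => ‖w n s‖ₑ ^ α) atTop < ∞ :=
    ae_lt_top (Measurable.liminf hwm) (hfatou.trans_lt ENNReal.ofReal_lt_top).ne
  have hpt : ∀ s, ∀ z : ℝ≥0∞, z ≠ ∞ → liminf (fun n => ‖w n s‖ₑ ^ α) atTop < z →
      ι (w₀ s) = u₀ s ∧ ‖w₀ s‖ₑ ^ α ≤ z := by
    intro s z hz hlt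
    have hfr : ∃ᶠ n in atTop, ‖w n s‖ ≤ (z.toReal) ^ (1 / α) := by
      refine (frequently_lt_of_liminf_lt (by isBoundedDefault) hlt).mono fun n hn => ?_
      have h1 : ‖w n s‖ ^ α ≤ z.toReal := by
        have h2 := ENNReal.toReal_mono hz hn.le
        rwa [← ENNReal.toReal_rpow, toReal_enorm] at h2
      calc ‖w n s‖ = (‖w n s‖ ^ α) ^ (1 / α) := by
            rw [← Real.rpow_mul (norm_nonneg _), mul_one_div_cancel hα0.ne', Real.rpow_one]
        _ ≤ _ := Real.rpow_le_rpow (by positivity) h1 (by positivity)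
    obtain ⟨v₀, hv₀, hv₀r⟩ := exists_preimage_of_weak_limit hV hfr (hwlim s)
    have h3 : w₀ s = v₀ := by
      simp only [hw₀, ← hv₀]
      exact hemb.leftInverse_invFun v₀
    refine ⟨by rw [h3, hv₀], ?_⟩
    rw [h3, ← ofReal_norm, ENNReal.ofReal_rpow_of_nonneg (norm_nonneg _) hα0.le]
    refine ENNReal.ofReal_le_of_le_toReal ?_
    calc ‖v₀‖ ^ α ≤ (z.toReal ^ (1 / α)) ^ α := Real.rpow_le_rpow (norm_nonneg _) hv₀r hα0.le
      _ = z.toReal := by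
        rw [← Real.rpow_mul ENNReal.toReal_nonneg, one_div_mul_cancel hα0.ne', Real.rpow_one]
  have hle : ∫⁻ s, ‖w₀ s‖ₑ ^ α ∂leb T ≤ ENNReal.ofReal C₁ := by
    refine (lintegral_mono_ae ?_).trans hfatou
    filter_upwards [hfin] with s hs
    refine le_of_forall_gt fun z hz => ?_
    obtain ⟨z', h1, h2⟩ := exists_between hz
    exact ((hpt s z' (ne_top_of_lt h2) h1).2).trans_lt h2
  have hLp : MemLp w₀ (ENNReal.ofReal α) (leb T) := by
    refine ⟨hw₀m.aestronglyMeasurable, ?_⟩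
    rw [eLpNorm_lt_top_iff_lintegral_rpow_enorm_lt_top (by simpa using hα0) ENNReal.ofReal_ne_top,
      ENNReal.toReal_ofReal hα0.le]
    exact hle.trans_lt ENNReal.ofReal_lt_top
  refine ⟨w₀, hw₀m, hLp, ?_, ?_⟩
  · have h1 := setIntegral_norm_rpow_eq_toReal hα0.le hLp.1 univ
    rw [setIntegral_univ, setLIntegral_univ] at h1
    rw [h1]
    exact ENNReal.toReal_le_of_le_ofReal hG.C₁_nonneg hle
  · filter_upwards [hfin] with s hs
    obtain ⟨z, h1, h2⟩ := exists_between hs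
    exact (hpt s z h2.ne h1).1

end

/-! ### Integrals along weakly convergent approximations -/

section

variable {T : ℝ} {V : Type*} [NormedAddCommGroup V] [NormedSpace ℝ V]
  {H : Type*} [NormedAddCommGroup H] [InnerProductSpace ℝ H]
  {ι : V →L[ℝ] H}

/-- On functions with bounded `H`-norm, a weighted `L¹([0,T],H)`-norm is controlled by the norm of
`L^α([0,T],V)` up to a small error: the weight is truncated at a high level. -/
theorem exists_weight_bound {α : ℝ} (hα : 1 < α) (ι : V →L[ℝ] H) {c : Time T → ℝ}
    (hc : Integrable c (leb T)) (hc0 : ∀ s, 0 ≤ c s) {η R' : ℝ} (hη : 0 < η) (hR' : 0 ≤ R') :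
    ∃ K : ℝ, 0 ≤ K ∧ ∀ y : Time T → V, MemLp y (ENNReal.ofReal α) (leb T) →
      (∀ᵐ s ∂leb T, ‖ι (y s)‖ ≤ R') → ∀ S : Set (Time T),
      ∫ s in S, c s * ‖ι (y s)‖ ∂leb T ≤ η + K * ∫ s in S, ‖y s‖ ^ α ∂leb T := by
  have hmin : ∀ M : ℕ, Integrable (fun s => c s - min (c s) M) (leb T) := fun M =>
    hc.sub (hc.inf (integrable_const (M : ℝ)))
  have hlim : Tendsto (fun M : ℕ => ∫ s, (c s - min (c s) M) ∂leb T) atTop (𝓝 0) := by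
    have h := tendsto_integral_of_dominated_convergence (F := fun (M : ℕ) s => c s - min (c s) M)
      (f := fun _ => (0 : ℝ)) (μ := leb T) c (fun M => (hmin M).1) hc
      (fun M => Eventually.of_forall fun s => by
        have h1 : min (c s) (M : ℝ) ≤ c s := min_le_left _ _
        have h2 : 0 ≤ min (c s) (M : ℝ) := le_min (hc0 s) (by positivity)
        rw [Real.norm_of_nonneg (by linarith)]; linarith)
      (Eventually.of_forall fun s => by
        refine tendsto_const_nhds.congr' ?_
        filter_upwards [eventually_ge_atTop ⌈c s⌉₊] with M hM
        rw [min_eq_left (Nat.ceil_le.1 hM), sub_self])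
    simpa using h
  obtain ⟨M, hM⟩ := (hlim.eventually (gt_mem_nhds
    (show (0 : ℝ) < η / (2 * (R' + 1)) by positivity))).exists
  set D : ℝ := (M * ‖ι‖) ^ (α / (α - 1)) * (leb T).real univ with hD
  have hD0 : 0 ≤ D := by positivity
  obtain ⟨K, hK, hY⟩ := exists_young hα (ε := η / (2 * (D + 1))) (by positivity)
  refine ⟨K, hK, fun y hy hyR S => ?_⟩
  have hyi := integrable_norm_rpow hα.le hy
  set E : ℝ := η / (2 * (D + 1)) * (M * ‖ι‖) ^ (α / (α - 1)) with hE
  have i1 : Integrable (fun s => (c s - min (c s) M) * R' + E) (leb T) :=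
    ((hmin M).mul_const _).add (integrable_const _)
  have i2 : Integrable (fun s => K * ‖y s‖ ^ α) (leb T) := hyi.const_mul _
  have hle : ∀ᵐ s ∂leb T, c s * ‖ι (y s)‖ ≤ ((c s - min (c s) M) * R' + E) + K * ‖y s‖ ^ α := by
    filter_upwards [hyR] with s hs
    have h1 : min (c s) (M : ℝ) ≤ c s := min_le_left _ _
    have h2 : min (c s) (M : ℝ) ≤ M := min_le_right _ _
    have h3 := hY (M * ‖ι‖) ‖y s‖ (by positivity) (norm_nonneg _)
    have h4 := ι.le_opNorm (y s)
    have h5 : min (c s) (M : ℝ) * ‖ι (y s)‖ ≤ M * (‖ι‖ * ‖y s‖) := by gcongr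
    have h6 : (c s - min (c s) M) * ‖ι (y s)‖ ≤ (c s - min (c s) M) * R' :=
      mul_le_mul_of_nonneg_left hs (by linarith)
    calc c s * ‖ι (y s)‖ = (c s - min (c s) M) * ‖ι (y s)‖ + min (c s) (M : ℝ) * ‖ι (y s)‖ := by
          ring
      _ ≤ _ := by linarith
  have hci : Integrable (fun s => c s * ‖ι (y s)‖) (leb T) :=
    hc.mul_bdd (c := R') (ι.continuous.comp_aestronglyMeasurable hy.1).norm
      (hyR.mono fun s hs => by rwa [norm_norm])
  have h0 : ∫ s in S, ((c s - min (c s) M) * R' + E) ∂leb T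
      ≤ ∫ s, ((c s - min (c s) M) * R' + E) ∂leb T :=
    setIntegral_le_integral i1 (Eventually.of_forall fun s => by
      have h1 : min (c s) (M : ℝ) ≤ c s := min_le_left _ _
      have h2 : 0 ≤ (c s - min (c s) M) * R' := mul_nonneg (by linarith) hR'
      have h3 : 0 ≤ E := by positivity
      simp only [Pi.zero_apply]; linarith)
  have h1 : ∫ s, ((c s - min (c s) M) * R' + E) ∂leb T ≤ η := by
    rw [integral_add ((hmin M).mul_const _) (integrable_const _), integral_mul_const,
      integral_const, smul_eq_mul]
    have h2 : (∫ s, (c s - min (c s) M) ∂leb T) * R' ≤ η / 2 := by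
      calc (∫ s, (c s - min (c s) M) ∂leb T) * R' ≤ η / (2 * (R' + 1)) * R' := by gcongr
        _ = η / 2 * (R' / (R' + 1)) := by field_simp
        _ ≤ η / 2 := mul_le_of_le_one_right (by positivity)
          (div_le_one_of_le₀ (by linarith) (by linarith))
    have h3 : (leb T).real univ * E ≤ η / 2 := by
      calc (leb T).real univ * E = η / 2 * (D / (D + 1)) := by rw [hE, hD]; field_simp
        _ ≤ η / 2 := mul_le_of_le_one_right (by positivity)
          (div_le_one_of_le₀ (by linarith) (by linarith))
    linarith
  calc ∫ s in S, c s * ‖ι (y s)‖ ∂leb T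
      ≤ ∫ s in S, (((c s - min (c s) M) * R' + E) + K * ‖y s‖ ^ α) ∂leb T :=
        integral_mono_ae hci.integrableOn (i1.add i2).integrableOn (ae_restrict_of_ae hle)
    _ = ∫ s in S, ((c s - min (c s) M) * R' + E) ∂leb T + K * ∫ s in S, ‖y s‖ ^ α ∂leb T := by
        rw [integral_add i1.integrableOn i2.integrableOn, integral_const_mul]
    _ ≤ _ := by linarith

variable [MeasurableSpace V] [MeasurableSpace H]
  {A : Time T → V → StrongDual ℝ V} {b : Time T → V → H} {α β θ C : ℝ} {k F c : Time T → ℝ}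
  {d : ℕ → V} {x : H} {R C₁ : ℝ} {ε : ℕ → ℝ} {Q : ℕ → H →L[ℝ] V}
  {w : ℕ → Time T → V} {u : ℕ → Time T → H} {u₀ : Time T → H} {w₀ : Time T → V}

/-- A sequence of approximations together with its weak limit: `u₀` with values in `H`, and its
`V`-valued version `w₀`. -/
structure WeakLimit (ι : V →L[ℝ] H) (A : Time T → V → StrongDual ℝ V) (b : Time T → V → H)
    (α : ℝ) (d : ℕ → V) (x : H) (R C₁ : ℝ) (ε : ℕ → ℝ) (Q : ℕ → H →L[ℝ] V)
    (w : ℕ → Time T → V) (u : ℕ → Time T → H) (w₀ : Time T → V) (u₀ : Time T → H) : Prop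
    extends GalerkinSeq ι A b α d x R C₁ ε Q w u where
  dense : DenseRange d
  u_weak : ∀ t h, Tendsto (fun n => inner ℝ (u n t) h) atTop (𝓝 (inner ℝ (u₀ t) h))
  w_weak : ∀ t h, Tendsto (fun n => inner ℝ (ι (w n t)) h) atTop (𝓝 (inner ℝ (u₀ t) h))
  u₀_meas : Measurable u₀
  u₀_le : ∀ t, ‖u₀ t‖ ≤ R
  w₀_meas : Measurable w₀
  w₀_memLp : MemLp w₀ (ENNReal.ofReal α) (leb T)
  w₀_int_le : ∫ s, ‖w₀ s‖ ^ α ∂leb T ≤ C₁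
  w₀_eq : ∀ᵐ s ∂leb T, ι (w₀ s) = u₀ s

variable [BorelSpace V] [BorelSpace H] [SecondCountableTopology H]
  [SecondCountableTopology (StrongDual ℝ V)]

/-- The bound of `EvolutionData.exists_total_bound` in terms of the norm of `L^α([0,T],V)` alone,
for functions with a fixed bound in `H`. -/
theorem EvolutionData.exists_total_bound' (hE : EvolutionData ι A b α β θ C k F c)
    (hC₁ : 0 ≤ C₁) (hR : 0 ≤ R) {η : ℝ} (hη : 0 < η) {R' : ℝ} (hR' : 0 ≤ R') :
    ∃ K : ℝ, 0 ≤ K ∧ ∀ v : Time T → V, Measurable v → MemLp v (ENNReal.ofReal α) (leb T) →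
      (∀ᵐ s ∂leb T, ‖ι (v s)‖ ≤ R) → ∫ s, ‖v s‖ ^ α ∂leb T ≤ C₁ →
      ∀ y : Time T → V, MemLp y (ENNReal.ofReal α) (leb T) → (∀ᵐ s ∂leb T, ‖ι (y s)‖ ≤ R') →
      Integrable (fun s => total ι A b s (v s) (y s)) (leb T) ∧ ∀ S : Set (Time T),
      |∫ s in S, total ι A b s (v s) (y s) ∂leb T| ≤ η + K * ∫ s in S, ‖y s‖ ^ α ∂leb T := by
  obtain ⟨K, hK, h⟩ := hE.exists_total_bound hC₁ hR (half_pos hη)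
  obtain ⟨K', hK', h'⟩ := exists_weight_bound hE.one_lt ι hE.c_int hE.c_nonneg
    (η := η / (2 * (1 + R))) (by positivity) hR'
  refine ⟨K + (1 + R) * K', by positivity, fun v h1 h2 h3 h4 y h5 h6 => ?_⟩
  obtain ⟨h7, h8⟩ := h v h1 h2 h3 h4 y h5 R' h6
  refine ⟨h7, fun S => (h8 S).trans ?_⟩
  have h9 := mul_le_mul_of_nonneg_left (h' y h5 h6 S) (by linarith : 0 ≤ 1 + R)
  have h10 : (1 + R) * (η / (2 * (1 + R))) = η / 2 := by field_simp
  rw [mul_add, h10] at h9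
  linarith

/-- The increments of the approximations satisfy the limiting integral equation up to a vanishing
error when tested with a vector of `V`. -/
theorem WeakLimit.tendsto_inner_sub (hW : WeakLimit ι A b α d x R C₁ ε Q w u w₀ u₀)
    (hE : EvolutionData ι A b α β θ C k F c) {s t : Time T} (hst : s ≤ t) (v : V) :
    Tendsto (fun n => ∫ r in Ioc s t, total ι A b r (w n r) v ∂leb T) atTop
      (𝓝 (inner ℝ (u₀ t - u₀ s) (ι v))) := by
  have hα := hE.one_lt
  have hG := hW.toGalerkinSeq
  set e : ℕ → ℝ := fun n => ∫ r in Ioc s t, total ι A b r (w n r) v ∂leb T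
    - inner ℝ (u n t - u n s) (ι v) with he
  suffices h : Tendsto e atTop (𝓝 0) by
    have h2 := h.add ((hW.u_weak t (ι v)).sub (hW.u_weak s (ι v)))
    rw [zero_add, ← inner_sub_left] at h2
    refine h2.congr fun n => ?_
    rw [he, ← inner_sub_left]; ring
  rw [Metric.tendsto_atTop']
  intro η hη
  have hR := hG.R_nonneg
  obtain ⟨K, hK, h⟩ := hE.exists_total_bound' hG.C₁_nonneg hG.R_nonneg (η := η / 4)
    (by positivity) (R' := ‖ι‖) (norm_nonneg _)
  set μ := (leb T).real univ
  have hμ0 : 0 ≤ μ := by positivity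
  obtain ⟨j, hj⟩ := hW.dense.exists_dist_lt v
    (ε := min 1 (min (η / (4 * (K * μ + 1))) (η / (4 * (2 * R * ‖ι‖ + 1))))) (by positivity)
  rw [dist_eq_norm, lt_min_iff, lt_min_iff] at hj
  obtain ⟨hj1, hj2, hj3⟩ := hj
  obtain ⟨N, hN⟩ := eventually_atTop.1 (hG.Q_eq j)
  refine ⟨N, fun n hn => ?_⟩
  rw [Real.dist_eq, sub_zero]
  have h1 := h (w n) (hG.w_meas n) (hG.memLp n) (Eventually.of_forall (hG.w_le n)) (hG.int_le n)
    (fun _ => v - d j) (memLp_const _) (Eventually.of_forall fun _ =>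
      (ι.le_opNorm _).trans (mul_le_of_le_one_right (norm_nonneg _) hj1.le))
  have h2 := h1.2 (Ioc s t)
  have h3 : ∫ r in Ioc s t, total ι A b r (w n r) (d j) ∂leb T
      = inner ℝ (u n t - u n s) (ι (d j)) := by
    rw [hG.inner_sub hE n hst, hN n hn.le]
  have h4 : e n = ∫ r in Ioc s t, total ι A b r (w n r) (v - d j) ∂leb T
      - inner ℝ (u n t - u n s) (ι (v - d j)) := by
    simp only [map_sub, inner_sub_right]
    rw [integral_sub (hG.integrable_total hE n v).integrableOn
      (hG.integrable_total hE n (d j)).integrableOn, h3]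
    simp only [he]; ring
  have h5 : |(inner ℝ (u n t - u n s) (ι (v - d j)) : ℝ)| ≤ η / 4 := by
    calc |(inner ℝ (u n t - u n s) (ι (v - d j)) : ℝ)| ≤ (R + R) * (‖ι‖ * ‖v - d j‖) := by
          refine (abs_real_inner_le_norm _ _).trans ?_
          gcongr
          · exact (norm_sub_le _ _).trans (add_le_add (hG.u_le n t) (hG.u_le n s))
          · exact ι.le_opNorm _
      _ = (2 * R * ‖ι‖) * ‖v - d j‖ := by ring
      _ ≤ (2 * R * ‖ι‖ + 1) * (η / (4 * (2 * R * ‖ι‖ + 1))) := by gcongr; linarith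
      _ = η / 4 := by field_simp
  have h6 : K * ∫ _ in Ioc s t, ‖v - d j‖ ^ α ∂leb T ≤ η / 4 := by
    have h7 : ‖v - d j‖ ^ α ≤ ‖v - d j‖ := by
      have := Real.rpow_le_rpow_of_exponent_ge' (norm_nonneg (v - d j)) hj1.le zero_le_one hα.le
      rwa [Real.rpow_one] at this
    have h8 : ∫ _ in Ioc s t, ‖v - d j‖ ^ α ∂leb T ≤ μ * ‖v - d j‖ := by
      rw [setIntegral_const, smul_eq_mul]
      gcongr
      exact measureReal_mono (subset_univ _)
    calc K * ∫ _ in Ioc s t, ‖v - d j‖ ^ α ∂leb T ≤ K * (μ * ‖v - d j‖) := by gcongr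
      _ = (K * μ) * ‖v - d j‖ := by ring
      _ ≤ (K * μ + 1) * (η / (4 * (K * μ + 1))) := by gcongr; linarith
      _ = η / 4 := by field_simp
  rw [h4]
  refine (abs_sub _ _).trans_lt ?_
  linarith

/-- Weak convergence of the approximations in `L^α([0,T],V)`. Functionals with values in a dense
set of functionals `⟪h, ·⟫` suffice, and for these the pointwise weak convergence in `H` is
enough. -/
theorem WeakLimit.tendsto_dual [CompleteSpace V] (hW : WeakLimit ι A b α d x R C₁ ε Q w u w₀ u₀)
    (hα : 1 < α) (hd : DenseRange (toVDual ι))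
    {ξ : Time T → StrongDual ℝ V} (hξ : Measurable ξ)
    (hξ' : Integrable (fun s => ‖ξ s‖ ^ (α / (α - 1))) (leb T)) (S : Set (Time T)) :
    Tendsto (fun n => ∫ s in S, ξ s (w n s - w₀ s) ∂leb T) atTop (𝓝 0) := by
  have hG := hW.toGalerkinSeq
  have hC₁ := hG.C₁_nonneg
  have hq : 1 < α / (α - 1) := (Real.HolderConjugate.conjExponent hα).symm.lt
  set q := α / (α - 1) with hqdef
  have hq0 : 0 < q := by linarith
  rw [Metric.tendsto_atTop']
  intro e he
  -- bound for the differences in `L^α([0,T],V)`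
  set B : ℝ := 2 ^ (α - 1) * (C₁ + C₁) with hB
  have hB0 : 0 ≤ B := by positivity
  have hdiff : ∀ n, MemLp (fun s => w n s - w₀ s) (ENNReal.ofReal α) (leb T) := fun n =>
    (hG.memLp n).sub hW.w₀_memLp
  have hdB : ∀ n, ∫ s, ‖w n s - w₀ s‖ ^ α ∂leb T ≤ B := by
    intro n
    have i1 := integrable_norm_rpow hα.le (hG.memLp n)
    have i2 := integrable_norm_rpow hα.le hW.w₀_memLp
    calc ∫ s, ‖w n s - w₀ s‖ ^ α ∂leb T
        ≤ ∫ s, 2 ^ (α - 1) * (‖w n s‖ ^ α + ‖w₀ s‖ ^ α) ∂leb T := by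
          refine integral_mono (integrable_norm_rpow hα.le (hdiff n))
            ((i1.add i2).const_mul _) fun s => ?_
          refine (Real.rpow_le_rpow (norm_nonneg _) (norm_sub_le _ _) (by linarith)).trans ?_
          exact_mod_cast NNReal.rpow_add_le_mul_rpow_add_rpow ‖w n s‖₊ ‖w₀ s‖₊ hα.le
      _ ≤ B := by
          rw [integral_const_mul, integral_add i1 i2, hB]
          gcongr
          · exact hG.int_le n
          · exact hW.w₀_int_le
  -- approximation of `ξ` in `L^{α'}` by a simple function with values in the range of `H` in `V*`
  obtain ⟨K, hK, hY⟩ := exists_young (α := q) hq (ε := e / (4 * (B + 1))) (by positivity)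
  have hconj : q / (q - 1) = α := by
    have : α - 1 ≠ 0 := by linarith
    rw [hqdef]; field_simp; ring
  rw [hconj] at hY
  have hsep : TopologicalSpace.SeparableSpace (range (toVDual ι)) := inferInstance
  have h0 : (0 : StrongDual ℝ V) ∈ range (toVDual ι) := ⟨0, by ext v; simp [toVDual]⟩
  have hξp : MemLp ξ (ENNReal.ofReal q) (leb T) := by
    refine (integrable_norm_rpow_iff hξ.aestronglyMeasurable (by simpa using hq0)
      ENNReal.ofReal_ne_top).1 ?_
    rwa [ENNReal.toReal_ofReal hq0.le]
  have happ := SimpleFunc.tendsto_approxOn_Lp_eLpNorm (μ := leb T) (p := ENNReal.ofReal q) hξ h0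
    ENNReal.ofReal_ne_top (Eventually.of_forall fun s => hd _) (by simpa using hξp.2)
  set δ : ℝ := e / (4 * (K + 1)) with hδ
  have hδ0 : 0 < δ := by positivity
  obtain ⟨m, hm⟩ := (happ.eventually (gt_mem_nhds (show (0 : ℝ≥0∞) < ENNReal.ofReal (δ ^ (1 / q))
    from ENNReal.ofReal_pos.2 (by positivity)))).exists
  set φ := SimpleFunc.approxOn ξ hξ (range (toVDual ι)) 0 h0 m with hφ
  have hφξ : ∫ s, ‖ξ s - φ s‖ ^ q ∂leb T ≤ δ := by
    have h1 := setIntegral_norm_rpow_eq_toReal (T := T) hq0.le (v := fun s => ξ s - φ s)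
      (hξ.aestronglyMeasurable.sub φ.aestronglyMeasurable) univ
    rw [setIntegral_univ, setLIntegral_univ] at h1
    rw [h1]
    refine ENNReal.toReal_le_of_le_ofReal hδ0.le ?_
    rw [eLpNorm_eq_lintegral_rpow_enorm_toReal (by simpa using hq0) ENNReal.ofReal_ne_top,
      ENNReal.toReal_ofReal hq0.le] at hm
    have h2 := ENNReal.rpow_le_rpow hm.le hq0.le
    rw [← ENNReal.rpow_mul, one_div_mul_cancel hq0.ne', ENNReal.rpow_one,
      ENNReal.ofReal_rpow_of_nonneg (by positivity) hq0.le, ← Real.rpow_mul hδ0.le,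
      one_div_mul_cancel hq0.ne', Real.rpow_one] at h2
    refine le_of_eq_of_le (lintegral_congr fun s => ?_) h2
    rw [Pi.sub_apply, enorm_sub_rev]
  have hφp : MemLp φ (ENNReal.ofReal q) (leb T) := φ.memLp_of_isFiniteMeasure _ _
  have hξφi : Integrable (fun s => ‖ξ s - φ s‖ ^ q) (leb T) :=
    integrable_norm_rpow hq.le (hξp.sub hφp)
  have hφi : Integrable (fun s => ‖φ s‖ ^ q) (leb T) := integrable_norm_rpow hq.le hφp
  -- for the simple functional, the pointwise weak convergence in `H` is dominated
  obtain ⟨Mφ, hMφ⟩ : ∃ M, ∀ f ∈ range φ, ‖Function.invFun (toVDual ι) f‖ ≤ M := by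
    obtain ⟨M, hM⟩ := (φ.finite_range.image (Function.invFun (toVDual ι))).isBounded.exists_norm_le
    exact ⟨M, fun f hf => hM _ ⟨f, hf, rfl⟩⟩
  have hφeq : ∀ s v, φ s v = inner ℝ (Function.invFun (toVDual ι) (φ s)) (ι v) := fun s v => by
    conv_lhs => rw [← Function.invFun_eq (SimpleFunc.approxOn_mem hξ h0 m s)]
    rfl
  have hsimple : Tendsto (fun n => ∫ s in S, φ s (w n s - w₀ s) ∂leb T) atTop (𝓝 0) := by
    have h := tendsto_integral_of_dominated_convergence (μ := (leb T).restrict S)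
      (F := fun n s => φ s (w n s - w₀ s)) (f := fun _ => (0 : ℝ)) (fun _ => Mφ * (R + R))
      (fun n => (integrable_dual_apply hα (hdiff n) φ.aestronglyMeasurable hφi).1.restrict)
      (integrable_const _) (fun n => ae_restrict_of_ae ?_) (ae_restrict_of_ae ?_)
    · simpa using h
    · filter_upwards [hW.w₀_eq] with s hs
      rw [hφeq]
      refine (norm_inner_le_norm _ _).trans ?_
      have h1 := hMφ (φ s) ⟨s, rfl⟩
      gcongr
      · exact (norm_nonneg _).trans h1
      · rw [map_sub, hs]
        exact (norm_sub_le _ _).trans (add_le_add (hG.w_le n s) (hW.u₀_le s))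
    · filter_upwards [hW.w₀_eq] with s hs
      simp_rw [hφeq, map_sub, hs, inner_sub_right]
      have h1 := (hW.w_weak s (Function.invFun (toVDual ι) (φ s))).sub_const
        (inner ℝ (u₀ s) (Function.invFun (toVDual ι) (φ s)))
      simp_rw [real_inner_comm (Function.invFun (toVDual ι) (φ s))] at h1
      simpa using h1
  obtain ⟨N, hN⟩ := Metric.tendsto_atTop'.1 hsimple (e / 2) (by positivity)
  refine ⟨N, fun n hn => ?_⟩
  have h1 := hN n hn
  rw [Real.dist_eq, sub_zero] at h1 ⊢
  have i1 := integrable_dual_apply hα (hdiff n) φ.aestronglyMeasurable hφi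
  have i2 := integrable_dual_apply hα (hdiff n) hξ.aestronglyMeasurable hξ'
  have h2 : |∫ s in S, (ξ s (w n s - w₀ s) - φ s (w n s - w₀ s)) ∂leb T|
      ≤ K * δ + e / (4 * (B + 1)) * B := by
    have hdi := integrable_norm_rpow hα.le (hdiff n)
    have i3 : Integrable (fun s => K * ‖ξ s - φ s‖ ^ q
      + e / (4 * (B + 1)) * ‖w n s - w₀ s‖ ^ α) (leb T) :=
      (hξφi.const_mul _).add (hdi.const_mul _)
    calc |∫ s in S, (ξ s (w n s - w₀ s) - φ s (w n s - w₀ s)) ∂leb T|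
        ≤ ∫ s in S, (K * ‖ξ s - φ s‖ ^ q
            + e / (4 * (B + 1)) * ‖w n s - w₀ s‖ ^ α) ∂leb T := by
          rw [← Real.norm_eq_abs]
          refine norm_integral_le_of_norm_le i3.integrableOn (Eventually.of_forall fun s => ?_)
          have h3 := hY ‖w n s - w₀ s‖ ‖ξ s - φ s‖ (norm_nonneg _) (norm_nonneg _)
          have h4 := (ξ s - φ s).le_opNorm (w n s - w₀ s)
          rw [sub_apply] at h4
          linarith
      _ ≤ ∫ s, (K * ‖ξ s - φ s‖ ^ q + e / (4 * (B + 1)) * ‖w n s - w₀ s‖ ^ α) ∂leb T :=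
          setIntegral_le_integral i3 (Eventually.of_forall fun s => by
            simp only [Pi.zero_apply]; positivity)
      _ ≤ K * δ + e / (4 * (B + 1)) * B := by
          rw [integral_add (hξφi.const_mul _) (hdi.const_mul _), integral_const_mul,
            integral_const_mul]
          gcongr
          exact hdB n
  rw [integral_sub i2.integrableOn i1.integrableOn] at h2
  have h3 : K * δ ≤ e / 4 := by
    calc K * δ = e / 4 * (K / (K + 1)) := by rw [hδ]; field_simp
      _ ≤ e / 4 := mul_le_of_le_one_right (by positivity)
          (div_le_one_of_le₀ (by linarith) (by linarith))
  have h4 : e / (4 * (B + 1)) * B ≤ e / 4 := by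
    calc e / (4 * (B + 1)) * B = e / 4 * (B / (B + 1)) := by field_simp
      _ ≤ e / 4 := mul_le_of_le_one_right (by positivity)
          (div_le_one_of_le₀ (by linarith) (by linarith))
  have h5 := abs_le.1 h2
  have h6 := abs_lt.1 h1
  rw [abs_lt]
  constructor <;> linarith [h5.1, h5.2, h6.1, h6.2]

end

/-! ### Local monotonicity along the approximations -/

section

variable {T : ℝ}

theorem setIntegral_Iic_eq_Ioc {E : Type*} [NormedAddCommGroup E] [NormedSpace ℝ E]
    {f : Time T → E} (hf : Integrable f (leb T)) {s : Time T} (hs : (s : ℝ) = 0) (t : Time T) :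
    ∫ r in Iic t, f r ∂leb T = ∫ r in Ioc s t, f r ∂leb T := by
  have hst : s ≤ t := by rw [← Subtype.coe_le_coe, hs]; exact t.2.1
  have h0 : leb T (Iic s) = 0 := by
    have h1 : Iic s ⊆ {s} := fun r hr => by
      refine le_antisymm hr ?_
      rw [← Subtype.coe_le_coe, hs]
      exact r.2.1
    exact measure_mono_null h1 (measure_singleton _)
  rw [setIntegral_Iic_sub hf hst, setIntegral_measure_zero _ h0, sub_zero]

/-- A version of Gronwall's inequality for the convergence to zero of a sequence of functions. The
integral inequality is only assumed asymptotically, at each time separately. -/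
theorem tendsto_zero_of_gronwall (hT : 0 ≤ T) {κ : Time T → ℝ} (hκ : Integrable κ (leb T))
    (hκ0 : ∀ s, 0 ≤ κ s) {f : ℕ → Time T → ℝ} {M : ℝ} (hfm : ∀ n, Measurable (f n))
    (hf0 : ∀ n t, 0 ≤ f n t) (hfM : ∀ n t, f n t ≤ M)
    (h : ∀ t, ∀ e > 0, ∀ᶠ n in atTop, f n t ≤ e + ∫ s in Iic t, κ s * f n s ∂leb T) (t : Time T) :
    Tendsto (fun n => f n t) atTop (𝓝 0) := by
  have hbd : ∀ {g : Time T → ℝ}, Measurable g → (∀ s, 0 ≤ g s) → (∃ B, ∀ s, g s ≤ B) →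
      Integrable (fun s => κ s * g s) (leb T) := fun hg hg0 ⟨B, hB⟩ =>
    hκ.mul_bdd (c := B) hg.aestronglyMeasurable
      (Eventually.of_forall fun s => by rw [Real.norm_of_nonneg (hg0 s)]; exact hB s)
  have hκf : ∀ n, Integrable (fun s => κ s * f n s) (leb T) := fun n =>
    hbd (hfm n) (hf0 n) ⟨M, hfM n⟩
  set I : ℕ → Time T → ℝ := fun n t => ∫ s in Iic t, κ s * f n s ∂leb T with hI
  have hIc : ∀ n, Continuous (I n) := fun n => continuous_integral_Iic (hκf n)
  have hI0 : ∀ n s, 0 ≤ I n s := fun n s =>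
    integral_nonneg fun r => mul_nonneg (hκ0 r) (hf0 n r)
  have hIB : ∀ n s, I n s ≤ ∫ r, κ r * f n r ∂leb T := fun n s =>
    setIntegral_le_integral (hκf n) (Eventually.of_forall fun r => mul_nonneg (hκ0 r) (hf0 n r))
  -- the defect in the integral inequality tends to zero pointwise and boundedly, and Gronwall's
  -- inequality applies to the continuous functions `I n`
  set o : ℕ → Time T → ℝ := fun n t => max 0 (f n t - I n t) with ho
  have hom : ∀ n, Measurable (o n) := fun n =>
    measurable_const.max ((hfm n).sub (hIc n).measurable)
  have ho0 : ∀ n s, 0 ≤ o n s := fun n s => le_max_left _ _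
  have hoM : ∀ n s, o n s ≤ M := fun n s =>
    max_le ((hf0 n s).trans (hfM n s)) (by linarith [hI0 n s, hfM n s])
  have hfo : ∀ n s, f n s ≤ o n s + I n s := fun n s => by
    have := le_max_right 0 (f n s - I n s)
    simp only [ho]; linarith
  have hot : ∀ s, Tendsto (fun n => o n s) atTop (𝓝 0) := by
    intro s
    refine Metric.tendsto_nhds.2 fun e he => ?_
    filter_upwards [h s (e / 2) (by positivity)] with n hn
    rw [Real.dist_eq, sub_zero, abs_of_nonneg (ho0 n s)]
    exact max_lt he (by simp only [hI]; linarith)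
  set a : ℕ → ℝ := fun n => ∫ s, κ s * o n s ∂leb T with ha
  have hκo : ∀ n, Integrable (fun s => κ s * o n s) (leb T) := fun n =>
    hbd (hom n) (ho0 n) ⟨M, hoM n⟩
  have ha0 : ∀ n, 0 ≤ a n := fun n => integral_nonneg fun s => mul_nonneg (hκ0 s) (ho0 n s)
  have hat : Tendsto a atTop (𝓝 0) := by
    have h1 := tendsto_integral_of_dominated_convergence (μ := leb T)
      (F := fun n s => κ s * o n s) (f := fun _ => (0 : ℝ)) (fun s => κ s * M)
      (fun n => (hκo n).1) (hκ.mul_const M)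
      (fun n => Eventually.of_forall fun s => by
        rw [Real.norm_of_nonneg (mul_nonneg (hκ0 s) (ho0 n s))]
        exact mul_le_mul_of_nonneg_left (hoM n s) (hκ0 s))
      (Eventually.of_forall fun s => by simpa using (hot s).const_mul (κ s))
    simpa using h1
  have hIle : ∀ n s, I n s ≤ gronwallConst (∫ s, κ s ∂leb T) * a n := by
    intro n s
    refine gronwall hT hκ hκ0 le_rfl (ha0 n) (hIB n) (fun s => ⟨s, le_rfl, le_rfl⟩) (fun t => ?_) s
    have hκI : Integrable (fun s => κ s * I n s) (leb T) :=
      hbd (hIc n).measurable (hI0 n) ⟨_, hIB n⟩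
    calc I n t ≤ ∫ s in Iic t, (κ s * o n s + κ s * I n s) ∂leb T := by
          refine integral_mono (hκf n).integrableOn ((hκo n).add hκI).integrableOn fun s => ?_
          have := mul_le_mul_of_nonneg_left (hfo n s) (hκ0 s)
          simp only; linarith
      _ = ∫ s in Iic t, κ s * o n s ∂leb T + ∫ s in Iic t, κ s * I n s ∂leb T :=
          integral_add (hκo n).integrableOn hκI.integrableOn
      _ ≤ _ := by
          gcongr
          exact setIntegral_le_integral (hκo n)
            (Eventually.of_forall fun s => mul_nonneg (hκ0 s) (ho0 n s))
  refine squeeze_zero (hf0 · t) (fun n => (hfo n t).trans (add_le_add_right (hIle n t) _)) ?_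
  simpa using (hot t).add (hat.const_mul (gronwallConst (∫ s, κ s ∂leb T)))

end

section

variable {T : ℝ} {V : Type*} [NormedAddCommGroup V] [NormedSpace ℝ V]
  {H : Type*} [NormedAddCommGroup H] [InnerProductSpace ℝ H]
  {ι : V →L[ℝ] H} [MeasurableSpace V] [MeasurableSpace H]
  {A : Time T → V → StrongDual ℝ V} {b : Time T → V → H} {α β θ C : ℝ} {k F c : Time T → ℝ}
  {d : ℕ → V} {x : H} {R C₁ : ℝ} {ε : ℕ → ℝ} {Q : ℕ → H →L[ℝ] V}
  {w : ℕ → Time T → V} {u : ℕ → Time T → H} {u₀ : Time T → H} {w₀ : Time T → V}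

/-- The coefficient in the local monotonicity condition. -/
def monoWeight (ι : V →L[ℝ] H) (α β C : ℝ) (k : Time T → ℝ) (s : Time T) (v : V) : ℝ :=
  k s + C * (1 + ‖v‖ ^ α) * (1 + ‖ι v‖ ^ β)

theorem EvolutionData.monoWeight_nonneg (hE : EvolutionData ι A b α β θ C k F c) (s : Time T)
    (v : V) : 0 ≤ monoWeight ι α β C k s v := by
  have := hE.k_nonneg s
  have := hE.C_nonneg
  unfold monoWeight
  positivity

theorem EvolutionData.monoWeight_le (hE : EvolutionData ι A b α β θ C k F c) (s : Time T)
    {v : V} {r R : ℝ} (hr : ‖v‖ ≤ r) (hR : ‖ι v‖ ≤ R) :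
    monoWeight ι α β C k s v ≤ k s + C * (1 + r ^ α) * (1 + R ^ β) := by
  have := hE.one_lt
  have := hE.beta_nonneg
  have := hE.C_nonneg
  have h0 : 0 ≤ r := (norm_nonneg v).trans hr
  unfold monoWeight
  gcongr

/-- The local monotonicity, solved for `⟨(A + b)(v₁), v₁⟩`. -/
theorem EvolutionData.two_mul_total_self_le (hE : EvolutionData ι A b α β θ C k F c) (s : Time T)
    (v₁ v₂ : V) : 2 * total ι A b s v₁ v₁ ≤ monoWeight ι α β C k s v₂ * ‖ι v₁ - ι v₂‖ ^ 2
      + 2 * total ι A b s v₂ (v₁ - v₂) + 2 * total ι A b s v₁ v₂ := by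
  have h := hE.mono s v₁ v₂
  rw [map_sub ι] at h
  simp only [total_apply, monoWeight, map_sub, inner_sub_left, inner_sub_right, sub_apply] at h ⊢
  linarith

variable [BorelSpace V]

theorem EvolutionData.integrable_monoWeight (hE : EvolutionData ι A b α β θ C k F c)
    {v : Time T → V} (hv : Measurable v) (hvα : MemLp v (ENNReal.ofReal α) (leb T)) {R' : ℝ}
    (hvR : ∀ᵐ s ∂leb T, ‖ι (v s)‖ ≤ R') :
    Integrable (fun s => monoWeight ι α β C k s (v s)) (leb T) := by
  have hβ := hE.beta_nonneg
  refine hE.k_int.add ?_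
  have hi := (((integrable_const (1 : ℝ)).add (integrable_norm_rpow hE.one_lt.le hvα)).const_mul C)
  have hm : Measurable fun s => ‖ι (v s)‖ := (ι.continuous.norm.measurable).comp hv
  refine hi.mul_bdd (c := 1 + R' ^ β) (measurable_const.add (hm.pow_const β)).aestronglyMeasurable ?_
  filter_upwards [hvR] with s hs
  rw [Real.norm_of_nonneg (by positivity)]
  gcongr

variable [BorelSpace H] [SecondCountableTopology H] [SecondCountableTopology (StrongDual ℝ V)]

theorem WeakLimit.w₀_le (hW : WeakLimit ι A b α d x R C₁ ε Q w u w₀ u₀) :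
    ∀ᵐ s ∂leb T, ‖ι (w₀ s)‖ ≤ R :=
  hW.w₀_eq.mono fun s hs => hs ▸ hW.u₀_le s

/-- Weak convergence of the approximations, tested with the operator along a fixed function `ψ`. The part
`b(ψ)` is only in `L¹([0,T],H)`; for it the weak convergence at each time is used. -/
theorem WeakLimit.tendsto_total [CompleteSpace V] (hW : WeakLimit ι A b α d x R C₁ ε Q w u w₀ u₀)
    (hE : EvolutionData ι A b α β θ C k F c) (hd : DenseRange (toVDual ι)) {ψ : Time T → V}
    (hψ : Measurable ψ) (hψα : MemLp ψ (ENNReal.ofReal α) (leb T)) {R' : ℝ} (hR' : 0 ≤ R')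
    (hψR : ∀ᵐ s ∂leb T, ‖ι (ψ s)‖ ≤ R') (S : Set (Time T)) :
    Tendsto (fun n => ∫ s in S, total ι A b s (ψ s) (w n s - w₀ s) ∂leb T) atTop (𝓝 0) := by
  have hα := hE.one_lt
  have hG := hW.toGalerkinSeq
  obtain ⟨hA1, hA2, -⟩ := hE.integrable_A_rpow hψ hψα hR' hψR le_rfl
  have hAm : Measurable fun s => A s (ψ s) := hE.measurable_A.comp (measurable_id.prodMk hψ)
  have hbm : Measurable fun s => b s (ψ s) := hE.measurable_b.comp (measurable_id.prodMk hψ)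
  have h1 := hW.tendsto_dual hα hd hAm hA2 S
  have hdm : ∀ n, AEStronglyMeasurable (fun s => ι (w n s - w₀ s)) (leb T) := fun n =>
    ι.continuous.comp_aestronglyMeasurable ((hG.memLp n).sub hW.w₀_memLp).1
  have hdle : ∀ n, ∀ᵐ s ∂leb T, ‖ι (w n s - w₀ s)‖ ≤ R + R := fun n => by
    filter_upwards [hW.w₀_le] with s hs
    rw [map_sub]
    exact (norm_sub_le _ _).trans (add_le_add (hG.w_le n s) hs)
  have hble : ∀ n, ∀ᵐ s ∂leb T,
      ‖(inner ℝ (b s (ψ s)) (ι (w n s - w₀ s)) : ℝ)‖ ≤ c s * (1 + R') * (R + R) := fun n => by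
    filter_upwards [hdle n, hψR] with s hs hs'
    have hc := hE.c_nonneg s
    refine (norm_inner_le_norm _ _).trans ?_
    gcongr
    exact (hE.growth_b s _).trans (by gcongr)
  have hdom : Integrable (fun s => c s * (1 + R') * (R + R)) (leb T) :=
    (hE.c_int.mul_const _).mul_const _
  have hbi : ∀ n, Integrable (fun s => (inner ℝ (b s (ψ s)) (ι (w n s - w₀ s)) : ℝ)) (leb T) :=
    fun n => hdom.mono' (hbm.aestronglyMeasurable.inner (hdm n)) (hble n)
  have h2 := tendsto_integral_of_dominated_convergence (μ := (leb T).restrict S)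
    (F := fun n s => (inner ℝ (b s (ψ s)) (ι (w n s - w₀ s)) : ℝ)) (f := fun _ => (0 : ℝ)) _
    (fun n => (hbi n).1.restrict) hdom.integrableOn (fun n => ae_restrict_of_ae (hble n))
    (ae_restrict_of_ae (by
      filter_upwards [hW.w₀_eq] with s hs
      simp_rw [map_sub, hs, inner_sub_right]
      have h3 := (hW.w_weak s (b s (ψ s))).sub_const (inner ℝ (u₀ s) (b s (ψ s)))
      simp_rw [real_inner_comm (b s (ψ s))] at h3
      simpa using h3))
  have h3 := h1.add h2
  rw [integral_zero, add_zero] at h3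
  refine h3.congr fun n => ?_
  have hAi : Integrable (fun s => A s (ψ s) (w n s - w₀ s)) (leb T) :=
    integrable_dual_apply hα ((hG.memLp n).sub hW.w₀_memLp) hA1 hA2
  rw [← integral_add hAi.integrableOn (hbi n).integrableOn]
  rfl

/-- The value of a step function on a cell. -/
theorem sum_indicator_eq {E : Type*} [AddCommMonoid E] {τ : ℕ → Time T} (hτ : Monotone τ)
    (vv : ℕ → E) {N k : ℕ} (hk : k < N) {s : Time T} (hs : s ∈ Ioc (τ k) (τ (k + 1))) :
    ∑ j ∈ Finset.range N, (Ioc (τ j) (τ (j + 1))).indicator (fun _ => vv j) s = vv k := by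
  rw [Finset.sum_eq_single_of_mem k (Finset.mem_range.2 hk), indicator_of_mem hs]
  intro j _ hjk
  refine indicator_of_notMem (fun hj => ?_) _
  exact disjoint_left.1 (hτ.pairwise_disjoint_on_Ioc_succ hjk) hj hs

/-- Approximation of the weak limit by a step function whose values are, up to the value on the
first cell, the values of the weak limit at the grid points. -/
theorem WeakLimit.exists_step (hT : 0 < T) (hα : 1 < α) (hι : DenseRange ι)
    (hW : WeakLimit ι A b α d x R C₁ ε Q w u w₀ u₀) {δ₁ : ℝ} (hδ₁ : 0 < δ₁) {e₁ : ℝ}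
    (he₁ : 0 < e₁) (he₁' : e₁ ≤ 1) :
    ∃ (N : ℕ) (τ : ℕ → Time T) (vv : ℕ → V) (v : Time T → V), Monotone τ ∧ (τ 0 : ℝ) = 0 ∧
      (τ (N + 1) : ℝ) = T ∧ MemLp v (ENNReal.ofReal α) (leb T) ∧
      (∀ᵐ s ∂leb T, ‖ι (v s)‖ ≤ R + ‖x‖ + 1) ∧ ∫ s, ‖w₀ s - v s‖ ^ α ∂leb T ≤ δ₁ ∧
      ‖ι (vv 0) - x‖ ≤ e₁ ∧ (∀ k, 1 ≤ k → k ≤ N → ι (vv k) = u₀ (τ k)) ∧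
      ∀ k ≤ N, ∀ s ∈ Ioc (τ k) (τ (k + 1)), v s = vv k := by
  have hR := hW.R_nonneg
  obtain ⟨v₀, hv₀⟩ := hι.exists_dist_lt x he₁
  rw [dist_comm, dist_eq_norm] at hv₀
  have hwv : ∀ z : V, Integrable (fun s => ‖w₀ s - z‖ ^ α) (leb T) := fun z =>
    integrable_norm_rpow hα.le (hW.w₀_memLp.sub (memLp_const z))
  obtain ⟨δ, hδ, hδ'⟩ := exists_norm_setIntegral_Ioc_le (hwv v₀) (half_pos hδ₁)
  obtain ⟨N, τ, hN, hτ, hτ0, hτN, hP, hmesh, hsum, -⟩ := exists_partition_real hT hα.le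
    hW.w₀_memLp hW.w₀_eq (half_pos hδ₁) hδ
  set vv : ℕ → V := fun k => if k = 0 then v₀ else w₀ (τ k) with hvv
  have hvv0 : vv 0 = v₀ := if_pos rfl
  have hvvs : ∀ k, vv (k + 1) = w₀ (τ (k + 1)) := fun k => if_neg (Nat.succ_ne_zero k)
  set v : Time T → V := fun s =>
    ∑ j ∈ Finset.range (N + 1), (Ioc (τ j) (τ (j + 1))).indicator (fun _ => vv j) s with hv
  have hcell : ∀ k ≤ N, ∀ s ∈ Ioc (τ k) (τ (k + 1)), v s = vv k := fun k hk s hs =>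
    sum_indicator_eq hτ vv (Nat.lt_succ_of_le hk) hs
  have hvv1 : ∀ k, 1 ≤ k → k ≤ N → ι (vv k) = u₀ (τ k) := by
    intro k hk1 hkN
    obtain ⟨j, rfl⟩ := Nat.exists_eq_succ_of_ne_zero (by omega : k ≠ 0)
    rw [Nat.succ_eq_add_one, hvvs]
    exact hP _ hk1 hkN
  have hvα : MemLp v (ENNReal.ofReal α) (leb T) :=
    memLp_finsetSum _ fun j _ => (memLp_const (vv j)).indicator measurableSet_Ioc
  have hvvle : ∀ k ≤ N, ‖ι (vv k)‖ ≤ R + ‖x‖ + 1 := by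
    intro k hk
    rcases Nat.eq_zero_or_pos k with rfl | h
    · rw [hvv0]
      have h1 : ‖ι v₀‖ ≤ ‖ι v₀ - x‖ + ‖x‖ := by simpa using norm_add_le (ι v₀ - x) x
      linarith
    · rw [hvv1 k h hk]
      have := hW.u₀_le (τ k)
      have := norm_nonneg x
      linarith
  have hvR : ∀ s, ‖ι (v s)‖ ≤ R + ‖x‖ + 1 := by
    intro s
    by_cases h : ∃ k ≤ N, s ∈ Ioc (τ k) (τ (k + 1))
    · obtain ⟨k, hk, hs⟩ := h
      rw [hcell k hk s hs]
      exact hvvle k hk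
    · have h1 : v s = 0 := Finset.sum_eq_zero fun j hj => indicator_of_notMem
        (fun hs => h ⟨j, Nat.lt_succ_iff.1 (Finset.mem_range.1 hj), hs⟩) _
      rw [h1, map_zero, norm_zero]
      positivity
  refine ⟨N, τ, vv, v, hτ, hτ0, hτN _ (Nat.lt_succ_self N), hvα, Eventually.of_forall hvR, ?_,
    by rw [hvv0]; exact hv₀.le, hvv1, hcell⟩
  have hi := integrable_norm_rpow hα.le (hW.w₀_memLp.sub hvα)
  have htop : (univ : Set (Time T)) = Iic (τ (N + 1)) := by
    ext s
    simp only [mem_univ, mem_Iic, true_iff]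
    rw [← Subtype.coe_le_coe, hτN _ (Nat.lt_succ_self N)]
    exact s.2.2
  have hcong : ∀ k ≤ N, ∫ s in Ioc (τ k) (τ (k + 1)), ‖(w₀ - v) s‖ ^ α ∂leb T
      = ∫ s in Ioc (τ k) (τ (k + 1)), ‖w₀ s - vv k‖ ^ α ∂leb T := fun k hk =>
    setIntegral_congr_fun measurableSet_Ioc fun s hs => by
      simp only [Pi.sub_apply, hcell k hk s hs]
  calc ∫ s, ‖w₀ s - v s‖ ^ α ∂leb T = ∫ s in univ, ‖(w₀ - v) s‖ ^ α ∂leb T := by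
        rw [setIntegral_univ]; rfl
    _ = ∑ k ∈ Finset.range (N + 1), ∫ s in Ioc (τ k) (τ (k + 1)), ‖w₀ s - vv k‖ ^ α ∂leb T := by
        rw [htop, setIntegral_Iic_eq_Ioc hi hτ0, ← sum_setIntegral_Ioc hi hτ]
        exact Finset.sum_congr rfl fun k hk => hcong k (Nat.lt_succ_iff.1 (Finset.mem_range.1 hk))
    _ ≤ δ₁ / 2 + δ₁ / 2 := by
        rw [Finset.sum_range_succ']
        simp only [hvvs, hvv0]
        exact add_le_add hsum ((le_abs_self _).trans (hδ' _ _ (hτ (Nat.le_succ 0)) (hmesh 0)))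
    _ = δ₁ := add_halves _

end

/-! ### Minty's inequality -/

section

variable {T : ℝ} {V : Type*} [NormedAddCommGroup V] [NormedSpace ℝ V]
  {H : Type*} [NormedAddCommGroup H] [InnerProductSpace ℝ H]
  {ι : V →L[ℝ] H} [MeasurableSpace V] [MeasurableSpace H]
  {A : Time T → V → StrongDual ℝ V} {b : Time T → V → H} {α β θ C : ℝ} {k F c : Time T → ℝ}
  {d : ℕ → V} {x : H} {R C₁ : ℝ} {ε : ℕ → ℝ} {Q : ℕ → H →L[ℝ] V}
  {w : ℕ → Time T → V} {u : ℕ → Time T → H} {u₀ : Time T → H} {w₀ : Time T → V}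
  [BorelSpace V] [BorelSpace H] [SecondCountableTopology H]
  [SecondCountableTopology (StrongDual ℝ V)]

/-- The weak limit attains the initial value. -/
theorem WeakLimit.u₀_zero (hW : WeakLimit ι A b α d x R C₁ ε Q w u w₀ u₀)
    {s : Time T} (hs : (s : ℝ) = 0) : u₀ s = x := by
  have h0 : leb T (Iic s) = 0 := by
    have h1 : Iic s ⊆ {s} := fun r hr => by
      refine le_antisymm hr ?_
      rw [← Subtype.coe_le_coe, hs]
      exact r.2.1
    exact measure_mono_null h1 (measure_singleton _)
  have h1 : ∀ n, u n s = x := fun n => by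
    rw [← sub_eq_zero, ← inner_self_eq_zero (𝕜 := ℝ), hW.eqn n s, setIntegral_measure_zero _ h0]
  refine ext_inner_right ℝ fun h => tendsto_nhds_unique (hW.u_weak s h) ?_
  simp_rw [h1]
  exact tendsto_const_nhds

/-- Summation by parts for the step functions of `WeakLimit.exists_step`, on the interval
`[0, t]`. -/
theorem WeakLimit.two_mul_sum_le (hW : WeakLimit ι A b α d x R C₁ ε Q w u w₀ u₀)
    {N : ℕ} {τ : ℕ → Time T} {vv : ℕ → V} {e₁ : ℝ} (hτ : Monotone τ) (hτ0 : (τ 0 : ℝ) = 0)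
    (hτN : (τ (N + 1) : ℝ) = T) (hvv0 : ‖ι (vv 0) - x‖ ≤ e₁)
    (hvv : ∀ k, 1 ≤ k → k ≤ N → ι (vv k) = u₀ (τ k)) (t : Time T) :
    2 * ∑ k ∈ Finset.range (N + 1),
        (inner ℝ (u₀ (min (τ (k + 1)) t) - u₀ (min (τ k) t)) (ι (vv k)) : ℝ)
      ≤ ‖u₀ t‖ ^ 2 - ‖x‖ ^ 2
        - ∑ k ∈ Finset.range (N + 1), ‖u₀ (min (τ (k + 1)) t) - u₀ (min (τ k) t)‖ ^ 2
        + 4 * R * e₁ := by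
  have hR := hW.R_nonneg
  set z : ℕ → H := fun k => u₀ (min (τ k) t) with hz
  have hτt0 : min (τ 0) t = τ 0 := min_eq_left (by
    rw [← Subtype.coe_le_coe, hτ0]; exact t.2.1)
  have hτtN : min (τ (N + 1)) t = t := min_eq_right (by
    rw [← Subtype.coe_le_coe, hτN]; exact t.2.2)
  have hz0 : z 0 = x := by simp only [hz, hτt0]; exact hW.u₀_zero hτ0
  have hzN : z (N + 1) = u₀ t := by simp only [hz, hτtN]
  have hterm : ∀ k ∈ Finset.range (N + 1), 2 * (inner ℝ (z (k + 1) - z k) (ι (vv k)) : ℝ)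
      ≤ (‖z (k + 1)‖ ^ 2 - ‖z k‖ ^ 2) - ‖z (k + 1) - z k‖ ^ 2
        + (if k = 0 then 4 * R * e₁ else 0) := by
    intro k hk
    have hpol : 2 * (inner ℝ (z (k + 1) - z k) (z k) : ℝ)
        = (‖z (k + 1)‖ ^ 2 - ‖z k‖ ^ 2) - ‖z (k + 1) - z k‖ ^ 2 := by
      have h1 := norm_add_sq_real (z (k + 1) - z k) (z k)
      rw [sub_add_cancel] at h1
      linarith
    rcases Nat.eq_zero_or_pos k with rfl | hk0
    · rw [if_pos rfl, ← hpol]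
      have h1 : (inner ℝ (z (0 + 1) - z 0) (ι (vv 0) - x) : ℝ) ≤ (R + R) * e₁ := by
        refine (real_inner_le_norm _ _).trans ?_
        gcongr
        exact (norm_sub_le _ _).trans (add_le_add (hW.u₀_le _) (hW.u₀_le _))
      rw [inner_sub_right] at h1
      rw [hz0] at h1 ⊢
      linarith
    · rw [if_neg hk0.ne', add_zero, ← hpol, hvv k hk0 (Nat.lt_succ_iff.1 (Finset.mem_range.1 hk))]
      rcases le_total (τ k) t with h1 | h1
      · simp only [hz, min_eq_left h1]; exact le_rfl
      · have h2 : z (k + 1) - z k = 0 := by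
          simp only [hz, min_eq_right h1, min_eq_right (h1.trans (hτ (Nat.le_succ k))), sub_self]
        rw [h2, inner_zero_left, inner_zero_left]
  calc 2 * ∑ k ∈ Finset.range (N + 1), (inner ℝ (z (k + 1) - z k) (ι (vv k)) : ℝ)
      ≤ ∑ k ∈ Finset.range (N + 1), ((‖z (k + 1)‖ ^ 2 - ‖z k‖ ^ 2) - ‖z (k + 1) - z k‖ ^ 2
        + (if k = 0 then 4 * R * e₁ else 0)) := by
        rw [Finset.mul_sum]; exact Finset.sum_le_sum hterm
    _ = _ := by
        rw [Finset.sum_add_distrib, Finset.sum_sub_distrib,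
          Finset.sum_range_sub (fun k => ‖z k‖ ^ 2), hz0, hzN]
        simp only [Finset.sum_ite_eq', Finset.mem_range, Nat.succ_pos, if_true, hz]

/-- Minty's trick. The energy inequality of the approximations and the local monotonicity, applied
to `w n` and to a perturbation `w₀ - l φ` of the weak limit, bound the distance of `u n` and `u₀`.
The limit of `∫ ⟨(A + b)(w n), w₀⟩` is not accessible directly, and `w₀` is replaced by a step
function. The squares of the increments of `u₀` along the corresponding partition come from the
summation by parts; they yield the continuity of `u₀`. -/
theorem WeakLimit.minty_inequality [CompleteSpace V] (hT : 0 < T) (hι : DenseRange ι)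
    (hW : WeakLimit ι A b α d x R C₁ ε Q w u w₀ u₀)
    (hE : EvolutionData ι A b α β θ C k F c) (hd : DenseRange (toVDual ι)) {e : ℝ} (he : 0 < e) :
    ∃ (N : ℕ) (τ : ℕ → Time T), Monotone τ ∧ (τ 0 : ℝ) = 0 ∧ (τ (N + 1) : ℝ) = T ∧
      ∀ (t : Time T) (φ : V) (l : ℝ), ∀ᶠ n in atTop,
        ‖u n t - u₀ t‖ ^ 2
          + ∑ k ∈ Finset.range (N + 1), ‖u₀ (min (τ (k + 1)) t) - u₀ (min (τ k) t)‖ ^ 2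
        ≤ e + 2 * l * (∫ s in Iic t, total ι A b s (w₀ s - l • φ) φ ∂leb T
            - inner ℝ (u₀ t - x) (ι φ))
          + ∫ s in Iic t, monoWeight ι α β C k s (w₀ s - l • φ)
              * ‖ι (w n s) - ι (w₀ s - l • φ)‖ ^ 2 ∂leb T := by
  have hα := hE.one_lt
  have hG := hW.toGalerkinSeq
  have hR := hG.R_nonneg
  set R' : ℝ := R + (R + ‖x‖ + 1) with hR'
  obtain ⟨K, hK, hKb⟩ := hE.exists_total_bound' hG.C₁_nonneg hG.R_nonneg (η := e / 16)
    (by positivity) (R' := R') (by positivity)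
  obtain ⟨N, τ, vv, v, hτ, hτ0, hτN, hvα, hvR, hvw, hvv0, hvv, hcell⟩ :=
    hW.exists_step hT hα hι (δ₁ := e / (16 * (K + 1))) (by positivity)
      (e₁ := min 1 (e / (16 * (R + 1)))) (by positivity) (min_le_left _ _)
  refine ⟨N, τ, hτ, hτ0, hτN, fun t φ l => ?_⟩
  set ψ : Time T → V := fun s => w₀ s - l • φ with hψ
  have hψm : Measurable ψ := (measurable_sub_const' (l • φ)).comp hW.w₀_meas
  have hψα : MemLp ψ (ENNReal.ofReal α) (leb T) := hW.w₀_memLp.sub (memLp_const _)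
  set R'' : ℝ := R + ‖ι (l • φ)‖ with hR''
  have hψR : ∀ᵐ s ∂leb T, ‖ι (ψ s)‖ ≤ R'' := by
    filter_upwards [hW.w₀_le] with s hs
    simp only [hψ, map_sub]
    exact (norm_sub_le _ _).trans (add_le_add hs (by rw [map_smul]))
  have hC₁' : 0 ≤ ∫ s, ‖ψ s‖ ^ α ∂leb T := integral_nonneg fun s => by positivity
  obtain ⟨K₂, -, hKb₂⟩ := hE.exists_total_bound hC₁' (R := R'') (by positivity) one_pos
  have iψ : ∀ {y : Time T → V} {B : ℝ}, MemLp y (ENNReal.ofReal α) (leb T) →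
      (∀ᵐ s ∂leb T, ‖ι (y s)‖ ≤ B) → Integrable (fun s => total ι A b s (ψ s) (y s)) (leb T) :=
    fun hy hB => (hKb₂ ψ hψm hψα hψR le_rfl _ hy _ hB).1
  obtain ⟨K₃, -, hKb₃⟩ := hE.exists_total_bound hG.C₁_nonneg hG.R_nonneg one_pos
  have iw : ∀ (n : ℕ) {y : Time T → V} {B : ℝ}, MemLp y (ENNReal.ofReal α) (leb T) →
      (∀ᵐ s ∂leb T, ‖ι (y s)‖ ≤ B) → Integrable (fun s => total ι A b s (w n s) (y s)) (leb T) :=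
    fun n _ _ hy hB => (hKb₃ (w n) (hG.w_meas n) (hG.memLp n) (Eventually.of_forall (hG.w_le n))
      (hG.int_le n) _ hy _ hB).1
  have hdle : ∀ n, ∀ᵐ s ∂leb T, ‖ι (w n s - w₀ s)‖ ≤ R + R := fun n => by
    filter_upwards [hW.w₀_le] with s hs
    rw [map_sub]
    exact (norm_sub_le _ _).trans (add_le_add (hG.w_le n s) hs)
  have hwvR : ∀ᵐ s ∂leb T, ‖ι (w₀ s - v s)‖ ≤ R' := by
    filter_upwards [hW.w₀_le, hvR] with s hs hs'
    rw [map_sub]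
    exact (norm_sub_le _ _).trans (add_le_add hs hs')
  have hφ : MemLp (fun _ : Time T => φ) (ENNReal.ofReal α) (leb T) := memLp_const φ
  have hφR : ∀ᵐ _ ∂leb T, ‖ι φ‖ ≤ ‖ι φ‖ := Eventually.of_forall fun _ => le_rfl
  have iκ : ∀ n, Integrable (fun s => monoWeight ι α β C k s (ψ s) * ‖ι (w n s) - ι (ψ s)‖ ^ 2)
      (leb T) := by
    intro n
    have hm : Measurable fun s => ‖ι (w n s) - ι (ψ s)‖ ^ 2 :=
      (((ι.continuous.measurable.comp (hG.w_meas n)).sub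
        (ι.continuous.measurable.comp hψm)).norm.pow_const 2)
    refine (hE.integrable_monoWeight hψm hψα hψR).mul_bdd (c := (R + R'') ^ 2)
      hm.aestronglyMeasurable ?_
    filter_upwards [hψR] with s hs
    rw [Real.norm_of_nonneg (by positivity)]
    gcongr
    exact (norm_sub_le _ _).trans (add_le_add (hG.w_le n s) hs)
  -- the energy inequality, with `⟨(A + b)(w n), w n⟩` estimated by the local monotonicity and
  -- `w₀` replaced by the step function `v` up to the error `w₀ - v`
  have hn : ∀ n, ‖u n t‖ ^ 2 ≤ ‖x‖ ^ 2 + ε n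
      + (∫ s in Iic t, monoWeight ι α β C k s (ψ s) * ‖ι (w n s) - ι (ψ s)‖ ^ 2 ∂leb T)
      + 2 * (∫ s in Iic t, total ι A b s (ψ s) (w n s - w₀ s) ∂leb T)
      + 2 * l * (∫ s in Iic t, total ι A b s (ψ s) φ ∂leb T)
      + 2 * (∫ s in Iic t, total ι A b s (w n s) (v s) ∂leb T)
      + 2 * (∫ s in Iic t, total ι A b s (w n s) (w₀ s - v s) ∂leb T)
      - 2 * l * (∫ s in Iic t, total ι A b s (w n s) φ ∂leb T) := by
    intro n
    have j0 := (iw n (hG.memLp n) (Eventually.of_forall (hG.w_le n)))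
    have j1 := iκ n
    have j2 : Integrable (fun s => total ι A b s (ψ s) (w n s - w₀ s)) (leb T) :=
      iψ ((hG.memLp n).sub hW.w₀_memLp) (hdle n)
    have j3 := iψ hφ hφR
    have j4 := iw n hvα hvR
    have j5 : Integrable (fun s => total ι A b s (w n s) (w₀ s - v s)) (leb T) :=
      iw n (hW.w₀_memLp.sub hvα) hwvR
    have j6 := iw n hφ hφR
    have h1 := hG.energy n t
    have h2 : 2 * ∫ s in Iic t, total ι A b s (w n s) (w n s) ∂leb T
        ≤ ∫ s in Iic t, (monoWeight ι α β C k s (ψ s) * ‖ι (w n s) - ι (ψ s)‖ ^ 2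
          + (2 * total ι A b s (ψ s) (w n s - w₀ s) + (2 * l * total ι A b s (ψ s) φ
          + (2 * total ι A b s (w n s) (v s) + (2 * total ι A b s (w n s) (w₀ s - v s)
          - 2 * l * total ι A b s (w n s) φ))))) ∂leb T := by
      rw [← integral_const_mul]
      refine integral_mono (j0.const_mul 2).integrableOn ((j1.add ((j2.const_mul 2).add
        ((j3.const_mul (2 * l)).add ((j4.const_mul 2).add ((j5.const_mul 2).sub
        (j6.const_mul (2 * l))))))).integrableOn) fun s => ?_
      have h3 := hE.two_mul_total_self_le s (w n s) (ψ s)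
      have h4 : w n s - ψ s = (w n s - w₀ s) + l • φ := by simp only [hψ]; abel
      have h5 : total ι A b s (w n s) (ψ s) = total ι A b s (w n s) (v s)
          + total ι A b s (w n s) (w₀ s - v s) - l * total ι A b s (w n s) φ := by
        have h6 : ψ s = v s + (w₀ s - v s) - l • φ := by simp only [hψ]; abel
        rw [h6, map_sub, map_add, map_smul, smul_eq_mul]
      rw [h4, map_add, map_smul, smul_eq_mul, h5] at h3
      simp only
      linarith
    rw [integral_add j1.integrableOn, integral_add (j2.const_mul 2).integrableOn,
      integral_add (j3.const_mul (2 * l)).integrableOn, integral_add (j4.const_mul 2).integrableOn,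
      integral_sub (j5.const_mul 2).integrableOn (j6.const_mul (2 * l)).integrableOn,
      integral_const_mul, integral_const_mul, integral_const_mul, integral_const_mul,
      integral_const_mul] at h2
    · linarith
    · exact ((j5.const_mul 2).sub (j6.const_mul (2 * l))).integrableOn
    · exact ((j4.const_mul 2).add ((j5.const_mul 2).sub (j6.const_mul (2 * l)))).integrableOn
    · exact ((j3.const_mul (2 * l)).add ((j4.const_mul 2).add ((j5.const_mul 2).sub
        (j6.const_mul (2 * l))))).integrableOn
    · exact ((j2.const_mul 2).add ((j3.const_mul (2 * l)).add ((j4.const_mul 2).add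
        ((j5.const_mul 2).sub (j6.const_mul (2 * l)))))).integrableOn
  -- the limits of the individual terms; only the term with `w₀ - v` has no limit, but it is small
  have l1 := hW.tendsto_total hE hd hψm hψα (by positivity) hψR (Iic t)
  have l2 : Tendsto (fun n => ∫ s in Iic t, total ι A b s (w n s) (v s) ∂leb T) atTop
      (𝓝 (∑ k ∈ Finset.range (N + 1),
        (inner ℝ (u₀ (min (τ (k + 1)) t) - u₀ (min (τ k) t)) (ι (vv k)) : ℝ))) := by
    have hτt : Monotone fun k => min (τ k) t := fun i j hij => min_le_min_right _ (hτ hij)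
    have hτt0 : ((min (τ 0) t : Time T) : ℝ) = 0 := by
      rw [min_eq_left (by rw [← Subtype.coe_le_coe, hτ0]; exact t.2.1), hτ0]
    have hτtN : min (τ (N + 1)) t = t := min_eq_right (by
      rw [← Subtype.coe_le_coe, hτN]; exact t.2.2)
    refine (tendsto_finsetSum _ fun k _ => hW.tendsto_inner_sub hE (hτt (Nat.le_succ k))
      (vv k)).congr fun n => ?_
    have h1 := sum_setIntegral_Ioc (iw n hvα hvR) hτt (N + 1)
    rw [hτtN, ← setIntegral_Iic_eq_Ioc (iw n hvα hvR) hτt0] at h1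
    rw [← h1]
    refine Finset.sum_congr rfl fun k hk => setIntegral_congr_fun measurableSet_Ioc fun s hs => ?_
    have hsc : s ∈ Ioc (τ k) (τ (k + 1)) := by
      obtain ⟨h3, h4⟩ := hs
      have h5 : s ≤ t := h4.trans (min_le_right _ _)
      refine ⟨(min_lt_iff.1 h3).resolve_right (not_lt.2 h5), h4.trans (min_le_left _ _)⟩
    simp only [hcell k (Nat.lt_succ_iff.1 (Finset.mem_range.1 hk)) s hsc]
  have l3 : Tendsto (fun n => ∫ s in Iic t, total ι A b s (w n s) φ ∂leb T) atTop
      (𝓝 (inner ℝ (u₀ t - x) (ι φ))) := by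
    have h0 : ((⟨0, le_rfl, hT.le⟩ : Time T) : ℝ) = 0 := rfl
    have h1 := hW.tendsto_inner_sub hE (s := ⟨0, le_rfl, hT.le⟩) (t := t) t.2.1 φ
    rw [hW.u₀_zero h0] at h1
    exact h1.congr fun n => (setIntegral_Iic_eq_Ioc (iw n hφ hφR) h0 t).symm
  have l4 := hW.u_weak t (u₀ t)
  have l5 := hW.two_mul_sum_le hτ hτ0 hτN hvv0 hvv t
  have l6 : 4 * R * min 1 (e / (16 * (R + 1))) ≤ e / 4 := by
    calc 4 * R * min 1 (e / (16 * (R + 1))) ≤ 4 * R * (e / (16 * (R + 1))) := by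
          gcongr; exact min_le_right _ _
      _ = e / 4 * (R / (R + 1)) := by field_simp; ring
      _ ≤ e / 4 := mul_le_of_le_one_right (by positivity)
          (div_le_one_of_le₀ (by linarith) (by linarith))
  have l7 : ∀ n, ∫ s in Iic t, total ι A b s (w n s) (w₀ s - v s) ∂leb T ≤ e / 8 := by
    intro n
    have h1 := (hKb (w n) (hG.w_meas n) (hG.memLp n) (Eventually.of_forall (hG.w_le n))
      (hG.int_le n) _ (hW.w₀_memLp.sub hvα) hwvR).2 (Iic t)
    have h2 : ∫ s in Iic t, ‖(w₀ - v) s‖ ^ α ∂leb T ≤ e / (16 * (K + 1)) :=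
      (setIntegral_le_integral (integrable_norm_rpow hα.le (hW.w₀_memLp.sub hvα))
        (Eventually.of_forall fun s => by simp only [Pi.zero_apply]; positivity)).trans hvw
    have h3 : K * ∫ s in Iic t, ‖(w₀ - v) s‖ ^ α ∂leb T ≤ e / 16 := by
      calc K * ∫ s in Iic t, ‖(w₀ - v) s‖ ^ α ∂leb T ≤ K * (e / (16 * (K + 1))) := by gcongr
        _ = e / 16 * (K / (K + 1)) := by field_simp
        _ ≤ e / 16 := mul_le_of_le_one_right (by positivity)
            (div_le_one_of_le₀ (by linarith) (by linarith))
    exact (le_abs_self _).trans (h1.trans (by linarith))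
  have lim := ((((hG.eps_tendsto.add (l1.const_mul 2)).add (l2.const_mul 2)).sub
    (l3.const_mul (2 * l))).sub (l4.const_mul 2))
  filter_upwards [lim.eventually (gt_mem_nhds (lt_add_of_pos_right _ (by positivity : 0 < e / 4)))]
    with n hlim
  have h1 := hn n
  have h2 := l7 n
  have h3 : ‖u n t - u₀ t‖ ^ 2 = ‖u n t‖ ^ 2 - 2 * inner ℝ (u n t) (u₀ t) + ‖u₀ t‖ ^ 2 :=
    norm_sub_sq_real _ _
  rw [real_inner_self_eq_norm_sq] at hlim
  linarith

end

/-! ### Strong convergence and existence of solutions -/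

section

variable {T : ℝ} {V : Type*} [NormedAddCommGroup V] [NormedSpace ℝ V]
  {H : Type*} [NormedAddCommGroup H] [InnerProductSpace ℝ H]
  {ι : V →L[ℝ] H} [MeasurableSpace V] [MeasurableSpace H]
  {A : Time T → V → StrongDual ℝ V} {b : Time T → V → H} {α β θ C : ℝ} {k F c : Time T → ℝ}
  {d : ℕ → V} {x : H} {R C₁ : ℝ} {ε : ℕ → ℝ} {Q : ℕ → H →L[ℝ] V}
  {w : ℕ → Time T → V} {u : ℕ → Time T → H} {u₀ : Time T → H} {w₀ : Time T → V}
  [BorelSpace V] [BorelSpace H] [SecondCountableTopology H]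
  [SecondCountableTopology (StrongDual ℝ V)] [CompleteSpace V]

/-- The distance of `w n` and `u₀` is at most that of `u n` and `u₀`, up to this error. -/
def projError (ι : V →L[ℝ] H) (ε : ℕ → ℝ) (Q : ℕ → H →L[ℝ] V) (u₀ : Time T → H) (n : ℕ)
    (s : Time T) : ℝ := ε n + ‖ι (Q n (u₀ s)) - u₀ s‖

theorem WeakLimit.norm_sub_le (hW : WeakLimit ι A b α d x R C₁ ε Q w u w₀ u₀) (n : ℕ)
    (s : Time T) : ‖ι (w n s) - u₀ s‖ ≤ projError ι ε Q u₀ n s + ‖u n s - u₀ s‖ := by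
  have h1 : ι (w n s) - u₀ s = (ι (w n s) - ι (Q n (u n s))) + (ι (Q n (u₀ s)) - u₀ s)
      + ι (Q n (u n s - u₀ s)) := by
    rw [map_sub, map_sub]; abel
  rw [h1, projError]
  refine (norm_add_le _ _).trans (add_le_add ((norm_add_le _ _).trans ?_) (hW.Q_norm _ _))
  exact add_le_add_left (hW.close n s) _

theorem WeakLimit.eps_nonneg (hT : 0 < T) (hW : WeakLimit ι A b α d x R C₁ ε Q w u w₀ u₀) (n : ℕ) :
    0 ≤ ε n := (norm_nonneg _).trans (hW.close n ⟨0, le_rfl, hT.le⟩)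

theorem WeakLimit.tendsto_projError (hW : WeakLimit ι A b α d x R C₁ ε Q w u w₀ u₀) (s : Time T) :
    Tendsto (fun n => projError ι ε Q u₀ n s) atTop (𝓝 0) := by
  simpa [projError] using hW.eps_tendsto.add ((hW.Q_tendsto (u₀ s)).sub_const (u₀ s)).norm

theorem WeakLimit.norm_sub_u₀_le (hW : WeakLimit ι A b α d x R C₁ ε Q w u w₀ u₀) (n : ℕ)
    (s : Time T) : ‖u n s - u₀ s‖ ≤ R + R :=
  (_root_.norm_sub_le _ _).trans (add_le_add (hW.u_le n s) (hW.u₀_le s))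

/-- The approximations converge strongly, at every time, by `WeakLimit.minty_inequality` with
`l = 0` and Gronwall's inequality. -/
theorem WeakLimit.tendsto_strong (hT : 0 < T) (hι : DenseRange ι)
    (hW : WeakLimit ι A b α d x R C₁ ε Q w u w₀ u₀)
    (hE : EvolutionData ι A b α β θ C k F c) (hd : DenseRange (toVDual ι)) (t : Time T) :
    Tendsto (fun n => ‖u n t - u₀ t‖) atTop (𝓝 0) := by
  have hG := hW.toGalerkinSeq
  have hR := hG.R_nonneg
  have hκ := hE.integrable_monoWeight hW.w₀_meas hW.w₀_memLp hW.w₀_le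
  set κ : Time T → ℝ := fun s => monoWeight ι α β C k s (w₀ s) with hκdef
  have hκ0 : ∀ s, 0 ≤ κ s := fun s => hE.monoWeight_nonneg s _
  obtain ⟨E, hEb⟩ := hG.eps_tendsto.bddAbove_range
  have hεE : ∀ n, ε n ≤ E := fun n => hEb ⟨n, rfl⟩
  have hε0 : ∀ n, 0 ≤ ε n := hW.eps_nonneg hT
  have hE0 : 0 ≤ E := (hε0 0).trans (hεE 0)
  set r : ℕ → Time T → ℝ := projError ι ε Q u₀ with hr
  have hr0 : ∀ n s, 0 ≤ r n s := fun n s => add_nonneg (hε0 n) (norm_nonneg _)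
  have hrle : ∀ n s, r n s ≤ E + (R + R) := fun n s => add_le_add (hεE n)
    ((_root_.norm_sub_le _ _).trans (add_le_add ((hW.Q_norm _ _).trans (hW.u₀_le s))
      (hW.u₀_le s)))
  have hrm : ∀ n, Measurable (r n) := fun n => measurable_const.add
    ((((ι.continuous.comp (Q n).continuous).measurable.comp hW.u₀_meas).sub hW.u₀_meas).norm)
  have hsq : Tendsto (fun n => ‖u n t - u₀ t‖ ^ 2) atTop (𝓝 0) := by
    refine tendsto_zero_of_gronwall hT.le hκ hκ0 (f := fun n t => ‖u n t - u₀ t‖ ^ 2)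
      (M := (R + R) ^ 2) (fun n => (((hG.u_cont n).measurable.sub hW.u₀_meas).norm.pow_const 2))
      (fun n s => by positivity) (fun n s => by
        gcongr; exact hW.norm_sub_u₀_le n s) (fun t e he => ?_) t
    obtain ⟨N, τ, -, -, -, h⟩ := hW.minty_inequality hT hι hE hd (half_pos he)
    have hlim : Tendsto (fun n => ∫ s in Iic t, κ s * (r n s * (2 * (R + R) + r n s)) ∂leb T) atTop
        (𝓝 0) := by
      have h1 := tendsto_integral_of_dominated_convergence (μ := (leb T).restrict (Iic t))
        (F := fun n s => κ s * (r n s * (2 * (R + R) + r n s))) (f := fun _ => (0 : ℝ))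
        (fun s => κ s * ((E + (R + R)) * (2 * (R + R) + (E + (R + R)))))
        (fun n => (hκ.1.mul ((hrm n).mul
          (measurable_const.add (hrm n))).aestronglyMeasurable).restrict)
        (hκ.mul_const _).integrableOn
        (fun n => Eventually.of_forall fun s => by
          have h2 := hr0 n s
          have h3 := hκ0 s
          rw [Real.norm_of_nonneg (by positivity)]
          have h4 := hrle n s
          gcongr)
        (Eventually.of_forall fun s => by
          have h2 := hW.tendsto_projError s
          have h3 := (h2.mul (h2.const_add (2 * (R + R)))).const_mul (κ s)
          simpa using h3)
      simpa using h1
    filter_upwards [h t 0 0, hlim.eventually (gt_mem_nhds (half_pos he))] with n hn hn'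
    have hi1 : Integrable (fun s => κ s * ‖u n s - u₀ s‖ ^ 2) (leb T) :=
      hκ.mul_bdd (c := (R + R) ^ 2)
        (((hG.u_cont n).measurable.sub hW.u₀_meas).norm.pow_const 2).aestronglyMeasurable
        (Eventually.of_forall fun s => by
          rw [Real.norm_of_nonneg (by positivity)]
          gcongr
          exact hW.norm_sub_u₀_le n s)
    have hi2 : Integrable (fun s => κ s * (r n s * (2 * (R + R) + r n s))) (leb T) :=
      hκ.mul_bdd (c := (E + (R + R)) * (2 * (R + R) + (E + (R + R))))
        ((hrm n).mul (measurable_const.add (hrm n))).aestronglyMeasurable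
        (Eventually.of_forall fun s => by
          have h2 := hr0 n s
          have h4 := hrle n s
          rw [Real.norm_of_nonneg (by positivity)]
          gcongr)
    have hle : ∫ s in Iic t, κ s * ‖ι (w n s) - ι (w₀ s)‖ ^ 2 ∂leb T
        ≤ ∫ s in Iic t, κ s * ‖u n s - u₀ s‖ ^ 2 ∂leb T
          + ∫ s in Iic t, κ s * (r n s * (2 * (R + R) + r n s)) ∂leb T := by
      rw [← integral_add hi1.integrableOn hi2.integrableOn]
      refine integral_mono_of_nonneg (Eventually.of_forall fun s => mul_nonneg (hκ0 s)
        (by positivity)) (hi1.add hi2).integrableOn (ae_restrict_of_ae ?_)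
      filter_upwards [hW.w₀_eq] with s hs
      rw [hs, ← mul_add]
      refine mul_le_mul_of_nonneg_left ?_ (hκ0 s)
      have h2 := hW.norm_sub_le n s
      have h3 := hW.norm_sub_u₀_le n s
      have h4 := hr0 n s
      calc ‖ι (w n s) - u₀ s‖ ^ 2 ≤ (r n s + ‖u n s - u₀ s‖) ^ 2 := by gcongr
        _ = ‖u n s - u₀ s‖ ^ 2 + r n s * (2 * ‖u n s - u₀ s‖ + r n s) := by ring
        _ ≤ _ := by gcongr
    simp only [smul_zero, sub_zero, map_zero, integral_zero, inner_zero_right, mul_zero,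
      add_zero] at hn
    have h5 : 0 ≤ ∑ k ∈ Finset.range (N + 1), ‖u₀ (min (τ (k + 1)) t) - u₀ (min (τ k) t)‖ ^ 2 :=
      Finset.sum_nonneg fun _ _ => by positivity
    simp only [hκdef] at hle ⊢
    linarith
  have h := hsq.sqrt
  simpa using h

theorem WeakLimit.tendsto_w (hT : 0 < T) (hι : DenseRange ι)
    (hW : WeakLimit ι A b α d x R C₁ ε Q w u w₀ u₀)
    (hE : EvolutionData ι A b α β θ C k F c) (hd : DenseRange (toVDual ι)) (t : Time T) :
    Tendsto (fun n => ι (w n t)) atTop (𝓝 (u₀ t)) := by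
  rw [tendsto_iff_norm_sub_tendsto_zero]
  refine squeeze_zero (fun _ => norm_nonneg _) (fun n => hW.norm_sub_le n t) ?_
  simpa using (hW.tendsto_projError t).add (hW.tendsto_strong hT hι hE hd t)

/-- The inequality of `WeakLimit.minty_inequality` in the limit. By the strong convergence, the
integral with the monotonicity weight becomes quadratic in `l`. -/
theorem WeakLimit.minty_limit (hT : 0 < T) (hι : DenseRange ι)
    (hW : WeakLimit ι A b α d x R C₁ ε Q w u w₀ u₀)
    (hE : EvolutionData ι A b α β θ C k F c) (hd : DenseRange (toVDual ι)) {e : ℝ} (he : 0 < e) :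
    ∃ (N : ℕ) (τ : ℕ → Time T), Monotone τ ∧ (τ 0 : ℝ) = 0 ∧ (τ (N + 1) : ℝ) = T ∧
      ∀ (t : Time T) (φ : V) (l : ℝ),
        ∑ k ∈ Finset.range (N + 1), ‖u₀ (min (τ (k + 1)) t) - u₀ (min (τ k) t)‖ ^ 2
        ≤ e + 2 * l * (∫ s in Iic t, total ι A b s (w₀ s - l • φ) φ ∂leb T
            - inner ℝ (u₀ t - x) (ι φ))
          + ∫ s in Iic t, monoWeight ι α β C k s (w₀ s - l • φ) * ‖ι (l • φ)‖ ^ 2 ∂leb T := by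
  obtain ⟨N, τ, h1, h2, h3, h⟩ := hW.minty_inequality hT hι hE hd he
  refine ⟨N, τ, h1, h2, h3, fun t φ l => ?_⟩
  have hG := hW.toGalerkinSeq
  have hR := hG.R_nonneg
  set ψ : Time T → V := fun s => w₀ s - l • φ with hψ
  have hψm : Measurable ψ := (measurable_sub_const' (l • φ)).comp hW.w₀_meas
  have hψα : MemLp ψ (ENNReal.ofReal α) (leb T) := hW.w₀_memLp.sub (memLp_const _)
  set R'' : ℝ := R + ‖ι (l • φ)‖ with hR''
  have hψR : ∀ᵐ s ∂leb T, ‖ι (ψ s)‖ ≤ R'' := by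
    filter_upwards [hW.w₀_le] with s hs
    simp only [hψ, map_sub]
    exact (_root_.norm_sub_le _ _).trans (add_le_add hs (by rw [map_smul]))
  have hκ := hE.integrable_monoWeight hψm hψα hψR
  have hlim := tendsto_integral_of_dominated_convergence (μ := (leb T).restrict (Iic t))
    (F := fun n s => monoWeight ι α β C k s (ψ s) * ‖ι (w n s) - ι (ψ s)‖ ^ 2)
    (f := fun s => monoWeight ι α β C k s (ψ s) * ‖ι (l • φ)‖ ^ 2)
    (fun s => monoWeight ι α β C k s (ψ s) * (R + R'') ^ 2)
    (fun n => (hκ.1.mul (((ι.continuous.measurable.comp (hG.w_meas n)).sub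
        (ι.continuous.measurable.comp hψm)).norm.pow_const 2).aestronglyMeasurable).restrict)
    (hκ.mul_const _).integrableOn
    (fun n => ae_restrict_of_ae (by
      filter_upwards [hψR] with s hs
      have h5 := hE.monoWeight_nonneg s (ψ s)
      rw [Real.norm_of_nonneg (by positivity)]
      gcongr
      exact (_root_.norm_sub_le _ _).trans (add_le_add (hG.w_le n s) hs)))
    (ae_restrict_of_ae (by
      filter_upwards [hW.w₀_eq] with s hs
      have h5 := ((hW.tendsto_w hT hι hE hd s).sub_const (ι (ψ s)))
      have h6 : u₀ s - ι (ψ s) = ι (l • φ) := by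
        simp only [hψ, map_sub, hs]; abel
      rw [h6] at h5
      exact ((h5.norm).pow 2).const_mul _))
  refine ge_of_tendsto (hlim.const_add _) ?_
  filter_upwards [h t φ l] with n hn
  have : 0 ≤ ‖u n t - u₀ t‖ ^ 2 := by positivity
  linarith

/-- Strong continuity of the limit. `WeakLimit.minty_limit` with `l = 0` provides partitions along which
the increments of the limit, up to an arbitrary intermediate time, have arbitrarily small squares.
So the range is totally bounded, and the weak continuity suffices. -/
theorem WeakLimit.continuous (hT : 0 < T) (hι : DenseRange ι)
    (hW : WeakLimit ι A b α d x R C₁ ε Q w u w₀ u₀)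
    (hE : EvolutionData ι A b α β θ C k F c) (hd : DenseRange (toVDual ι)) [CompleteSpace H] :
    Continuous u₀ := by
  -- the range is totally bounded, so the weak and the norm topology agree on its closure
  have htb : TotallyBounded (range u₀) := by
    refine Metric.totallyBounded_iff.2 fun e he => ?_
    obtain ⟨N, τ, hτ, hτ0, hτN, h⟩ := hW.minty_limit hT hι hE hd (e := (e / 2) ^ 2) (by positivity)
    refine ⟨(fun k => u₀ (τ k)) '' Iic N, (finite_Iic N).image _, ?_⟩
    rintro _ ⟨t, rfl⟩
    simp only [mem_iUnion, mem_image, exists_prop, exists_exists_and_eq_and]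
    set j := Nat.findGreatest (fun k => τ k ≤ t) N with hj
    have hjN : j ≤ N := Nat.findGreatest_le N
    have hj1 : τ j ≤ t := Nat.findGreatest_spec (P := fun k => τ k ≤ t) (Nat.zero_le N) (by
      simp only [← Subtype.coe_le_coe, hτ0]; exact t.2.1)
    have hj2 : t ≤ τ (j + 1) := by
      rcases hjN.eq_or_lt with h1 | h1
      · rw [h1, ← Subtype.coe_le_coe, hτN]; exact t.2.2
      · exact (not_le.1 (Nat.findGreatest_is_greatest (P := fun k => τ k ≤ t)
          (Nat.lt_succ_self j) h1)).le
    refine ⟨j, hjN, ?_⟩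
    have h1 := h t 0 0
    simp only [smul_zero, sub_zero, map_zero, integral_zero, inner_zero_right, mul_zero,
      add_zero, norm_zero, ne_eq, OfNat.ofNat_ne_zero, not_false_eq_true, zero_pow] at h1
    have h2 := (Finset.single_le_sum (f := fun k =>
      ‖u₀ (min (τ (k + 1)) t) - u₀ (min (τ k) t)‖ ^ 2) (fun _ _ => by positivity)
      (Finset.mem_range.2 (Nat.lt_succ_of_le hjN))).trans h1
    simp only [min_eq_right hj2, min_eq_left hj1] at h2
    rw [Metric.mem_ball, dist_eq_norm]
    have h3 := abs_le_of_sq_le_sq' h2 (by positivity)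
    linarith [h3.2]
  have hcomp : IsCompact (closure (range u₀)) := htb.closure.isCompact_of_isClosed isClosed_closure
  have : CompactSpace (closure (range u₀)) := isCompact_iff_compactSpace.1 hcomp
  let Φ : closure (range u₀) → ℕ → ℝ := fun h j => inner ℝ (h : H) (ι (d j))
  have hΦ : Continuous Φ := continuous_pi fun j =>
    continuous_subtype_val.inner continuous_const
  have hΦi : Function.Injective Φ := fun h h' hh => by
    refine Subtype.ext ((hι.comp hW.dense ι.continuous).eq_of_inner_left ℝ fun j => ?_)
    exact congrFun hh j
  let U : Time T → closure (range u₀) := fun t => ⟨u₀ t, subset_closure ⟨t, rfl⟩⟩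
  suffices hU : Continuous U from continuous_subtype_val.comp hU
  rw [(hΦ.isClosedEmbedding hΦi).isInducing.continuous_iff]
  refine continuous_pi fun j => ?_
  -- weak continuity, inherited from the equicontinuity of the approximations
  change Continuous fun t => (inner ℝ (u₀ t) (ι (d j)) : ℝ)
  rw [Metric.continuous_iff]
  intro t e he
  obtain ⟨δ, hδ, h⟩ := hW.toGalerkinSeq.equicontinuous hE j (half_pos he)
  have key : ∀ s t : Time T, s ≤ t → (t : ℝ) - s < δ →
      |(inner ℝ (u₀ t) (ι (d j)) : ℝ) - inner ℝ (u₀ s) (ι (d j))| ≤ e / 2 := by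
    intro s t hst hd'
    refine le_of_tendsto ((hW.u_weak t (ι (d j))).sub (hW.u_weak s (ι (d j)))).abs ?_
    filter_upwards [h] with n hn
    rw [← inner_sub_left]
    exact hn s t hst hd'
  refine ⟨δ, hδ, fun s hs => ?_⟩
  rw [Subtype.dist_eq, Real.dist_eq] at hs
  rw [Real.dist_eq]
  rcases le_total s t with h1 | h1
  · rw [abs_sub_comm]
    rw [abs_sub_comm] at hs
    exact (key s t h1 ((le_abs_self _).trans_lt hs)).trans_lt (half_lt_self he)
  · exact (key t s h1 ((le_abs_self _).trans_lt hs)).trans_lt (half_lt_self he)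

/-- One half of the equation for the limit: the inequality of `WeakLimit.minty_limit` is divided by `l`,
and `l → 0` by hemicontinuity. The other half follows by replacing `φ` with `-φ`. -/
theorem WeakLimit.inner_le (hT : 0 < T) (hι : DenseRange ι)
    (hW : WeakLimit ι A b α d x R C₁ ε Q w u w₀ u₀)
    (hE : EvolutionData ι A b α β θ C k F c) (hd : DenseRange (toVDual ι)) (t : Time T) (φ : V) :
    inner ℝ (u₀ t - x) (ι φ) ≤ ∫ s in Iic t, total ι A b s (w₀ s) φ ∂leb T := by
  have hα := hE.one_lt
  have hC := hE.C_nonneg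
  have hR := hW.R_nonneg
  set l : ℕ → ℝ := fun m => 1 / ((m : ℝ) + 1) with hl
  have hl0 : ∀ m, 0 < l m := fun m => by positivity
  have hl1 : ∀ m, l m ≤ 1 := fun m => by
    rw [hl, div_le_one (by positivity)]; linarith [(Nat.cast_nonneg m : (0 : ℝ) ≤ m)]
  have hlt : Tendsto l atTop (𝓝 0) := tendsto_one_div_add_atTop_nhds_zero_nat
  set r : Time T → ℝ := fun s => ‖w₀ s‖ + ‖φ‖ with hr
  have hri : Integrable (fun s => r s ^ α) (leb T) := by
    have h1 := integrable_norm_rpow hα.le (hW.w₀_memLp.norm.add (memLp_const ‖φ‖))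
    refine h1.congr (Eventually.of_forall fun s => ?_)
    simp only [Pi.add_apply, hr]
    rw [Real.norm_of_nonneg (by positivity)]
  have hrle : ∀ m s, ‖w₀ s - l m • φ‖ ≤ r s := fun m s => by
    refine (_root_.norm_sub_le _ _).trans (add_le_add_right ?_ _)
    rw [norm_smul, Real.norm_of_nonneg (hl0 m).le]
    exact mul_le_of_le_one_left (norm_nonneg _) (hl1 m)
  set R'' := R + ‖ι φ‖ with hR''
  have hRle : ∀ m, ∀ᵐ s ∂leb T, ‖ι (w₀ s - l m • φ)‖ ≤ R'' := fun m => by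
    filter_upwards [hW.w₀_le] with s hs
    rw [map_sub, map_smul]
    refine (_root_.norm_sub_le _ _).trans (add_le_add hs ?_)
    rw [norm_smul, Real.norm_of_nonneg (hl0 m).le]
    exact mul_le_of_le_one_left (norm_nonneg _) (hl1 m)
  set κ : Time T → ℝ := fun s => k s + C * (1 + r s ^ α) * (1 + R'' ^ β) with hκ
  have hκi : Integrable κ (leb T) :=
    hE.k_int.add ((((integrable_const (1 : ℝ)).add hri).const_mul C).mul_const _)
  set M : ℝ := ∫ s in Iic t, κ s * ‖ι φ‖ ^ 2 ∂leb T with hM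
  have hineq : ∀ m, inner ℝ (u₀ t - x) (ι φ)
      ≤ ∫ s in Iic t, total ι A b s (w₀ s - l m • φ) φ ∂leb T + l m / 2 * M := by
    intro m
    have h1 : 0 ≤ 2 * l m * (∫ s in Iic t, total ι A b s (w₀ s - l m • φ) φ ∂leb T
            - inner ℝ (u₀ t - x) (ι φ))
          + ∫ s in Iic t, monoWeight ι α β C k s (w₀ s - l m • φ) * ‖ι (l m • φ)‖ ^ 2 ∂leb T := by
      refine le_of_forall_pos_le_add fun e he => ?_
      obtain ⟨N, τ, -, -, -, h⟩ := hW.minty_limit hT hι hE hd he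
      have h2 := h t φ (l m)
      have h3 : 0 ≤ ∑ k ∈ Finset.range (N + 1),
          ‖u₀ (min (τ (k + 1)) t) - u₀ (min (τ k) t)‖ ^ 2 :=
        Finset.sum_nonneg fun _ _ => by positivity
      linarith
    have h2 : ∫ s in Iic t, monoWeight ι α β C k s (w₀ s - l m • φ) * ‖ι (l m • φ)‖ ^ 2 ∂leb T
        ≤ l m ^ 2 * M := by
      rw [hM, ← integral_const_mul]
      refine integral_mono_of_nonneg (Eventually.of_forall fun s =>
        mul_nonneg (hE.monoWeight_nonneg _ _) (by positivity))
        ((hκi.mul_const _).const_mul _).integrableOn (ae_restrict_of_ae ?_)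
      filter_upwards [hRle m] with s hs
      have h3 := hE.monoWeight_le s (hrle m s) hs
      have h4 : ‖ι (l m • φ)‖ ^ 2 = l m ^ 2 * ‖ι φ‖ ^ 2 := by
        rw [map_smul, norm_smul, mul_pow, Real.norm_of_nonneg (hl0 m).le]
      rw [h4]
      calc _ ≤ κ s * (l m ^ 2 * ‖ι φ‖ ^ 2) := by gcongr
        _ = _ := by ring
    have h3 : 0 ≤ l m * (2 * (∫ s in Iic t, total ι A b s (w₀ s - l m • φ) φ ∂leb T
            - inner ℝ (u₀ t - x) (ι φ)) + l m * M) := by linarith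
    have h4 := nonneg_of_mul_nonneg_right h3 (hl0 m)
    linarith
  have htm : ∀ m, AEStronglyMeasurable (fun s => total ι A b s (w₀ s - l m • φ) φ) (leb T) := by
    intro m
    have h1 : Measurable fun s => total ι A b s (w₀ s - l m • φ) :=
      hE.measurable_total.comp (measurable_id.prodMk
        ((measurable_sub_const' (l m • φ)).comp hW.w₀_meas))
    exact ((ContinuousLinearMap.apply ℝ ℝ φ).continuous.measurable.comp h1).aestronglyMeasurable
  have hdom : Integrable (fun s => (1 + (F s + C * r s ^ α) * (1 + R'' ^ β)
      + ‖toVDualL ι‖ * (c s * (1 + R''))) * ‖φ‖) (leb T) :=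
    (((integrable_const _).add ((hE.F_int.add (hri.const_mul C)).mul_const _)).add
      ((hE.c_int.mul_const _).const_mul _)).mul_const _
  have hlim := tendsto_integral_of_dominated_convergence (μ := (leb T).restrict (Iic t))
    (F := fun m s => total ι A b s (w₀ s - l m • φ) φ) (f := fun s => total ι A b s (w₀ s) φ)
    _ (fun m => (htm m).restrict) hdom.integrableOn
    (fun m => ae_restrict_of_ae (by
      filter_upwards [hRle m] with s hs
      refine ((total ι A b s (w₀ s - l m • φ)).le_opNorm φ).trans ?_
      exact mul_le_mul_of_nonneg_right (hE.norm_total_le s (hrle m s) hs) (norm_nonneg _)))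
    (Eventually.of_forall fun s => by
      have h1 : Tendsto (fun m => -l m) atTop (𝓝 0) := by simpa using hlt.neg
      have h2 := ((hE.hemi_A s (w₀ s) φ φ).tendsto 0).comp h1
      have h3 : Tendsto (fun m => (inner ℝ (b s (w₀ s + (-l m) • φ)) (ι φ) : ℝ)) atTop
          (𝓝 (inner ℝ (b s (w₀ s + (0 : ℝ) • φ)) (ι φ))) :=
        (((hE.hemi_b s (w₀ s) φ).tendsto 0).comp h1).inner tendsto_const_nhds
      have h4 := h2.add h3
      simp only [zero_smul, add_zero] at h4
      refine h4.congr fun m => ?_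
      simp only [Function.comp_apply, total_apply, neg_smul, sub_eq_add_neg])
  have hfin := hlim.add ((hlt.div_const 2).mul_const M)
  rw [zero_div, zero_mul, add_zero] at hfin
  exact ge_of_tendsto' hfin hineq

end

/-- Existence of solutions of evolution equations with locally monotone, coercive operators. -/
theorem EvolutionData.exists_solution {T : ℝ} (hT : 0 < T)
    {V : Type*} [NormedAddCommGroup V] [NormedSpace ℝ V] [CompleteSpace V]
    [TopologicalSpace.SeparableSpace V] [MeasurableSpace V] [BorelSpace V] (hV : IsReflexive V)
    {H : Type*} [NormedAddCommGroup H] [InnerProductSpace ℝ H] [CompleteSpace H]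
    [TopologicalSpace.SeparableSpace H] [MeasurableSpace H] [BorelSpace H]
    {ι : V →L[ℝ] H} (hι : Function.Injective ι) (hι' : DenseRange ι)
    {A : Time T → V → StrongDual ℝ V} {b : Time T → V → H} {α β θ C : ℝ} {k F c : Time T → ℝ}
    (hE : EvolutionData ι A b α β θ C k F c) (x : H) :
    ∃ (u : C(Time T, H)) (w : Time T → V), Measurable w ∧ MemLp w (ENNReal.ofReal α) (leb T) ∧
      (∀ᵐ s ∂leb T, ι (w s) = u s) ∧ Integrable (fun s => A s (w s)) (leb T) ∧
      Integrable (fun s => b s (w s)) (leb T) ∧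
      ∀ t, toVDual ι (u t) = toVDual ι x + (∫ s in Iic t, A s (w s) ∂leb T)
        + toVDual ι (∫ s in Iic t, b s (w s) ∂leb T) := by
  have := secondCountable_dual hV hι
  have : SecondCountableTopology H := UniformSpace.secondCountable_of_separable H
  have hd := denseRange_toVDual hV hι
  obtain ⟨d, Q, hQ⟩ := exists_finiteRankApprox (ι := ι) hι
  obtain ⟨R, C₁, ε, w, u, hG⟩ := hE.exists_galerkinSeq hT hι' hQ x
  obtain ⟨σ, u₀, hσ, hu₀R, hu₀⟩ := hG.exists_subseq hT hι' hQ.dense hE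
  have hGσ := hG.comp hσ.tendsto_atTop
  obtain ⟨hum, hwlim, w₀, hw₀m, hw₀p, hw₀i, hw₀e⟩ := hGσ.exists_limit hV hι hι' hQ hE hu₀
  have hW : WeakLimit ι A b α d x R C₁ (ε ∘ σ) (Q ∘ σ) (w ∘ σ) (u ∘ σ) w₀ u₀ :=
    { hGσ with
      dense := hQ.dense
      u_weak := hu₀
      w_weak := hwlim
      u₀_meas := hum
      u₀_le := hu₀R
      w₀_meas := hw₀m
      w₀_memLp := hw₀p
      w₀_int_le := hw₀i
      w₀_eq := hw₀e }
  obtain ⟨hA1, hA2, -⟩ := hE.integrable_A_rpow hw₀m hw₀p hG.R_nonneg hW.w₀_le hw₀i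
  have hAi := integrable_of_rpow hE.one_le_conj hA1 hA2
  have hbm : Measurable fun s => b s (w₀ s) := hE.measurable_b.comp (measurable_id.prodMk hw₀m)
  have hbi : Integrable (fun s => b s (w₀ s)) (leb T) := by
    refine (hE.c_int.mul_const (1 + R)).mono' hbm.aestronglyMeasurable ?_
    filter_upwards [hW.w₀_le] with s hs
    have := hE.c_nonneg s
    exact (hE.growth_b s _).trans (by gcongr)
  refine ⟨⟨u₀, hW.continuous hT hι' hE hd⟩, w₀, hw₀m, hw₀p, hw₀e, hAi, hbi, fun t => ?_⟩
  have hbi' : Integrable (fun s => toVDual ι (b s (w₀ s))) (leb T) :=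
    (toVDualL ι).integrable_comp hbi
  ext φ
  have h1 := hW.inner_le hT hι' hE hd t φ
  have h2 := hW.inner_le hT hι' hE hd t (-φ)
  simp only [map_neg, inner_neg_right, integral_neg] at h2
  have h3 : inner ℝ (u₀ t - x) (ι φ) = ∫ s in Iic t, total ι A b s (w₀ s) φ ∂leb T := by linarith
  rw [inner_sub_left] at h3
  have h4 : ∫ s in Iic t, total ι A b s (w₀ s) φ ∂leb T
      = (∫ s in Iic t, A s (w₀ s) ∂leb T) φ + toVDual ι (∫ s in Iic t, b s (w₀ s) ∂leb T) φ := by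
    rw [setIntegral_toVDual ι hbi, ContinuousLinearMap.integral_apply hAi.integrableOn,
      ContinuousLinearMap.integral_apply hbi'.integrableOn, ← integral_add]
    · rfl
    · exact (hAi.apply_continuousLinearMap φ).integrableOn
    · exact (hbi'.apply_continuousLinearMap φ).integrableOn
  simp only [ContinuousMap.coe_mk, add_apply, toVDual_apply] at h4 ⊢
  linarith

/-! ### Entropy and exponential integrability -/

/-- The Young function `e^|x| - 1 - |x|`. -/
def expGauge (x : ℝ) : ℝ := Real.exp |x| - 1 - |x|

/-- The entropy density `r log r - r + 1`, the convex conjugate of `e^x - 1`. -/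
def entropyFun (r : ℝ) : ℝ := r * Real.log r - r + 1

theorem expGauge_nonneg (x : ℝ) : 0 ≤ expGauge x := by
  have := Real.add_one_le_exp |x|
  unfold expGauge; linarith

theorem expGauge_zero : expGauge 0 = 0 := by simp [expGauge]

theorem continuous_expGauge : Continuous expGauge := by
  unfold expGauge; fun_prop

theorem expGauge_le {x y : ℝ} (h : |x| ≤ |y|) : expGauge x ≤ expGauge y := by
  have h1 := Real.add_one_le_exp (|y| - |x|)
  have h2 : Real.exp |y| = Real.exp |x| * Real.exp (|y| - |x|) := by
    rw [← Real.exp_add]; congr 1; ring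
  have h3 : 1 ≤ Real.exp |x| := Real.one_le_exp (abs_nonneg _)
  unfold expGauge
  nlinarith

theorem expGauge_le_exp (x : ℝ) : expGauge x ≤ Real.exp |x| := by
  have := abs_nonneg x
  unfold expGauge; linarith

theorem expGauge_le_mul (x : ℝ) : expGauge x ≤ |x| * Real.exp |x| := by
  have h := Real.add_one_le_exp (-|x|)
  have h1 : Real.exp |x| * Real.exp (-|x|) = 1 := by rw [← Real.exp_add]; simp
  have h2 := Real.exp_pos |x|
  have := abs_nonneg x
  unfold expGauge
  nlinarith

theorem expGauge_le_sq_mul (x : ℝ) : expGauge x ≤ x ^ 2 * Real.exp |x| := by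
  have h := expGauge_le_mul x
  have h0 := abs_nonneg x
  have h2 := Real.exp_pos |x|
  rcases le_total 1 |x| with h1 | h1
  · have : |x| ≤ x ^ 2 := by rw [← sq_abs]; nlinarith
    nlinarith
  · have h3 := Real.abs_exp_sub_one_sub_id_le (x := |x|) (by rwa [abs_abs])
    rw [sq_abs] at h3
    have h4 := (le_abs_self _).trans h3
    have h5 : 1 ≤ Real.exp |x| := Real.one_le_exp h0
    unfold expGauge
    nlinarith [sq_nonneg x]

theorem entropyFun_nonneg {b : ℝ} (hb : 0 ≤ b) : 0 ≤ entropyFun b := by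
  rcases hb.eq_or_lt with rfl | hb
  · simp [entropyFun]
  · have h := Real.one_sub_inv_le_log_of_pos hb
    have h1 : b * (1 - b⁻¹) = b - 1 := by field_simp
    unfold entropyFun
    nlinarith

/-- Young's inequality for the entropy density. -/
theorem mul_abs_sub_one_le (a : ℝ) {b : ℝ} (hb : 0 ≤ b) :
    |a| * |b - 1| ≤ expGauge a + entropyFun b := by
  have key : ∀ y : ℝ, y * b ≤ Real.exp y + b * Real.log b - b := by
    intro y
    rcases hb.eq_or_lt with rfl | hb
    · simpa using (Real.exp_pos y).le
    · have h1 := Real.add_one_le_exp (y - Real.log b)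
      have h2 : Real.exp y = b * Real.exp (y - Real.log b) := by
        rw [Real.exp_sub, Real.exp_log hb]; field_simp
      nlinarith
  have h1 := key |a|
  have h2 := key (-|a|)
  have h3 : Real.exp (-|a|) - 1 + |a| ≤ Real.exp |a| - 1 - |a| := by
    have := Real.self_le_sinh_iff.2 (abs_nonneg a)
    rw [Real.sinh_eq] at this
    linarith
  unfold expGauge entropyFun
  rcases le_total 1 b with h | h
  · rw [abs_of_nonneg (sub_nonneg.2 h)]; linarith
  · rw [abs_of_nonpos (sub_nonpos.2 h)]; linarith

section

variable {Y : Type*} [MeasurableSpace Y] {μ : Measure Y}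

/-- Functions all of whose multiples have an integrable gauge. Unlike exponential integrability of
`ψ` itself, this is meaningful on spaces of infinite measure. -/
structure ExpIntegrable (ψ : Y → ℝ) (μ : Measure Y) : Prop where
  aesm : AEStronglyMeasurable ψ μ
  int : ∀ σ : ℝ, 0 < σ → Integrable (fun q => expGauge (σ * ψ q)) μ

/-- Measurable densities with entropy at most `N`. -/
structure EntropyLe (g : Y → ℝ≥0) (μ : Measure Y) (N : ℝ) : Prop where
  meas : Measurable g
  int : Integrable (fun q => entropyFun (g q)) μ
  le : ∫ q, entropyFun (g q) ∂μ ≤ N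

theorem ExpIntegrable.mono {ψ φ : Y → ℝ} (hψ : ExpIntegrable ψ μ) (hφ : AEStronglyMeasurable φ μ)
    (h : ∀ᵐ q ∂μ, |φ q| ≤ |ψ q|) : ExpIntegrable φ μ := by
  refine ⟨hφ, fun σ hσ => (hψ.int σ hσ).mono' ?_ ?_⟩
  · exact continuous_expGauge.comp_aestronglyMeasurable (hφ.const_mul σ)
  · filter_upwards [h] with q hq
    rw [Real.norm_of_nonneg (expGauge_nonneg _)]
    refine expGauge_le ?_
    rw [abs_mul, abs_mul]
    gcongr

theorem ExpIntegrable.const_mul {ψ : Y → ℝ} (hψ : ExpIntegrable ψ μ) (c : ℝ) :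
    ExpIntegrable (fun q => c * ψ q) μ := by
  refine ⟨hψ.aesm.const_mul c, fun σ hσ => (hψ.int (σ * (|c| + 1)) (by positivity)).mono' ?_
    (Eventually.of_forall fun q => ?_)⟩
  · exact continuous_expGauge.comp_aestronglyMeasurable ((hψ.aesm.const_mul c).const_mul σ)
  · rw [Real.norm_of_nonneg (expGauge_nonneg _)]
    refine expGauge_le ?_
    rw [abs_mul, abs_mul, abs_mul, abs_mul, abs_of_nonneg (by positivity : 0 ≤ |c| + 1),
      mul_assoc]
    gcongr
    linarith

/-- The integrals `∫ |ψ| |g - 1|` are finite, with a bound that depends on `g` through its entropy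
only, and whose contribution of the entropy is as small as desired. -/
theorem EntropyLe.integrable_mul {g : Y → ℝ≥0} {N : ℝ} (hg : EntropyLe g μ N) {ψ : Y → ℝ}
    (hψ : ExpIntegrable ψ μ) :
    Integrable (fun q => ψ q * ((g q : ℝ) - 1)) μ ∧ ∀ (S : Set Y) (σ : ℝ), 0 < σ →
      ∫ q in S, |ψ q| * |(g q : ℝ) - 1| ∂μ
        ≤ (∫ q in S, expGauge (σ * ψ q) ∂μ) / σ + N / σ := by
  have hgm : Measurable fun q => (g q : ℝ) - 1 := hg.meas.coe_nnreal_real.sub_const 1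
  have hint : Integrable (fun q => ψ q * ((g q : ℝ) - 1)) μ := by
    refine ((hψ.int 1 one_pos).add hg.int).mono' (hψ.aesm.mul hgm.aestronglyMeasurable)
      (Eventually.of_forall fun q => ?_)
    rw [norm_mul, Real.norm_eq_abs, Real.norm_eq_abs]
    simpa using mul_abs_sub_one_le (ψ q) (g q).coe_nonneg
  have habs : Integrable (fun q => |ψ q| * |(g q : ℝ) - 1|) μ :=
    hint.norm.congr (Eventually.of_forall fun q => by simp)
  refine ⟨hint, fun S σ hσ => ?_⟩
  have h1 : ∫ q in S, |ψ q| * |(g q : ℝ) - 1| ∂μ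
      ≤ ∫ q in S, (expGauge (σ * ψ q) / σ + entropyFun (g q) / σ) ∂μ := by
    refine integral_mono habs.integrableOn
      (((hψ.int σ hσ).div_const σ).add (hg.int.div_const σ)).integrableOn fun q => ?_
    have h2 := mul_abs_sub_one_le (σ * ψ q) (g q).coe_nonneg
    rw [abs_mul, abs_of_pos hσ, mul_assoc] at h2
    rw [← add_div, le_div_iff₀ hσ]
    linarith
  refine h1.trans ?_
  rw [integral_add ((hψ.int σ hσ).div_const σ).integrableOn (hg.int.div_const σ).integrableOn,
    integral_div, integral_div]
  have h3 : ∫ q in S, entropyFun (g q) ∂μ ≤ N := (setIntegral_le_integral hg.int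
    (Eventually.of_forall fun q => entropyFun_nonneg (g q).coe_nonneg)).trans hg.le
  gcongr

theorem EntropyLe.integrable_abs {g : Y → ℝ≥0} {N : ℝ} (hg : EntropyLe g μ N) {ψ : Y → ℝ}
    (hψ : ExpIntegrable ψ μ) : Integrable (fun q => |ψ q| * |(g q : ℝ) - 1|) μ :=
  (hg.integrable_mul hψ).1.norm.congr (Eventually.of_forall fun q => by simp)

/-- Dominated convergence, uniformly over all densities with bounded entropy. In the bound of
`EntropyLe.integrable_mul` the parameter `σ` is chosen to make the entropy term small; then the
gauge term tends to zero by the usual dominated convergence. -/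
theorem ExpIntegrable.eventually_le {Ψ : Y → ℝ} (hΨ : ExpIntegrable Ψ μ) {ψ : ℕ → Y → ℝ}
    (hψ : ∀ j, AEStronglyMeasurable (ψ j) μ) (hle : ∀ j, ∀ᵐ q ∂μ, |ψ j q| ≤ |Ψ q|)
    (hlim : ∀ᵐ q ∂μ, Tendsto (fun j => ψ j q) atTop (𝓝 0)) {N : ℝ} (hN : 0 ≤ N) {e : ℝ}
    (he : 0 < e) : ∀ᶠ j in atTop, ∀ g : Y → ℝ≥0, EntropyLe g μ N →
      ∫ q, |ψ j q| * |(g q : ℝ) - 1| ∂μ ≤ e := by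
  set σ : ℝ := 2 * (N + 1) / e with hσ
  have hσ0 : 0 < σ := by positivity
  have h1 : Tendsto (fun j => ∫ q, expGauge (σ * ψ j q) ∂μ) atTop (𝓝 0) := by
    have h := tendsto_integral_of_dominated_convergence (μ := μ)
      (F := fun j q => expGauge (σ * ψ j q)) (f := fun _ => (0 : ℝ)) _
      (fun j => continuous_expGauge.comp_aestronglyMeasurable ((hψ j).const_mul σ))
      (hΨ.int σ hσ0) (fun j => by
        filter_upwards [hle j] with q hq
        rw [Real.norm_of_nonneg (expGauge_nonneg _)]
        refine expGauge_le ?_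
        rw [abs_mul, abs_mul]
        gcongr) (by
        filter_upwards [hlim] with q hq
        have h2 := (continuous_expGauge.tendsto (σ * 0)).comp (hq.const_mul σ)
        simpa [expGauge_zero, Function.comp_def] using h2)
    simpa using h
  filter_upwards [h1.eventually (gt_mem_nhds (show (0 : ℝ) < σ * (e / 2) by positivity))]
    with j hj g hg
  have h2 := (hg.integrable_mul (hΨ.mono (hψ j) (hle j))).2 univ σ hσ0
  rw [setIntegral_univ, setIntegral_univ] at h2
  have h3 : (∫ q, expGauge (σ * ψ j q) ∂μ) / σ ≤ e / 2 := by
    rw [div_le_iff₀ hσ0]; linarith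
  have h4 : N / σ ≤ e / 2 := by
    rw [div_le_iff₀ hσ0, hσ]
    field_simp
    linarith
  linarith

/-- Square-integrable functions with an exponential moment of order `p ≥ 2` on sets of finite
measure are exponentially integrable: where the function is at most one its gauge is bounded by a
multiple of its square, and elsewhere, on a set of finite measure, `σ x ≤ δ x ^ p + σ² / δ`. -/
theorem expIntegrable_of_memLp {ψ : Y → ℝ} (h0 : ∀ q, 0 ≤ ψ q) (h2 : MemLp ψ 2 μ) {p δ : ℝ}
    (hp : 2 ≤ p) (hδ : 0 < δ)
    (hexp : ∀ Γ : Set Y, MeasurableSet Γ → μ Γ < ∞ →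
      ∫⁻ q in Γ, ENNReal.ofReal (Real.exp (δ * ψ q ^ p)) ∂μ < ∞) : ExpIntegrable ψ μ := by
  refine ⟨h2.1, fun σ hσ => ?_⟩
  have hsq : Integrable (fun q => ψ q ^ 2) μ := h2.integrable_sq
  set Γ₀ : Set Y := {q | 1 ≤ ψ q ^ 2} with hΓ₀
  have hΓ₀fin : μ Γ₀ < ∞ := by
    have h := hsq.measure_norm_ge_lt_top one_pos
    refine lt_of_le_of_lt (measure_mono fun q hq => ?_) h
    have hq' : 1 ≤ ψ q ^ 2 := hq
    change 1 ≤ ‖ψ q ^ 2‖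
    rwa [Real.norm_of_nonneg (by positivity)]
  set Γ := toMeasurable μ Γ₀ with hΓ
  have hΓm : MeasurableSet Γ := measurableSet_toMeasurable _ _
  have hΓfin : μ Γ < ∞ := by rwa [hΓ, measure_toMeasurable]
  have hm : AEStronglyMeasurable (fun q => expGauge (σ * ψ q)) μ :=
    continuous_expGauge.comp_aestronglyMeasurable (h2.1.const_mul σ)
  have hsmall : ∀ q, q ∉ Γ → ψ q ≤ 1 := fun q hq => by
    have h3 : q ∉ Γ₀ := fun h => hq (subset_toMeasurable _ _ h)
    have h4 : ψ q ^ 2 < 1 := not_le.1 h3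
    have := h0 q
    nlinarith
  have hmexp : AEStronglyMeasurable (fun q => Real.exp (δ * ψ q ^ p)) μ :=
    (((h2.1.aemeasurable.pow_const p).const_mul δ).exp).aestronglyMeasurable
  have hiexp : IntegrableOn (fun q => Real.exp (δ * ψ q ^ p)) Γ μ := by
    refine ⟨hmexp.restrict, ?_⟩
    rw [hasFiniteIntegral_iff_ofReal (Eventually.of_forall fun q => (Real.exp_pos _).le)]
    exact hexp Γ hΓm hΓfin
  rw [← integrableOn_univ, ← union_compl_self Γ]
  refine IntegrableOn.union ?_ ?_
  · refine Integrable.mono' ((hiexp.add (integrableOn_const (C := Real.exp δ)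
      hΓfin.ne)).const_mul (Real.exp (σ ^ 2 / δ))) hm.restrict (Eventually.of_forall fun q => ?_)
    rw [Real.norm_of_nonneg (expGauge_nonneg _)]
    refine (expGauge_le_exp _).trans ?_
    have hψ0 := h0 q
    rw [abs_of_nonneg (by positivity)]
    have h3 : σ * ψ q ≤ σ ^ 2 / δ + δ * ψ q ^ 2 := by
      have h4 : 0 ≤ δ * (σ / δ - ψ q) ^ 2 + σ * ψ q := by positivity
      have h5 : δ * (σ / δ - ψ q) ^ 2 = σ ^ 2 / δ - 2 * σ * ψ q + δ * ψ q ^ 2 := by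
        field_simp
        ring
      linarith
    have h6 : ψ q ^ 2 ≤ ψ q ^ p ∨ ψ q ^ 2 ≤ 1 := by
      rcases le_total 1 (ψ q) with h | h
      · left
        have := Real.rpow_le_rpow_of_exponent_le h hp
        rwa [Real.rpow_two] at this
      · right; nlinarith
    calc Real.exp (σ * ψ q) ≤ Real.exp (σ ^ 2 / δ + δ * ψ q ^ 2) := Real.exp_le_exp.2 h3
      _ = Real.exp (σ ^ 2 / δ) * Real.exp (δ * ψ q ^ 2) := Real.exp_add _ _
      _ ≤ Real.exp (σ ^ 2 / δ) * (Real.exp (δ * ψ q ^ p) + Real.exp δ) := by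
        gcongr
        rcases h6 with h | h
        · have h7 : Real.exp (δ * ψ q ^ 2) ≤ Real.exp (δ * ψ q ^ p) := by gcongr
          linarith [Real.exp_pos δ]
        · have h7 : Real.exp (δ * ψ q ^ 2) ≤ Real.exp δ :=
            Real.exp_le_exp.2 (mul_le_of_le_one_right hδ.le h)
          linarith [Real.exp_pos (δ * ψ q ^ p)]
  · refine Integrable.mono' (hsq.const_mul (σ ^ 2 * Real.exp σ)).integrableOn hm.restrict ?_
    filter_upwards [ae_restrict_mem hΓm.compl] with q hq
    rw [Real.norm_of_nonneg (expGauge_nonneg _)]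
    refine (expGauge_le_sq_mul _).trans ?_
    have h3 := hsmall q hq
    have h4 := h0 q
    rw [abs_of_nonneg (by positivity), mul_pow]
    have h5 : Real.exp (σ * ψ q) ≤ Real.exp σ :=
      Real.exp_le_exp.2 (mul_le_of_le_one_right hσ.le h3)
    calc σ ^ 2 * ψ q ^ 2 * Real.exp (σ * ψ q) ≤ σ ^ 2 * ψ q ^ 2 * Real.exp σ := by gcongr
      _ = _ := by ring

/-- Convergence of the densities against compactly supported continuous functions implies
convergence against exponentially integrable functions, for densities with bounded entropy. -/
theorem tendsto_integral_mul_sub [TopologicalSpace Y] [NormalSpace Y] [R1Space Y]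
    [WeaklyLocallyCompactSpace Y] [BorelSpace Y] [μ.Regular] [SigmaFinite μ] {N : ℝ} (hN : 0 ≤ N) {gs : ℕ → Y → ℝ≥0}
    {g : Y → ℝ≥0} (hgs : ∀ n, EntropyLe (gs n) μ N) (hg : EntropyLe g μ N)
    (hconv : ∀ φ : Y → ℝ, Continuous φ → HasCompactSupport φ →
      Tendsto (fun n => ∫ q, φ q * ((gs n q : ℝ) - g q) ∂μ) atTop (𝓝 0))
    {φ : Y → ℝ} (hφ : ExpIntegrable φ μ) :
    Tendsto (fun n => ∫ q, φ q * ((gs n q : ℝ) - g q) ∂μ) atTop (𝓝 0) := by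
  have hint : ∀ n {ψ : Y → ℝ}, ExpIntegrable ψ μ →
      Integrable (fun q => ψ q * ((gs n q : ℝ) - g q)) μ := fun n ψ hψ =>
    (((hgs n).integrable_mul hψ).1.sub (hg.integrable_mul hψ).1).congr
      (Eventually.of_forall fun q => by simp only [Pi.sub_apply]; ring)
  have habs : ∀ n {ψ : Y → ℝ}, ExpIntegrable ψ μ → ∀ {e : ℝ},
      (∀ g : Y → ℝ≥0, EntropyLe g μ N → ∫ q, |ψ q| * |(g q : ℝ) - 1| ∂μ ≤ e) →
      |∫ q, ψ q * ((gs n q : ℝ) - g q) ∂μ| ≤ e + e := by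
    intro n ψ hψ e h
    have h1 : ∫ q, ψ q * ((gs n q : ℝ) - g q) ∂μ
        = ∫ q, ψ q * ((gs n q : ℝ) - 1) ∂μ - ∫ q, ψ q * ((g q : ℝ) - 1) ∂μ := by
      rw [← integral_sub ((hgs n).integrable_mul hψ).1 (hg.integrable_mul hψ).1]
      exact integral_congr_ae (Eventually.of_forall fun q => by ring)
    have h2 : ∀ g : Y → ℝ≥0, EntropyLe g μ N → |∫ q, ψ q * ((g q : ℝ) - 1) ∂μ| ≤ e := fun g hg =>
      (abs_integral_le_integral_abs).trans ((h g hg).trans' (le_of_eq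
        (integral_congr_ae (Eventually.of_forall fun q => abs_mul _ _))))
    rw [h1]
    exact (abs_sub _ _).trans (add_le_add (h2 _ (hgs n)) (h2 _ hg))
  rw [Metric.tendsto_atTop']
  intro e he
  -- truncation of `φ` to a bounded function supported on a set of finite measure
  set φ' := hφ.aesm.mk φ with hφ'
  have hφφ' : φ =ᵐ[μ] φ' := hφ.aesm.ae_eq_mk
  have hφ'm : Measurable φ' := hφ.aesm.stronglyMeasurable_mk.measurable
  let Γ : ℕ → Set Y := fun j => spanningSets μ j ∩ {q | |φ' q| ≤ j}
  have hΓm : ∀ j, MeasurableSet (Γ j) := fun j =>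
    (measurableSet_spanningSets μ j).inter (measurableSet_le hφ'm.abs measurable_const)
  have hΓfin : ∀ j, μ (Γ j) < ∞ := fun j =>
    (measure_mono inter_subset_left).trans_lt (measure_spanningSets_lt_top μ j)
  have hev : ∀ q, ∀ᶠ j in atTop, q ∈ Γ j := by
    intro q
    have h1 := mem_iUnion.1 ((iUnion_spanningSets μ).symm ▸ mem_univ q)
    obtain ⟨i, hi⟩ := h1
    filter_upwards [eventually_ge_atTop i, eventually_ge_atTop ⌈|φ' q|⌉₊] with j h1 h2
    exact ⟨monotone_spanningSets μ h1 hi, Nat.ceil_le.1 h2⟩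
  have htr := hφ.eventually_le (ψ := fun j q => φ q - (Γ j).indicator φ' q)
    (fun j => hφ.aesm.sub (hφ'm.aestronglyMeasurable.indicator (hΓm j))) (fun j => by
      filter_upwards [hφφ'] with q hq
      by_cases h : q ∈ Γ j
      · rw [indicator_of_mem h, hq, sub_self, abs_zero]; exact abs_nonneg _
      · rw [indicator_of_notMem h, sub_zero])
    (by
      filter_upwards [hφφ'] with q hq
      refine tendsto_const_nhds.congr' ?_
      filter_upwards [hev q] with j hj
      rw [indicator_of_mem hj, hq, sub_self]) hN (e := e / 8) (by positivity)
  obtain ⟨j, hj⟩ := htr.exists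
  set χ : Y → ℝ := (Γ j).indicator φ' with hχ
  have hχm : AEStronglyMeasurable χ μ := hφ'm.aestronglyMeasurable.indicator (hΓm j)
  have hχj : ∀ q, |χ q| ≤ j := fun q => by
    by_cases h : q ∈ Γ j
    · rw [hχ, indicator_of_mem h]; exact h.2
    · rw [hχ, indicator_of_notMem h, abs_zero]; positivity
  have hχφ : ∀ᵐ q ∂μ, |χ q| ≤ |φ q| := by
    filter_upwards [hφφ'] with q hq
    by_cases h : q ∈ Γ j
    · rw [hχ, indicator_of_mem h, hq]
    · rw [hχ, indicator_of_notMem h, abs_zero]; exact abs_nonneg _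
  have hχE : ExpIntegrable χ μ := hφ.mono hχm hχφ
  have hχi : Integrable χ μ := by
    refine Integrable.mono' (g := (Γ j).indicator fun _ => (j : ℝ))
      ((integrable_indicator_iff (hΓm j)).2 (integrableOn_const (hΓfin j).ne)) hχm
      (Eventually.of_forall fun q => ?_)
    by_cases h : q ∈ Γ j
    · rw [indicator_of_mem h]; exact hχj q
    · rw [indicator_of_notMem h, hχ, indicator_of_notMem h, norm_zero]
  -- approximation by a compactly supported continuous function with the same bound
  set σ : ℝ := 2 * (N + 1) / (e / 8) with hσ
  have hσ0 : 0 < σ := by positivity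
  set D : ℝ := Real.exp (σ * (j + j)) with hD
  have hD0 : 0 < D := Real.exp_pos _
  obtain ⟨η₀, hη₀c, hη₀i, hη₀cont, hη₀int⟩ := hχi.exists_hasCompactSupport_integral_sub_le
    (ε := e / 16 / D) (by positivity)
  set η : Y → ℝ := fun q => max (-j) (min j (η₀ q)) with hη
  have hηc : Continuous η := continuous_const.max (continuous_const.min hη₀cont)
  have hηsupp : HasCompactSupport η := hη₀c.comp_left (g := fun x : ℝ => max (-(j : ℝ)) (min j x))
    (by simp)
  have hηj : ∀ q, |η q| ≤ j := fun q => abs_le.2 ⟨le_max_left _ _,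
    max_le (by linarith [(Nat.cast_nonneg j : (0 : ℝ) ≤ j)]) (min_le_left _ _)⟩
  have hηχ : ∀ q, |χ q - η q| ≤ |χ q - η₀ q| := fun q => by
    have h1 : χ q = max (-(j : ℝ)) (min j (χ q)) := by
      rw [min_eq_right (abs_le.1 (hχj q)).2, max_eq_right (abs_le.1 (hχj q)).1]
    conv_lhs => rw [h1]
    refine (abs_max_sub_max_le_max _ _ _ _).trans ?_
    rw [sub_self, abs_zero, max_eq_right (abs_nonneg _)]
    refine (abs_min_sub_min_le_max _ _ _ _).trans ?_
    rw [sub_self, abs_zero, max_eq_right (abs_nonneg _)]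
  have hdm : AEStronglyMeasurable (fun q => χ q - η q) μ := hχm.sub hηc.aestronglyMeasurable
  have hdj : ∀ q, |χ q - η q| ≤ j + j := fun q =>
    (abs_sub _ _).trans (add_le_add (hχj q) (hηj q))
  have hdi : Integrable (fun q => |χ q - η₀ q|) μ := (hχi.sub hη₀int).abs
  have hgauge : ∀ (s : ℝ), 0 < s → ∀ q, expGauge (s * (χ q - η q))
      ≤ s * Real.exp (s * (j + j)) * |χ q - η₀ q| := by
    intro s hs q
    refine (expGauge_le_mul _).trans ?_
    rw [abs_mul, abs_of_pos hs]
    calc s * |χ q - η q| * Real.exp (s * |χ q - η q|)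
        ≤ s * |χ q - η₀ q| * Real.exp (s * (j + j)) := by
          exact mul_le_mul (mul_le_mul_of_nonneg_left (hηχ q) hs.le) (Real.exp_le_exp.2
            (mul_le_mul_of_nonneg_left (hdj q) hs.le)) (Real.exp_pos _).le (by positivity)
      _ = _ := by ring
  have hdE : ExpIntegrable (fun q => χ q - η q) μ := ⟨hdm, fun s hs =>
    (hdi.const_mul (s * Real.exp (s * (j + j)))).mono'
      (continuous_expGauge.comp_aestronglyMeasurable (hdm.const_mul s))
      (Eventually.of_forall fun q => by
        rw [Real.norm_of_nonneg (expGauge_nonneg _)]; exact hgauge s hs q)⟩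
  have hdsmall : ∀ g : Y → ℝ≥0, EntropyLe g μ N →
      ∫ q, |χ q - η q| * |(g q : ℝ) - 1| ∂μ ≤ e / 8 := by
    intro g hg
    have h1 := (hg.integrable_mul hdE).2 univ σ hσ0
    rw [setIntegral_univ, setIntegral_univ] at h1
    have h2 : ∫ q, expGauge (σ * (χ q - η q)) ∂μ ≤ σ * (e / 16) := by
      calc ∫ q, expGauge (σ * (χ q - η q)) ∂μ ≤ ∫ q, σ * D * |χ q - η₀ q| ∂μ :=
            integral_mono (hdE.int σ hσ0) (hdi.const_mul _) (hgauge σ hσ0)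
        _ ≤ σ * D * (e / 16 / D) := by
            rw [integral_const_mul]
            gcongr
            exact hη₀i
        _ = σ * (e / 16) := by field_simp
    have h3 : (∫ q, expGauge (σ * (χ q - η q)) ∂μ) / σ ≤ e / 16 := by
      rw [div_le_iff₀ hσ0]; linarith
    have h4 : N / σ ≤ e / 16 := by
      rw [div_le_iff₀ hσ0, hσ]
      field_simp
      linarith
    linarith
  have hηE : ExpIntegrable η μ := by
    refine ⟨hηc.aestronglyMeasurable, fun s hs => ?_⟩
    refine Continuous.integrable_of_hasCompactSupport
      (continuous_expGauge.comp (continuous_const.mul hηc)) ?_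
    exact hηsupp.comp_left (g := fun x => expGauge (s * x)) (by simp [expGauge_zero])
  obtain ⟨n₀, hn₀⟩ := Metric.tendsto_atTop'.1 (hconv η hηc hηsupp) (e / 4) (by positivity)
  refine ⟨n₀, fun n hn => ?_⟩
  have h1 := hn₀ n hn
  rw [Real.dist_eq, sub_zero] at h1 ⊢
  have htrE : ExpIntegrable (fun q => φ q - χ q) μ := by
    refine hφ.mono (hφ.aesm.sub hχm) ?_
    filter_upwards [hφφ'] with q hq
    by_cases h : q ∈ Γ j
    · rw [hχ, indicator_of_mem h, hq, sub_self, abs_zero]; exact abs_nonneg _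
    · rw [hχ, indicator_of_notMem h, sub_zero]
  have h2 := habs n htrE hj
  have h3 := habs n hdE hdsmall
  have h4 : ∫ q, φ q * ((gs n q : ℝ) - g q) ∂μ
      = ∫ q, (φ q - χ q) * ((gs n q : ℝ) - g q) ∂μ
        + ∫ q, (χ q - η q) * ((gs n q : ℝ) - g q) ∂μ + ∫ q, η q * ((gs n q : ℝ) - g q) ∂μ := by
    have h5 : Integrable (fun q => (φ q - χ q) * ((gs n q : ℝ) - g q)
      + (χ q - η q) * ((gs n q : ℝ) - g q)) μ := (hint n htrE).add (hint n hdE)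
    rw [← integral_add (hint n htrE) (hint n hdE), ← integral_add h5 (hint n hηE)]
    exact integral_congr_ae (Eventually.of_forall fun q => by ring)
  rw [h4]
  have h5 := abs_add_le (∫ q, (φ q - χ q) * ((gs n q : ℝ) - g q) ∂μ
        + ∫ q, (χ q - η q) * ((gs n q : ℝ) - g q) ∂μ) (∫ q, η q * ((gs n q : ℝ) - g q) ∂μ)
  have h6 := abs_add_le (∫ q, (φ q - χ q) * ((gs n q : ℝ) - g q) ∂μ)
    (∫ q, (χ q - η q) * ((gs n q : ℝ) - g q) ∂μ)
  linarith

end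

/-! ### The skeleton equation for a fixed control -/

section

variable {T : ℝ} {V : Type*} [NormedAddCommGroup V] [NormedSpace ℝ V] [MeasurableSpace V]
  {H : Type*} [NormedAddCommGroup H] [InnerProductSpace ℝ H] [MeasurableSpace H]
  {X : Type*} [MeasurableSpace X]

/-- The hypotheses on the coefficients of the skeleton equation in the form in which they are used:
the bound `L` and the Lipschitz constant `G` of `f` are exponentially integrable. -/
structure SkeletonData (ι : V →L[ℝ] H) (A : Time T → V → StrongDual ℝ V)
    (f : Time T → V → X → H) (ν : Measure X) (α β θ C : ℝ) (K F : Time T → ℝ)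
    (L G : Time T × X → ℝ) : Prop where
  one_lt : 1 < α
  beta_nonneg : 0 ≤ β
  theta_pos : 0 < θ
  C_nonneg : 0 ≤ C
  measurable_A : Measurable fun p : Time T × V => A p.1 p.2
  measurable_f : Measurable fun p : Time T × V × X => f p.1 p.2.1 p.2.2
  K_nonneg : ∀ t, 0 ≤ K t
  F_nonneg : ∀ t, 0 ≤ F t
  K_int : Integrable K (leb T)
  F_int : Integrable F (leb T)
  hemi : Hemicontinuity A
  mono : ∀ (t : Time T) (v₁ v₂ : V), 2 * (A t v₁ - A t v₂) (v₁ - v₂)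
    ≤ (K t + C * (1 + ‖v₂‖ ^ α) * (1 + ‖ι v₂‖ ^ β)) * ‖ι (v₁ - v₂)‖ ^ 2
  coer : Coercivity ι A α θ F
  growth : Growth ι A α β C F
  L_exp : ExpIntegrable L (nuT T ν)
  G_exp : ExpIntegrable G (nuT T ν)
  f_le : ∀ t v z, ‖f t v z‖ ≤ |L (t, z)| * (1 + ‖ι v‖)
  f_lip : ∀ t v₁ v₂ z, ‖f t v₁ z - f t v₂ z‖ ≤ |G (t, z)| * ‖ι (v₁ - v₂)‖

/-- The drift `∫ f(s, v, z) (g(s, z) - 1) ν(dz)`. -/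
def jumpDrift (f : Time T → V → X → H) (ν : Measure X) (g : Time T × X → ℝ≥0) (s : Time T)
    (v : V) : H := ∫ z, ((g (s, z) : ℝ) - 1) • f s v z ∂ν

/-- The function `s ↦ ∫ |L(s, z)| |g(s, z) - 1| ν(dz)`. -/
def controlNorm (ν : Measure X) (L : Time T × X → ℝ) (g : Time T × X → ℝ≥0) (s : Time T) : ℝ :=
  ∫ z, |L (s, z)| * |(g (s, z) : ℝ) - 1| ∂ν

variable {ι : V →L[ℝ] H} {A : Time T → V → StrongDual ℝ V} {f : Time T → V → X → H}
  {ν : Measure X} [SigmaFinite ν] {α β θ C : ℝ} {K F : Time T → ℝ} {L G : Time T × X → ℝ}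
  {g g' : Time T × X → ℝ≥0} {N : ℝ}

theorem controlNorm_nonneg (s : Time T) : 0 ≤ controlNorm ν L g s :=
  integral_nonneg fun _ => by positivity

theorem ExpIntegrable.integrable_controlNorm (hL : ExpIntegrable L (nuT T ν))
    (hg : EntropyLe g (nuT T ν) N) : Integrable (controlNorm ν L g) (leb T) :=
  (hg.integrable_abs hL).integral_prod_left

/-- `EntropyLe.integrable_mul` on sets of times: as `σ` is free, the integral is uniformly small over
short time intervals. -/
theorem ExpIntegrable.setIntegral_controlNorm_le (hL : ExpIntegrable L (nuT T ν))
    (hg : EntropyLe g (nuT T ν) N) (S : Set (Time T)) {σ : ℝ} (hσ : 0 < σ) :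
    ∫ s in S, controlNorm ν L g s ∂leb T
      ≤ (∫ s in S, ∫ z, expGauge (σ * L (s, z)) ∂ν ∂leb T) / σ + N / σ := by
  have h1 := (hg.integrable_mul hL).2 (S ×ˢ univ) σ hσ
  have h2 : ∫ q in S ×ˢ univ, |L q| * |(g q : ℝ) - 1| ∂nuT T ν
      = ∫ s in S, controlNorm ν L g s ∂leb T := by
    have h := setIntegral_prod (μ := leb T) (ν := ν) (s := S) (t := univ)
      (fun q => |L q| * |(g q : ℝ) - 1|) (hg.integrable_abs hL).integrableOn
    simp only [Measure.restrict_univ] at h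
    exact h
  have h3 : ∫ q in S ×ˢ univ, expGauge (σ * L q) ∂nuT T ν
      = ∫ s in S, ∫ z, expGauge (σ * L (s, z)) ∂ν ∂leb T := by
    have h := setIntegral_prod (μ := leb T) (ν := ν) (s := S) (t := univ)
      (fun q => expGauge (σ * L q)) (hL.int σ hσ).integrableOn
    simp only [Measure.restrict_univ] at h
    exact h
  rwa [h2, h3] at h1

/-- A bound for `∫∫ |L| |g - 1|` for densities with entropy at most `N`. -/
def controlBound (ν : Measure X) (L : Time T × X → ℝ) (N : ℝ) : ℝ :=
  ∫ s, ∫ z, expGauge (L (s, z)) ∂ν ∂leb T + N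

theorem ExpIntegrable.integral_controlNorm_le (hL : ExpIntegrable L (nuT T ν))
    (hg : EntropyLe g (nuT T ν) N) : ∫ s, controlNorm ν L g s ∂leb T ≤ controlBound ν L N := by
  have h := hL.setIntegral_controlNorm_le hg univ one_pos
  simpa [controlBound] using h

theorem ExpIntegrable.ae_integrable (hL : ExpIntegrable L (nuT T ν))
    (hg : EntropyLe g (nuT T ν) N) :
    ∀ᵐ s ∂leb T, Integrable (fun z => |L (s, z)| * |(g (s, z) : ℝ) - 1|) ν :=
  (hg.integrable_abs hL).prod_right_ae

variable [BorelSpace H] [SecondCountableTopology H]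

/-- The drift is defined at the times `s` with `∫ |L(s, z)| |g(s, z) - 1| ν(dz) < ∞`, simultaneously for
all `v`, with linear growth in `‖v‖_H`. -/
theorem SkeletonData.integrable_section (hS : SkeletonData ι A f ν α β θ C K F L G)
    (hg : Measurable g) {s : Time T}
    (hs : Integrable (fun z => |L (s, z)| * |(g (s, z) : ℝ) - 1|) ν) (v : V) :
    Integrable (fun z => ((g (s, z) : ℝ) - 1) • f s v z) ν ∧
      ‖jumpDrift f ν g s v‖ ≤ controlNorm ν L g s * (1 + ‖ι v‖) := by
  have hfm : Measurable fun z => f s v z :=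
    hS.measurable_f.comp (measurable_const.prodMk (measurable_const.prodMk measurable_id))
  have hgm : Measurable fun z => (g (s, z) : ℝ) - 1 :=
    (hg.comp measurable_prodMk_left).coe_nnreal_real.sub_const 1
  have hle : ∀ z, ‖((g (s, z) : ℝ) - 1) • f s v z‖
      ≤ |L (s, z)| * |(g (s, z) : ℝ) - 1| * (1 + ‖ι v‖) := fun z => by
    rw [norm_smul, Real.norm_eq_abs]
    calc |(g (s, z) : ℝ) - 1| * ‖f s v z‖
        ≤ |(g (s, z) : ℝ) - 1| * (|L (s, z)| * (1 + ‖ι v‖)) := by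
          gcongr; exact hS.f_le s v z
      _ = _ := by ring
  have hint : Integrable (fun z => ((g (s, z) : ℝ) - 1) • f s v z) ν :=
    (hs.mul_const (1 + ‖ι v‖)).mono' (hgm.smul hfm).aestronglyMeasurable
      (Eventually.of_forall hle)
  refine ⟨hint, ?_⟩
  rw [controlNorm, ← integral_mul_const]
  exact norm_integral_le_of_norm_le (hs.mul_const _) (Eventually.of_forall hle)

/-- The drift is Lipschitz continuous in the norm of `H`. -/
theorem SkeletonData.norm_jumpDrift_sub_le (hS : SkeletonData ι A f ν α β θ C K F L G)
    (hg : Measurable g) {s : Time T}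
    (hs : Integrable (fun z => |L (s, z)| * |(g (s, z) : ℝ) - 1|) ν)
    (hs' : Integrable (fun z => |G (s, z)| * |(g (s, z) : ℝ) - 1|) ν) (v₁ v₂ : V) :
    ‖jumpDrift f ν g s v₁ - jumpDrift f ν g s v₂‖ ≤ controlNorm ν G g s * ‖ι (v₁ - v₂)‖ := by
  rw [jumpDrift, jumpDrift, ← integral_sub (hS.integrable_section hg hs v₁).1
    (hS.integrable_section hg hs v₂).1, controlNorm, ← integral_mul_const]
  refine norm_integral_le_of_norm_le (hs'.mul_const _) (Eventually.of_forall fun z => ?_)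
  rw [← smul_sub, norm_smul, Real.norm_eq_abs]
  calc |(g (s, z) : ℝ) - 1| * ‖f s v₁ z - f s v₂ z‖
      ≤ |(g (s, z) : ℝ) - 1| * (|G (s, z)| * ‖ι (v₁ - v₂)‖) := by
        gcongr; exact hS.f_lip s v₁ v₂ z
    _ = _ := by ring

theorem SkeletonData.measurable_jumpDrift (hS : SkeletonData ι A f ν α β θ C K F L G)
    (hg : Measurable g) : Measurable fun q : Time T × V => jumpDrift f ν g q.1 q.2 := by
  have h : Measurable fun p : (Time T × V) × X => ((g (p.1.1, p.2) : ℝ) - 1) • f p.1.1 p.1.2 p.2 :=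
    ((hg.comp (measurable_fst.fst.prodMk measurable_snd)).coe_nnreal_real.sub_const 1).smul
      (hS.measurable_f.comp (measurable_fst.fst.prodMk (measurable_fst.snd.prodMk measurable_snd)))
  exact h.stronglyMeasurable.integral_prod_right'.measurable

/-- For a fixed control the skeleton equation is an evolution equation with a locally monotone,
coercive operator. At the exceptional times at which the integral defining the drift may diverge
the drift is replaced by zero. -/
theorem SkeletonData.exists_evolutionData (hS : SkeletonData ι A f ν α β θ C K F L G)
    (hg : EntropyLe g (nuT T ν) N) : ∃ b : Time T → V → H,
      EvolutionData ι A b α β θ C (fun s => K s + 2 * controlNorm ν G g s)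
        (fun s => F s + 4 * controlNorm ν L g s) (controlNorm ν L g) ∧
      ∀ᵐ s ∂leb T, ∀ v, b s v = jumpDrift f ν g s v := by
  classical
  set P : Time T → Prop := fun s => Integrable (fun z => |L (s, z)| * |(g (s, z) : ℝ) - 1|) ν ∧
    Integrable (fun z => |G (s, z)| * |(g (s, z) : ℝ) - 1|) ν with hP
  have hPae : ∀ᵐ s ∂leb T, P s := (hS.L_exp.ae_integrable hg).and (hS.G_exp.ae_integrable hg)
  set B : Set (Time T) := toMeasurable (leb T) {s | ¬ P s} with hB
  have hBm : MeasurableSet B := measurableSet_toMeasurable _ _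
  have hB0 : leb T B = 0 := by rw [hB, measure_toMeasurable]; exact hPae
  have hBP : ∀ s, s ∉ B → P s := fun s hs => by
    by_contra h
    exact hs (subset_toMeasurable _ _ h)
  set b : Time T → V → H := fun s v => if s ∈ B then 0 else jumpDrift f ν g s v with hb
  have hbe : ∀ s, s ∉ B → ∀ v, b s v = jumpDrift f ν g s v := fun s hs v => if_neg hs
  have hbB : ∀ s, s ∈ B → ∀ v, b s v = 0 := fun s hs v => if_pos hs
  have hlip : ∀ s v₁ v₂, ‖b s v₁ - b s v₂‖ ≤ controlNorm ν G g s * ‖ι (v₁ - v₂)‖ := by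
    intro s v₁ v₂
    by_cases h : s ∈ B
    · rw [hbB s h, hbB s h, sub_zero, norm_zero]
      exact mul_nonneg (controlNorm_nonneg _) (norm_nonneg _)
    · rw [hbe s h, hbe s h]
      exact hS.norm_jumpDrift_sub_le hg.meas (hBP s h).1 (hBP s h).2 v₁ v₂
  have hgrowth : ∀ s v, ‖b s v‖ ≤ controlNorm ν L g s * (1 + ‖ι v‖) := by
    intro s v
    by_cases h : s ∈ B
    · rw [hbB s h, norm_zero]
      exact mul_nonneg (controlNorm_nonneg _) (by positivity)
    · rw [hbe s h]
      exact (hS.integrable_section hg.meas (hBP s h).1 v).2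
  refine ⟨b, ?_, ?_⟩
  · refine
      { one_lt := hS.one_lt
        beta_nonneg := hS.beta_nonneg
        theta_pos := hS.theta_pos
        C_nonneg := hS.C_nonneg
        measurable_A := hS.measurable_A
        measurable_b := Measurable.ite (measurable_fst hBm) measurable_const
          (hS.measurable_jumpDrift hg.meas)
        k_nonneg := fun t => add_nonneg (hS.K_nonneg t) (mul_nonneg zero_le_two
          (controlNorm_nonneg t))
        F_nonneg := fun t => add_nonneg (hS.F_nonneg t) (mul_nonneg zero_le_four
          (controlNorm_nonneg t))
        c_nonneg := controlNorm_nonneg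
        k_int := hS.K_int.add ((hS.G_exp.integrable_controlNorm hg).const_mul 2)
        F_int := hS.F_int.add ((hS.L_exp.integrable_controlNorm hg).const_mul 4)
        c_int := hS.L_exp.integrable_controlNorm hg
        hemi_A := hS.hemi
        hemi_b := ?_
        mono := ?_
        coer := ?_
        growth := ?_
        growth_b := hgrowth }
    · intro t v₁ v₂
      rw [continuous_iff_continuousAt]
      intro s₀
      rw [ContinuousAt, tendsto_iff_norm_sub_tendsto_zero]
      refine squeeze_zero (fun _ => norm_nonneg _) (fun s => hlip t _ _) ?_
      have hc : Continuous fun s : ℝ => controlNorm ν G g t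
          * ‖ι ((v₁ + s • v₂) - (v₁ + s₀ • v₂))‖ := by fun_prop
      simpa using hc.tendsto s₀
    · intro t v₁ v₂
      have h1 := hS.mono t v₁ v₂
      have h2 : inner ℝ (b t v₁ - b t v₂) (ι (v₁ - v₂))
          ≤ controlNorm ν G g t * ‖ι (v₁ - v₂)‖ * ‖ι (v₁ - v₂)‖ :=
        (real_inner_le_norm _ _).trans (mul_le_mul_of_nonneg_right (hlip _ _ _) (norm_nonneg _))
      linarith
    · intro t v
      have h1 := hS.coer t v
      have h2 : inner ℝ (b t v) (ι v) ≤ controlNorm ν L g t * (1 + ‖ι v‖) * ‖ι v‖ :=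
        (real_inner_le_norm _ _).trans (mul_le_mul_of_nonneg_right (hgrowth _ _) (norm_nonneg _))
      have h3 : (1 + ‖ι v‖) * ‖ι v‖ ≤ 2 * (1 + ‖ι v‖ ^ 2) := by
        nlinarith [sq_nonneg (‖ι v‖ - 1)]
      have h4 := mul_le_mul_of_nonneg_left h3 (controlNorm_nonneg (ν := ν) (L := L) (g := g) t)
      linarith
    · intro t v
      refine (hS.growth t v).trans ?_
      have := controlNorm_nonneg (ν := ν) (L := L) (g := g) t
      gcongr
      linarith
  · filter_upwards [measure_eq_zero_iff_ae_notMem.1 hB0] with s hs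
    exact hbe s hs

/-- A solution `u` of the skeleton equation together with a measurable `V`-valued version `w`. -/
structure SolutionPair (ι : V →L[ℝ] H) (A : Time T → V → StrongDual ℝ V)
    (f : Time T → V → X → H) (ν : Measure X) (α : ℝ) (x : H) (g : Time T × X → ℝ≥0)
    (u : C(Time T, H)) (w : Time T → V) : Prop where
  meas : Measurable w
  memLp : MemLp w (ENNReal.ofReal α) (leb T)
  ae_eq : ∀ᵐ s ∂(leb T), ι (w s) = u s
  int_A : Integrable (fun s => A s (w s)) (leb T)
  int_f : Integrable (fun p : Time T × X => ((g p : ℝ) - 1) • f p.1 (w p.1) p.2) (nuT T ν)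
  eqn : ∀ t : Time T, toVDual ι (u t) = toVDual ι x + (∫ s in Set.Iic t, A s (w s) ∂(leb T)) +
      toVDual ι (∫ s in Set.Iic t, jumpDrift f ν g s (w s) ∂(leb T))

variable {x : H} {u u' : C(Time T, H)} {w w' : Time T → V}

theorem SolutionPair.isSkeletonSolution (h : SolutionPair ι A f ν α x g u w) :
    IsSkeletonSolution ι A f ν α x g u :=
  ⟨w, h.memLp, h.ae_eq, h.int_A, h.int_f, h.eqn⟩

/-- Solutions do not change when the control and the `V`-valued version are modified on null
sets. -/
theorem IsSkeletonSolution.exists_pair [BorelSpace V] (h : IsSkeletonSolution ι A f ν α x g u)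
    (hgg' : g =ᵐ[nuT T ν] g') : ∃ w, SolutionPair ι A f ν α x g' u w := by
  obtain ⟨w, h1, h2, h3, h4, h5⟩ := h
  set w' := h1.1.mk w with hw'
  have hww : w =ᵐ[leb T] w' := h1.1.ae_eq_mk
  have hwwp : ∀ᵐ p ∂nuT T ν, w p.1 = w' p.1 :=
    Measure.quasiMeasurePreserving_fst.ae hww
  have hboth : (fun p : Time T × X => ((g p : ℝ) - 1) • f p.1 (w p.1) p.2) =ᵐ[nuT T ν]
      fun p => ((g' p : ℝ) - 1) • f p.1 (w' p.1) p.2 := by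
    filter_upwards [hgg', hwwp] with p hp1 hp2
    rw [hp1, hp2]
  refine ⟨w', h1.1.stronglyMeasurable_mk.measurable, (memLp_congr_ae hww).1 h1, ?_, ?_,
    h4.congr hboth, fun t => ?_⟩
  · filter_upwards [hww, h2] with s hs hs'
    rw [← hs, hs']
  · exact h3.congr (hww.mono fun s hs => by simp only [hs])
  · rw [h5 t]
    have e1 : ∫ s in Iic t, A s (w s) ∂leb T = ∫ s in Iic t, A s (w' s) ∂leb T :=
      setIntegral_congr_ae measurableSet_Iic (hww.mono fun s hs _ => by rw [hs])
    have e2 : ∫ s in Iic t, (∫ z, ((g (s, z) : ℝ) - 1) • f s (w s) z ∂ν) ∂leb T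
        = ∫ s in Iic t, jumpDrift f ν g' s (w' s) ∂leb T := by
      refine setIntegral_congr_ae measurableSet_Iic ?_
      filter_upwards [Measure.ae_ae_of_ae_prod hboth] with s hs _
      exact integral_congr_ae hs
    rw [e1, e2]

theorem SolutionPair.integrable_jumpDrift (h : SolutionPair ι A f ν α x g u w) :
    Integrable (fun s => jumpDrift f ν g s (w s)) (leb T) := h.int_f.integral_prod_left

/-- The integrand of the drift along a path that is bounded in `H` is integrable on `[0,T] × X`. -/
theorem SkeletonData.integrable_prod (hS : SkeletonData ι A f ν α β θ C K F L G)
    (hg : EntropyLe g (nuT T ν) N) (hw : Measurable w) {R : ℝ}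
    (hwR : ∀ᵐ s ∂leb T, ‖ι (w s)‖ ≤ R) :
    Integrable (fun p : Time T × X => ((g p : ℝ) - 1) • f p.1 (w p.1) p.2) (nuT T ν) := by
  have hfm : Measurable fun p : Time T × X => f p.1 (w p.1) p.2 :=
    hS.measurable_f.comp (measurable_fst.prodMk ((hw.comp measurable_fst).prodMk measurable_snd))
  refine ((hg.integrable_abs hS.L_exp).mul_const (1 + R)).mono'
    ((hg.meas.coe_nnreal_real.sub_const 1).smul hfm).aestronglyMeasurable ?_
  have hwRp : ∀ᵐ p ∂nuT T ν, ‖ι (w p.1)‖ ≤ R := Measure.quasiMeasurePreserving_fst.ae hwR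
  filter_upwards [hwRp] with p hp
  rw [norm_smul, Real.norm_eq_abs]
  calc |(g p : ℝ) - 1| * ‖f p.1 (w p.1) p.2‖
      ≤ |(g p : ℝ) - 1| * (|L p| * (1 + R)) := by
        gcongr
        exact (hS.f_le p.1 _ p.2).trans (by gcongr)
    _ = _ := by ring

theorem SkeletonData.exists_solution [CompleteSpace V] [TopologicalSpace.SeparableSpace V]
    [BorelSpace V] [CompleteSpace H] (hT : 0 < T) (hV : IsReflexive V)
    (hι : Function.Injective ι) (hι' : DenseRange ι)
    (hS : SkeletonData ι A f ν α β θ C K F L G) (hg : EntropyLe g (nuT T ν) N) (x : H) :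
    ∃ u : C(Time T, H), IsSkeletonSolution ι A f ν α x g u := by
  obtain ⟨b, hE, hb⟩ := hS.exists_evolutionData hg
  obtain ⟨u, w, hw, h1, h2, h3, -, h5⟩ := hE.exists_solution hT hV hι hι' x
  obtain ⟨R, hR⟩ := (isCompact_range u.continuous).isBounded.exists_norm_le
  have hwR : ∀ᵐ s ∂leb T, ‖ι (w s)‖ ≤ R := h2.mono fun s hs => hs ▸ hR _ ⟨s, rfl⟩
  refine ⟨u, w, h1, h2, h3, hS.integrable_prod hg hw hwR, fun t => ?_⟩
  rw [h5 t]
  refine congrArg _ (congrArg _ (setIntegral_congr_ae measurableSet_Iic ?_))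
  filter_upwards [hb] with s hs _
  exact hs _

/-! ### Energy estimates -/

variable [BorelSpace V] [CompleteSpace H] [SecondCountableTopology (StrongDual ℝ V)]

theorem SolutionPair.integrable_A_rpow (hS : SkeletonData ι A f ν α β θ C K F L G)
    (hg : EntropyLe g (nuT T ν) N) (h : SolutionPair ι A f ν α x g u w) {R C₁ : ℝ}
    (hR : ∀ t, ‖u t‖ ≤ R) (hR0 : 0 ≤ R) (hC₁ : ∫ s, ‖w s‖ ^ α ∂leb T ≤ C₁) :
    Integrable (fun s => ‖A s (w s)‖ ^ (α / (α - 1))) (leb T) ∧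
      ∫ s, ‖A s (w s)‖ ^ (α / (α - 1)) ∂leb T
        ≤ dualBound β C C₁ R (fun s => F s + 4 * controlNorm ν L g s) := by
  obtain ⟨b, hE, -⟩ := hS.exists_evolutionData hg
  exact (hE.integrable_A_rpow h.meas h.memLp hR0
    (h.ae_eq.mono fun s hs => hs ▸ hR s) hC₁).2

theorem exists_norm_le_continuousMap (hT : 0 ≤ T) (u : C(Time T, H)) :
    ∃ R, 0 ≤ R ∧ ∀ t, ‖u t‖ ≤ R := by
  obtain ⟨R, hR⟩ := (isCompact_range u.continuous).isBounded.exists_norm_le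
  exact ⟨R, (norm_nonneg _).trans (hR _ ⟨⟨0, le_rfl, hT⟩, rfl⟩), fun t => hR _ ⟨t, rfl⟩⟩

/-- A priori bounds that depend on the control through its entropy only. -/
theorem SkeletonData.exists_apriori (hT : 0 < T) (hι : DenseRange ι)
    (hS : SkeletonData ι A f ν α β θ C K F L G) (N : ℝ) (x : H) :
    ∃ R C₁ : ℝ, 0 ≤ R ∧ 0 ≤ C₁ ∧ ∀ g u w, EntropyLe g (nuT T ν) N →
      SolutionPair ι A f ν α x g u w → (∀ t, ‖u t‖ ≤ R) ∧ ∫ s, ‖w s‖ ^ α ∂leb T ≤ C₁ := by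
  have hα := hS.one_lt
  set cF : ℝ := max 0 (∫ s, F s ∂leb T + 4 * controlBound ν L N) with hcF
  have hcF0 : 0 ≤ cF := le_max_left _ _
  set a : ℝ := ‖x‖ ^ 2 + cF with ha
  set Γ : ℝ := gronwallConst cF with hΓ
  have hΓ0 : 0 ≤ Γ := gronwallConst_nonneg hcF0
  refine ⟨Real.sqrt (Γ * a), (‖x‖ ^ 2 + cF * (1 + Γ * a)) / θ, Real.sqrt_nonneg _,
    div_nonneg (by positivity) hS.theta_pos.le, fun g u w hg h => ?_⟩
  obtain ⟨b, hE, hb⟩ := hS.exists_evolutionData hg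
  set F' : Time T → ℝ := fun s => F s + 4 * controlNorm ν L g s with hF'
  have hF'0 : ∀ s, 0 ≤ F' s := hE.F_nonneg
  have hF'i : Integrable F' (leb T) := hE.F_int
  have hF'c : ∫ s, F' s ∂leb T ≤ cF := by
    have h1 := hS.L_exp.integrable_controlNorm hg
    have h2 := hS.L_exp.integral_controlNorm_le hg
    rw [hF', integral_add hS.F_int (h1.const_mul 4), integral_const_mul]
    exact (by linarith : _ ≤ _).trans (le_max_right _ _)
  obtain ⟨R, hR0, hR⟩ := exists_norm_le_continuousMap hT.le u
  have hA := (h.integrable_A_rpow hS hg hR hR0 le_rfl).1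
  have hen := energy_identity hT hα hι h.memLp u.continuous h.ae_eq h.int_A.1 hA
    h.integrable_jumpDrift h.eqn
  have hwα := integrable_norm_rpow hα.le h.memLp
  have hui : Integrable (fun s => F' s * (1 + ‖u s‖ ^ 2)) (leb T) :=
    hF'i.mul_bdd (c := 1 + R ^ 2)
      (continuous_const.add ((u.continuous.norm).pow 2)).aestronglyMeasurable
      (Eventually.of_forall fun s => by
        rw [Real.norm_of_nonneg (by positivity)]
        have := hR s
        gcongr)
  have hui' : Integrable (fun s => F' s * ‖u s‖ ^ 2) (leb T) :=
    (hui.sub hF'i).congr (Eventually.of_forall fun s => by simp only [Pi.sub_apply]; ring)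
  have hi : Integrable (fun s => A s (w s) (w s) + inner ℝ (jumpDrift f ν g s (w s)) (u s))
      (leb T) := by
    refine (integrable_dual_apply hα h.memLp h.int_A.1 hA).add ?_
    refine (h.integrable_jumpDrift.norm.mul_const R).mono'
      (h.integrable_jumpDrift.1.inner u.continuous.aestronglyMeasurable)
      (Eventually.of_forall fun s => (norm_inner_le_norm _ _).trans ?_)
    exact mul_le_mul_of_nonneg_left (hR s) (norm_nonneg _)
  have hkey : ∀ t, ‖u t‖ ^ 2 + θ * ∫ s in Iic t, ‖w s‖ ^ α ∂leb T
      ≤ ‖x‖ ^ 2 + ∫ s in Iic t, F' s * (1 + ‖u s‖ ^ 2) ∂leb T := by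
    intro t
    have h1 : ∫ s in Iic t, (2 * (A s (w s) (w s) + inner ℝ (jumpDrift f ν g s (w s)) (u s))
        + θ * ‖w s‖ ^ α) ∂leb T ≤ ∫ s in Iic t, F' s * (1 + ‖u s‖ ^ 2) ∂leb T := by
      refine integral_mono_ae ((hi.const_mul 2).add (hwα.const_mul θ)).integrableOn
        hui.integrableOn (ae_restrict_of_ae ?_)
      filter_upwards [h.ae_eq, hb] with s hs hs'
      have h2 := hE.coer s (w s)
      rw [hs', hs] at h2
      linarith
    rw [integral_add (hi.const_mul 2).integrableOn (hwα.const_mul θ).integrableOn,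
      integral_const_mul, integral_const_mul] at h1
    rw [hen t]
    linarith
  have hw0 : ∀ t, 0 ≤ θ * ∫ s in Iic t, ‖w s‖ ^ α ∂leb T := fun t =>
    mul_nonneg hS.theta_pos.le (integral_nonneg fun s => by positivity)
  have hbd : ∀ t, ‖u t‖ ^ 2 ≤ Γ * a := by
    refine gronwall hT.le hF'i hF'0 hF'c (f := fun t => ‖u t‖ ^ 2) (g := fun t => ‖u t‖ ^ 2)
      (M := R ^ 2) (by positivity) (fun t => by have := hR t; gcongr) (fun s => ⟨s, le_rfl, le_rfl⟩)
      fun t => ?_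
    have h1 := hkey t
    have h2 : ∫ s in Iic t, F' s * (1 + ‖u s‖ ^ 2) ∂leb T
        = ∫ s in Iic t, F' s ∂leb T + ∫ s in Iic t, F' s * ‖u s‖ ^ 2 ∂leb T := by
      rw [← integral_add hF'i.integrableOn hui'.integrableOn]
      exact integral_congr_ae (Eventually.of_forall fun s => by ring)
    have h3 : ∫ s in Iic t, F' s ∂leb T ≤ cF :=
      (setIntegral_le_integral hF'i (Eventually.of_forall hF'0)).trans hF'c
    have h4 := hw0 t
    linarith
  refine ⟨fun t => Real.le_sqrt_of_sq_le (hbd t), ?_⟩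
  rw [le_div_iff₀ hS.theta_pos]
  have h1 := hkey ⟨T, hT.le, le_rfl⟩
  have htop : Iic (⟨T, hT.le, le_rfl⟩ : Time T) = univ := by
    exact eq_univ_of_forall fun s => s.2.2
  rw [htop, setIntegral_univ, setIntegral_univ] at h1
  have h2 : ∫ s, F' s * (1 + ‖u s‖ ^ 2) ∂leb T ≤ cF * (1 + Γ * a) := by
    calc ∫ s, F' s * (1 + ‖u s‖ ^ 2) ∂leb T ≤ ∫ s, F' s * (1 + Γ * a) ∂leb T :=
          integral_mono hui (hF'i.mul_const _) fun s =>
            mul_le_mul_of_nonneg_left (by linarith [hbd s]) (hF'0 s)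
      _ ≤ cF * (1 + Γ * a) := by
          rw [integral_mul_const]
          gcongr
  have h3 : 0 ≤ ‖u ⟨T, hT.le, le_rfl⟩‖ ^ 2 := by positivity
  linarith

/-- The weight in the energy estimate for the difference of two solutions. -/
def diffWeight (ι : V →L[ℝ] H) (ν : Measure X) (α β C : ℝ) (K : Time T → ℝ)
    (G : Time T × X → ℝ) (g : Time T × X → ℝ≥0) (w : Time T → V) (s : Time T) : ℝ :=
  K s + C * (1 + ‖w s‖ ^ α) * (1 + ‖ι (w s)‖ ^ β) + 2 * controlNorm ν G g s

theorem SkeletonData.diffWeight_nonneg (hS : SkeletonData ι A f ν α β θ C K F L G) (s : Time T) :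
    0 ≤ diffWeight ι ν α β C K G g w s := by
  have := hS.K_nonneg s
  have := hS.C_nonneg
  have := controlNorm_nonneg (ν := ν) (L := G) (g := g) s
  unfold diffWeight
  positivity

theorem SkeletonData.integrable_diffWeight (hS : SkeletonData ι A f ν α β θ C K F L G)
    (hg : EntropyLe g (nuT T ν) N) (hw : Measurable w) (hwα : MemLp w (ENNReal.ofReal α) (leb T))
    {R : ℝ} (hwR : ∀ᵐ s ∂leb T, ‖ι (w s)‖ ≤ R) :
    Integrable (diffWeight ι ν α β C K G g w) (leb T) := by
  obtain ⟨b, hE, -⟩ := hS.exists_evolutionData hg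
  refine (hE.integrable_monoWeight hw hwα hwR).congr (Eventually.of_forall fun s => ?_)
  simp only [monoWeight, diffWeight]
  ring

/-- The effect of a change of the control on the drift along a fixed path. -/
def driftDiff (f : Time T → V → X → H) (ν : Measure X) (g g' : Time T × X → ℝ≥0)
    (w : Time T → V) (s : Time T) : H := ∫ z, ((g (s, z) : ℝ) - g' (s, z)) • f s (w s) z ∂ν

theorem SkeletonData.integrable_driftDiff (hS : SkeletonData ι A f ν α β θ C K F L G)
    (hg : EntropyLe g (nuT T ν) N) (hg' : EntropyLe g' (nuT T ν) N) (hw : Measurable w) {R : ℝ}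
    (hwR : ∀ᵐ s ∂leb T, ‖ι (w s)‖ ≤ R) :
    Integrable (fun p : Time T × X => ((g p : ℝ) - g' p) • f p.1 (w p.1) p.2) (nuT T ν) ∧
      Integrable (driftDiff f ν g g' w) (leb T) := by
  have h : Integrable (fun p : Time T × X => ((g p : ℝ) - g' p) • f p.1 (w p.1) p.2) (nuT T ν) :=
    ((hS.integrable_prod hg hw hwR).sub (hS.integrable_prod hg' hw hwR)).congr
      (Eventually.of_forall fun p => by
        simp only [Pi.sub_apply]; rw [← sub_smul]; congr 1; ring)
  exact ⟨h, h.integral_prod_left⟩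

/-- The energy estimate for the difference of two solutions with different controls. The difference of
the drifts is split into a change of the path with the control `g`, which is Lipschitz, and a
change of the control along the second path `w'`. The weight too involves `‖w'‖_V` only. -/
theorem SolutionPair.norm_sub_sq_le (hT : 0 < T) (hι : DenseRange ι)
    (hS : SkeletonData ι A f ν α β θ C K F L G) (hg : EntropyLe g (nuT T ν) N)
    (hg' : EntropyLe g' (nuT T ν) N) (h : SolutionPair ι A f ν α x g u w)
    (h' : SolutionPair ι A f ν α x g' u' w') (t : Time T) :
    ‖u t - u' t‖ ^ 2 ≤ 2 * ∫ s in Iic t, inner ℝ (driftDiff f ν g g' w' s) (u s - u' s) ∂leb T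
      + ∫ s in Iic t, diffWeight ι ν α β C K G g w' s * ‖u s - u' s‖ ^ 2 ∂leb T := by
  have hα := hS.one_lt
  have hq : 1 ≤ α / (α - 1) := (Real.HolderConjugate.conjExponent hα).symm.lt.le
  obtain ⟨R, hR0, hR⟩ := exists_norm_le_continuousMap hT.le u
  obtain ⟨R', hR'0, hR'⟩ := exists_norm_le_continuousMap hT.le u'
  have hA := (h.integrable_A_rpow hS hg hR hR0 le_rfl).1
  have hA' := (h'.integrable_A_rpow hS hg' hR' hR'0 le_rfl).1
  have hwR' : ∀ᵐ s ∂leb T, ‖ι (w' s)‖ ≤ R' := h'.ae_eq.mono fun s hs => hs ▸ hR' s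
  have hD : ∀ s, ‖u s - u' s‖ ≤ R + R' := fun s =>
    (norm_sub_le _ _).trans (add_le_add (hR s) (hR' s))
  have hDc : Continuous fun s => u s - u' s := u.continuous.sub u'.continuous
  have hAd : Integrable (fun s => ‖A s (w s) - A s (w' s)‖ ^ (α / (α - 1))) (leb T) := by
    refine ((hA.add hA').const_mul (2 ^ (α / (α - 1) - 1))).mono'
      (((h.int_A.sub h'.int_A).1.norm.aemeasurable.pow_const _).aestronglyMeasurable)
      (Eventually.of_forall fun s => ?_)
    rw [Real.norm_of_nonneg (by positivity)]
    refine (Real.rpow_le_rpow (norm_nonneg _) (norm_sub_le _ _) (by linarith)).trans ?_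
    exact_mod_cast NNReal.rpow_add_le_mul_rpow_add_rpow ‖A s (w s)‖₊ ‖A s (w' s)‖₊ hq
  have hb := h.integrable_jumpDrift
  have hb' := h'.integrable_jumpDrift
  have hen := energy_identity hT hα hι (h.memLp.sub h'.memLp) (u := fun s => u s - u' s) hDc
    (by
      filter_upwards [h.ae_eq, h'.ae_eq] with s hs hs'
      simp only [Pi.sub_apply, map_sub, hs, hs'])
    (x := 0) (a := fun s => A s (w s) - A s (w' s))
    (b := fun s => jumpDrift f ν g s (w s) - jumpDrift f ν g' s (w' s))
    (h.int_A.sub h'.int_A).1 hAd (hb.sub hb') (fun t => by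
      rw [integral_sub h.int_A.integrableOn h'.int_A.integrableOn,
        integral_sub hb.integrableOn hb'.integrableOn, toVDual_sub, toVDual_sub, h.eqn t, h'.eqn t]
      have h0 : toVDual ι 0 = 0 := by ext v; simp [toVDual]
      rw [h0]
      abel) t
  rw [hen, norm_zero, zero_pow two_ne_zero, zero_add, ← integral_const_mul, ← integral_const_mul]
  have hr := (hS.integrable_driftDiff hg hg' h'.meas hwR').2
  have hri : Integrable (fun s => 2 * inner ℝ (driftDiff f ν g g' w' s) (u s - u' s)) (leb T) := by
    refine Integrable.const_mul ?_ 2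
    refine (hr.norm.mul_const (R + R')).mono' (hr.1.inner hDc.aestronglyMeasurable)
      (Eventually.of_forall fun s => (norm_inner_le_norm _ _).trans ?_)
    exact mul_le_mul_of_nonneg_left (hD s) (norm_nonneg _)
  have hκi : Integrable (fun s => diffWeight ι ν α β C K G g w' s * ‖u s - u' s‖ ^ 2) (leb T) := by
    refine (hS.integrable_diffWeight hg h'.meas h'.memLp hwR').mul_bdd (c := (R + R') ^ 2)
      (hDc.norm.pow 2).aestronglyMeasurable (Eventually.of_forall fun s => ?_)
    rw [Real.norm_of_nonneg (by positivity)]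
    have := hD s
    gcongr
  have hli : Integrable (fun s => 2 * ((A s (w s) - A s (w' s)) ((w - w') s)
      + inner ℝ (jumpDrift f ν g s (w s) - jumpDrift f ν g' s (w' s)) (u s - u' s))) (leb T) := by
    refine Integrable.const_mul ?_ 2
    refine (integrable_dual_apply hα (h.memLp.sub h'.memLp) (h.int_A.sub h'.int_A).1 hAd).add ?_
    refine ((hb.sub hb').norm.mul_const (R + R')).mono'
      ((hb.sub hb').1.inner hDc.aestronglyMeasurable)
      (Eventually.of_forall fun s => (norm_inner_le_norm _ _).trans ?_)
    exact mul_le_mul_of_nonneg_left (hD s) (norm_nonneg _)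
  rw [← integral_add hri.integrableOn hκi.integrableOn]
  refine integral_mono_ae hli.integrableOn (hri.add hκi).integrableOn (ae_restrict_of_ae ?_)
  filter_upwards [h.ae_eq, h'.ae_eq, hS.L_exp.ae_integrable hg, hS.L_exp.ae_integrable hg',
    hS.G_exp.ae_integrable hg] with s hs hs' hL hL' hG
  have hsub : ι (w s - w' s) = u s - u' s := by rw [map_sub, hs, hs']
  have h1 := hS.mono s (w s) (w' s)
  have h2 := hS.norm_jumpDrift_sub_le hg.meas hL hG (w s) (w' s)
  rw [hsub] at h1 h2
  have h3 : jumpDrift f ν g s (w s) - jumpDrift f ν g' s (w' s)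
      = (jumpDrift f ν g s (w s) - jumpDrift f ν g s (w' s)) + driftDiff f ν g g' w' s := by
    have h4 : driftDiff f ν g g' w' s
        = jumpDrift f ν g s (w' s) - jumpDrift f ν g' s (w' s) := by
      rw [jumpDrift, jumpDrift, ← integral_sub (hS.integrable_section hg.meas hL (w' s)).1
        (hS.integrable_section hg'.meas hL' (w' s)).1, driftDiff]
      refine integral_congr_ae (Eventually.of_forall fun z => ?_)
      simp only
      rw [← sub_smul]; congr 1; ring
    rw [h4]; abel
  have h5 : inner ℝ (jumpDrift f ν g s (w s) - jumpDrift f ν g s (w' s)) (u s - u' s)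
      ≤ controlNorm ν G g s * ‖u s - u' s‖ * ‖u s - u' s‖ :=
    (real_inner_le_norm _ _).trans (mul_le_mul_of_nonneg_right h2 (norm_nonneg _))
  simp only [Pi.sub_apply]
  rw [h3, inner_add_left, diffWeight]
  linarith

theorem SolutionPair.unique (hT : 0 < T) (hι : DenseRange ι)
    (hS : SkeletonData ι A f ν α β θ C K F L G) (hg : EntropyLe g (nuT T ν) N)
    (h : SolutionPair ι A f ν α x g u w) (h' : SolutionPair ι A f ν α x g u' w') : u = u' := by
  obtain ⟨R, hR0, hR⟩ := exists_norm_le_continuousMap hT.le u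
  obtain ⟨R', hR'0, hR'⟩ := exists_norm_le_continuousMap hT.le u'
  have hwR' : ∀ᵐ s ∂leb T, ‖ι (w' s)‖ ≤ R' := h'.ae_eq.mono fun s hs => hs ▸ hR' s
  have hκ := hS.integrable_diffWeight hg h'.meas h'.memLp hwR'
  have hr : ∀ s, driftDiff f ν g g w' s = 0 := fun s => by simp [driftDiff]
  ext t
  have h1 := gronwall hT.le hκ (fun s => hS.diffWeight_nonneg s) le_rfl
    (f := fun t => ‖u t - u' t‖ ^ 2) (g := fun t => ‖u t - u' t‖ ^ 2) (M := (R + R') ^ 2) le_rfl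
    (fun t => by
      have := (norm_sub_le (u t) (u' t)).trans (add_le_add (hR t) (hR' t))
      gcongr) (fun s => ⟨s, le_rfl, le_rfl⟩) (fun t => by
      simpa [hr] using h.norm_sub_sq_le hT hι hS hg hg h' t) t
  rw [mul_zero] at h1
  have h2 : ‖u t - u' t‖ = 0 := pow_eq_zero_iff two_ne_zero |>.1 (le_antisymm h1 (by positivity))
  exact sub_eq_zero.1 (norm_eq_zero.1 h2)

end

/-! ### Stability under convergence of the controls -/

section

variable {T : ℝ}

/-- Integration by parts in the form of an estimate. -/
theorem abs_setIntegral_mul_le {ρ y : Time T → ℝ} (hρ : Integrable ρ (leb T))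
    (hy : Integrable y (leb T)) {B : ℝ} (hB : ∀ t, |∫ s in Iic t, ρ s ∂leb T| ≤ B) (t : Time T) :
    |∫ s in Iic t, ρ s * ∫ r in Iic s, y r ∂leb T ∂leb T| ≤ 2 * B * ∫ r, |y r| ∂leb T := by
  have hB0 : 0 ≤ B := (abs_nonneg _).trans (hB t)
  have hm : MeasurableSet {p : Time T × Time T | p.2 ≤ p.1} :=
    measurableSet_le measurable_snd measurable_fst
  have hi : Integrable (fun p : Time T × Time T =>
      {p : Time T × Time T | p.2 ≤ p.1}.indicator (fun p => ρ p.1 * y p.2) p)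
      (((leb T).restrict (Iic t)).prod (leb T)) :=
    (hρ.restrict.mul_prod hy).indicator hm
  have h1 : ∫ s in Iic t, ρ s * ∫ r in Iic s, y r ∂leb T ∂leb T
      = ∫ s in Iic t, ∫ r, {p : Time T × Time T | p.2 ≤ p.1}.indicator
        (fun p => ρ p.1 * y p.2) (s, r) ∂leb T ∂leb T := by
    refine integral_congr_ae (Eventually.of_forall fun s => ?_)
    simp only
    rw [← integral_const_mul, ← integral_indicator measurableSet_Iic]
    refine integral_congr_ae (Eventually.of_forall fun r => ?_)
    simp only [indicator, mem_Iic, mem_ofPred_eq]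
  have h2 : ∀ r, ∫ s in Iic t, {p : Time T × Time T | p.2 ≤ p.1}.indicator
      (fun p => ρ p.1 * y p.2) (s, r) ∂leb T = (∫ s in Icc r t, ρ s ∂leb T) * y r := by
    intro r
    rw [← integral_mul_const, ← integral_indicator measurableSet_Iic,
      ← integral_indicator measurableSet_Icc]
    refine integral_congr_ae (Eventually.of_forall fun s => ?_)
    by_cases h3 : s ≤ t <;> by_cases h4 : r ≤ s <;>
      simp [indicator, h3, h4]
  have h3 : ∀ r, |∫ s in Icc r t, ρ s ∂leb T| ≤ 2 * B := by
    intro r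
    rcases le_or_gt r t with h | h
    · rw [integral_Icc_eq_integral_Ioc, setIntegral_Iic_sub hρ h]
      exact (abs_sub _ _).trans (by linarith [hB t, hB r])
    · rw [Icc_eq_empty (not_le.2 h), setIntegral_empty, abs_zero]
      positivity
  rw [h1, integral_integral_swap hi, ← integral_const_mul]
  simp only [h2]
  refine (abs_integral_le_integral_abs).trans (integral_mono_of_nonneg
    (Eventually.of_forall fun r => abs_nonneg _) (hy.abs.const_mul _)
    (Eventually.of_forall fun r => ?_))
  simp only [abs_mul]
  exact mul_le_mul_of_nonneg_right (h3 r) (abs_nonneg _)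

end

section

variable {T : ℝ} {X : Type*} [MeasurableSpace X] {ν : Measure X} [SigmaFinite ν]

/-- Convergence of controls: convergence of the densities against exponentially integrable
functions. -/
def ControlTendsto (ν : Measure X) (gs : ℕ → Time T × X → ℝ≥0) (g : Time T × X → ℝ≥0) : Prop :=
  ∀ φ : Time T × X → ℝ, ExpIntegrable φ (nuT T ν) →
    Tendsto (fun n => ∫ q, φ q * ((gs n q : ℝ) - g q) ∂nuT T ν) atTop (𝓝 0)

variable {gs : ℕ → Time T × X → ℝ≥0} {g : Time T × X → ℝ≥0} {N : ℝ}

theorem EntropyLe.integrable_mul_sub {g' : Time T × X → ℝ≥0} (hg : EntropyLe g (nuT T ν) N)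
    (hg' : EntropyLe g' (nuT T ν) N) {φ : Time T × X → ℝ} (hφ : ExpIntegrable φ (nuT T ν)) :
    Integrable (fun q => φ q * ((g q : ℝ) - g' q)) (nuT T ν) :=
  ((hg.integrable_mul hφ).1.sub (hg'.integrable_mul hφ).1).congr
    (Eventually.of_forall fun q => by simp only [Pi.sub_apply]; ring)

/-- Convergence of the controls against exponentially integrable functions is uniform over the
time intervals `[0, t]`. -/
theorem ControlTendsto.eventually_le (hgs : ∀ n, EntropyLe (gs n) (nuT T ν) N)
    (hg : EntropyLe g (nuT T ν) N) (hN : 0 ≤ N) (hc : ControlTendsto ν gs g)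
    {φ : Time T × X → ℝ} (hφ : ExpIntegrable φ (nuT T ν)) {e : ℝ} (he : 0 < e) :
    ∀ᶠ n in atTop, ∀ t : Time T,
      |∫ s in Iic t, ∫ z, φ (s, z) * ((gs n (s, z) : ℝ) - g (s, z)) ∂ν ∂leb T| ≤ e := by
  set P : ℕ → Time T → ℝ := fun n t =>
    ∫ s in Iic t, ∫ z, φ (s, z) * ((gs n (s, z) : ℝ) - g (s, z)) ∂ν ∂leb T with hP
  have hint := fun n => (hgs n).integrable_mul_sub hg hφ
  have hint1 : ∀ n, Integrable (fun s => ∫ z, φ (s, z) * ((gs n (s, z) : ℝ) - g (s, z)) ∂ν)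
      (leb T) := fun n => (hint n).integral_prod_left
  have hpt : ∀ t, Tendsto (fun n => P n t) atTop (𝓝 0) := by
    intro t
    have hm : MeasurableSet (Iic t ×ˢ (univ : Set X)) := measurableSet_Iic.prod MeasurableSet.univ
    have h1 := hc ((Iic t ×ˢ (univ : Set X)).indicator φ) (hφ.mono (hφ.aesm.indicator hm)
      (Eventually.of_forall fun q => by
        by_cases h : q ∈ Iic t ×ˢ (univ : Set X)
        · rw [indicator_of_mem h]
        · rw [indicator_of_notMem h, abs_zero]; exact abs_nonneg _))
    refine h1.congr fun n => ?_
    have h2 := setIntegral_prod (μ := leb T) (ν := ν) (s := Iic t) (t := univ)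
      (fun q => φ q * ((gs n q : ℝ) - g q)) (hint n).integrableOn
    simp only [Measure.restrict_univ] at h2
    rw [hP]
    simp only
    rw [← h2, ← integral_indicator hm]
    refine integral_congr_ae (Eventually.of_forall fun q => ?_)
    simp only [indicator_apply]
    split_ifs <;> simp
  -- uniform smallness over short time intervals, by the bound on the entropy
  set σ : ℝ := 8 * (N + 1) / e with hσ
  have hσ0 : 0 < σ := by positivity
  have hgi : Integrable (fun s => ∫ z, expGauge (σ * φ (s, z)) ∂ν) (leb T) :=
    (hφ.int σ hσ0).integral_prod_left
  obtain ⟨δ, hδ, hδ'⟩ := exists_norm_setIntegral_Ioc_le hgi (ε := σ * (e / 8)) (by positivity)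
  have hNσ : N / σ ≤ e / 8 := by
    rw [div_le_iff₀ hσ0, hσ]
    field_simp
    linarith
  have hcn : ∀ g : Time T × X → ℝ≥0, EntropyLe g (nuT T ν) N → ∀ s t : Time T, s ≤ t →
      (t : ℝ) - s < δ → ∫ r in Ioc s t, controlNorm ν φ g r ∂leb T ≤ e / 4 := by
    intro g hg s t hst hd
    have h1 := hφ.setIntegral_controlNorm_le hg (Ioc s t) hσ0
    have h2 := (le_abs_self _).trans (hδ' s t hst hd)
    have h3 : (∫ s in Ioc s t, ∫ z, expGauge (σ * φ (s, z)) ∂ν ∂leb T) / σ ≤ e / 8 := by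
      rw [div_le_iff₀ hσ0]; linarith
    linarith
  have hwin : ∀ n, ∀ s t : Time T, s ≤ t → (t : ℝ) - s < δ → |P n t - P n s| ≤ e / 2 := by
    intro n s t hst hd
    have i1 := hφ.integrable_controlNorm (hgs n)
    have i2 := hφ.integrable_controlNorm hg
    have h1 : P n t - P n s = ∫ r in Ioc s t,
        ∫ z, φ (r, z) * ((gs n (r, z) : ℝ) - g (r, z)) ∂ν ∂leb T :=
      (setIntegral_Iic_sub (hint1 n) hst).symm
    rw [h1]
    have h2 : |∫ r in Ioc s t, ∫ z, φ (r, z) * ((gs n (r, z) : ℝ) - g (r, z)) ∂ν ∂leb T|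
        ≤ ∫ r in Ioc s t, (controlNorm ν φ (gs n) r + controlNorm ν φ g r) ∂leb T := by
      rw [← Real.norm_eq_abs]
      refine norm_integral_le_of_norm_le (i1.add i2).integrableOn (ae_restrict_of_ae ?_)
      filter_upwards [hφ.ae_integrable (hgs n), hφ.ae_integrable hg] with r hr hr'
      rw [controlNorm, controlNorm, ← integral_add hr hr']
      refine norm_integral_le_of_norm_le (hr.add hr') (Eventually.of_forall fun z => ?_)
      rw [norm_mul, Real.norm_eq_abs, Real.norm_eq_abs, ← mul_add]
      refine mul_le_mul_of_nonneg_left ?_ (abs_nonneg _)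
      have h3 := abs_sub (((gs n (r, z) : ℝ)) - 1) ((g (r, z) : ℝ) - 1)
      rwa [sub_sub_sub_cancel_right] at h3
    rw [integral_add i1.integrableOn i2.integrableOn] at h2
    have h3 := hcn (gs n) (hgs n) s t hst hd
    have h4 := hcn g hg s t hst hd
    linarith
  obtain ⟨I, -, hI, hcov⟩ := finite_cover_balls_of_compact (isCompact_univ (X := Time T)) hδ
  have hev : ∀ᶠ n in atTop, ∀ r ∈ I, |P n r| ≤ e / 2 := by
    rw [hI.eventually_all]
    intro r _
    filter_upwards [Metric.tendsto_nhds.1 (hpt r) (e / 2) (by positivity)] with n hn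
    rw [Real.dist_eq, sub_zero] at hn
    exact hn.le
  filter_upwards [hev] with n hn t
  obtain ⟨r, hr, htr⟩ := mem_iUnion₂.1 (hcov (mem_univ t))
  rw [Metric.mem_ball, Subtype.dist_eq, Real.dist_eq] at htr
  have h1 : |P n t - P n r| ≤ e / 2 := by
    rcases le_total r t with h | h
    · exact hwin n r t h ((le_abs_self _).trans_lt htr)
    · rw [abs_sub_comm]
      rw [abs_sub_comm] at htr
      exact hwin n t r h ((le_abs_self _).trans_lt htr)
  have h2 := abs_add_le (P n t - P n r) (P n r)
  rw [sub_add_cancel] at h2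
  have := hn r hr
  change |P n t| ≤ e
  linarith

end

section

variable {T : ℝ} {V : Type*} [NormedAddCommGroup V] [NormedSpace ℝ V] [MeasurableSpace V]
  {H : Type*} [NormedAddCommGroup H] [InnerProductSpace ℝ H] [MeasurableSpace H]
  {X : Type*} [MeasurableSpace X]
  {ι : V →L[ℝ] H} {A : Time T → V → StrongDual ℝ V} {f : Time T → V → X → H}
  {ν : Measure X} [SigmaFinite ν] {α β θ C : ℝ} {K F : Time T → ℝ} {L G : Time T × X → ℝ}
  {gs : ℕ → Time T × X → ℝ≥0} {g : Time T × X → ℝ≥0} {N : ℝ} {x : H}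
  {us : ℕ → C(Time T, H)} {u : C(Time T, H)} {ws : ℕ → Time T → V} {w : Time T → V}
  [BorelSpace H] [SecondCountableTopology H] [BorelSpace V] [CompleteSpace H]
  [SecondCountableTopology (StrongDual ℝ V)]

/-- Tested with a vector of `V`, solutions are absolutely continuous in time, with a bound for the
variation that depends on the control through its entropy only. -/
theorem SkeletonData.exists_deriv_bound (hT : 0 < T) (hι : DenseRange ι)
    (hS : SkeletonData ι A f ν α β θ C K F L G) (N : ℝ) (x : H) (v : V) :
    ∃ M : ℝ, 0 ≤ M ∧ ∀ g u w, EntropyLe g (nuT T ν) N → SolutionPair ι A f ν α x g u w →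
      ∃ y : Time T → ℝ, Integrable y (leb T) ∧ ∫ s, |y s| ∂leb T ≤ M ∧
        ∀ t, inner ℝ (u t) (ι v) = inner ℝ x (ι v) + ∫ s in Iic t, y s ∂leb T := by
  have hq : 1 ≤ α / (α - 1) := (Real.HolderConjugate.conjExponent hS.one_lt).symm.lt.le
  obtain ⟨R, C₁, hR0, hC₁, h⟩ := hS.exists_apriori hT hι N x
  set D : ℝ := (∫ s, F s ∂leb T + 4 * controlBound ν L N + C * C₁) * (1 + R ^ β) with hD
  refine ⟨max 0 (((leb T).real univ + D) * ‖v‖ + controlBound ν L N * ((1 + R) * ‖ι v‖)),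
    le_max_left _ _, fun g u w hg hu => ?_⟩
  obtain ⟨hR, hC⟩ := h g u w hg hu
  obtain ⟨hA, hAle⟩ := hu.integrable_A_rpow hS hg hR hR0 hC
  have hc := hS.L_exp.integrable_controlNorm hg
  have hcle := hS.L_exp.integral_controlNorm_le hg
  have hAD : ∫ s, ‖A s (w s)‖ ^ (α / (α - 1)) ∂leb T ≤ D := by
    refine hAle.trans ?_
    rw [dualBound, integral_add hS.F_int (hc.const_mul 4), integral_const_mul, hD]
    gcongr
  have hj := hu.integrable_jumpDrift
  have hjv : Integrable (fun s => inner ℝ (jumpDrift f ν g s (w s)) (ι v)) (leb T) :=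
    hj.inner_const (ι v)
  have hAv : Integrable (fun s => A s (w s) v) (leb T) := hu.int_A.apply_continuousLinearMap v
  have hyi : Integrable (fun s => A s (w s) v + inner ℝ (jumpDrift f ν g s (w s)) (ι v)) (leb T) :=
    hAv.add hjv
  refine ⟨_, hyi, le_max_of_le_right ?_, fun t => ?_⟩
  · have hA1 : Integrable (fun s => (1 + ‖A s (w s)‖ ^ (α / (α - 1))) * ‖v‖) (leb T) :=
      ((integrable_const _).add hA).mul_const _
    have hdom : Integrable (fun s => (1 + ‖A s (w s)‖ ^ (α / (α - 1))) * ‖v‖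
        + controlNorm ν L g s * ((1 + R) * ‖ι v‖)) (leb T) :=
      hA1.add (hc.mul_const _)
    calc ∫ s, |A s (w s) v + inner ℝ (jumpDrift f ν g s (w s)) (ι v)| ∂leb T
        ≤ ∫ s, ((1 + ‖A s (w s)‖ ^ (α / (α - 1))) * ‖v‖
          + controlNorm ν L g s * ((1 + R) * ‖ι v‖)) ∂leb T := by
          refine integral_mono_ae hyi.abs hdom ?_
          filter_upwards [hu.ae_eq, hS.L_exp.ae_integrable hg] with s hs hs'
          refine (abs_add_le _ _).trans (add_le_add ?_ ?_)
          · refine ((A s (w s)).le_opNorm v).trans ?_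
            exact mul_le_mul_of_nonneg_right (le_one_add_rpow (norm_nonneg _) hq) (norm_nonneg _)
          · refine (abs_real_inner_le_norm _ _).trans ?_
            rw [← mul_assoc]
            refine mul_le_mul_of_nonneg_right ?_ (norm_nonneg _)
            refine (hS.integrable_section hg.meas hs' (w s)).2.trans ?_
            have h1 := hR s
            rw [hs]
            exact mul_le_mul_of_nonneg_left (by linarith) (controlNorm_nonneg s)
      _ ≤ ((leb T).real univ + D) * ‖v‖ + controlBound ν L N * ((1 + R) * ‖ι v‖) := by
          rw [integral_add hA1 (hc.mul_const _),
            integral_mul_const, integral_mul_const, integral_add (integrable_const _) hA,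
            integral_const, smul_eq_mul, mul_one]
          gcongr
  · have h1 := congrArg (fun ξ => ξ v) (hu.eqn t)
    simp only [add_apply, toVDual_apply] at h1
    rw [h1, integral_add hAv.integrableOn hjv.integrableOn,
      ContinuousLinearMap.integral_apply hu.int_A.integrableOn]
    have h2 : (inner ℝ (∫ s in Iic t, jumpDrift f ν g s (w s) ∂leb T) (ι v) : ℝ)
        = ∫ s in Iic t, inner ℝ (jumpDrift f ν g s (w s)) (ι v) ∂leb T := by
      rw [real_inner_comm, ← integral_inner hj.integrableOn]
      exact integral_congr_ae (Eventually.of_forall fun s => real_inner_comm _ _)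
    rw [h2]
    ring

/-- Along the limiting solution, the perturbation of the drift is asymptotically orthogonal to the
difference of the solutions: finite-dimensional projections of the perturbation converge weakly in
time, uniformly over time intervals, and the projections of the difference have bounded
variation. -/
theorem SkeletonData.eventually_inner_driftDiff_le (hT : 0 < T) (hι : DenseRange ι)
    (hS : SkeletonData ι A f ν α β θ C K F L G) {d : ℕ → V} {Q : ℕ → H →L[ℝ] V}
    (hQ : FiniteRankApprox ι d Q) (hN : 0 ≤ N)
    (hgs : ∀ n, EntropyLe (gs n) (nuT T ν) N) (hg : EntropyLe g (nuT T ν) N)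
    (hc : ControlTendsto ν gs g) (hus : ∀ n, SolutionPair ι A f ν α x (gs n) (us n) (ws n))
    (hu : SolutionPair ι A f ν α x g u w) {e : ℝ} (he : 0 < e) :
    ∀ᶠ n in atTop, ∀ t : Time T,
      |∫ s in Iic t, inner ℝ (driftDiff f ν (gs n) g w s) (us n s - u s) ∂leb T| ≤ e := by
  obtain ⟨R, C₁, hR0, hC₁, hap⟩ := hS.exists_apriori hT hι N x
  have hRn : ∀ n t, ‖us n t‖ ≤ R := fun n => (hap _ _ _ (hgs n) (hus n)).1
  have hR : ∀ t, ‖u t‖ ≤ R := (hap _ _ _ hg hu).1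
  have hD : ∀ n s, ‖us n s - u s‖ ≤ R + R := fun n s =>
    (norm_sub_le _ _).trans (add_le_add (hRn n s) (hR s))
  have hDc : ∀ n, Continuous fun s => us n s - u s := fun n =>
    (us n).continuous.sub u.continuous
  have hwR : ∀ᵐ s ∂leb T, ‖ι (w s)‖ ≤ R := hu.ae_eq.mono fun s hs => hs ▸ hR s
  -- the coefficient along the limiting solution; its distance `ψ m` to its projections tends to zero,
  -- uniformly over the controls in the sense of `ExpIntegrable.eventually_le`
  set h : Time T × X → H := fun p => f p.1 (w p.1) p.2 with hh
  have hhm : Measurable h :=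
    hS.measurable_f.comp (measurable_fst.prodMk ((hu.meas.comp measurable_fst).prodMk
      measurable_snd))
  have hwRp : ∀ᵐ p ∂nuT T ν, ‖ι (w p.1)‖ ≤ R := Measure.quasiMeasurePreserving_fst.ae hwR
  have hhle : ∀ᵐ p ∂nuT T ν, ‖h p‖ ≤ |L p| * (1 + R) := by
    filter_upwards [hwRp] with p hp
    exact (hS.f_le p.1 _ p.2).trans (by gcongr)
  set ψ : ℕ → Time T × X → ℝ := fun m p => ‖h p - ι (Q m (h p))‖ with hψ
  have hψm : ∀ m, AEStronglyMeasurable (ψ m) (nuT T ν) := fun m =>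
    (hhm.sub ((ι.continuous.comp (Q m).continuous).measurable.comp hhm)).norm.aestronglyMeasurable
  have hLE : ExpIntegrable (fun p => (2 * (1 + R)) * L p) (nuT T ν) := hS.L_exp.const_mul _
  have hψle : ∀ m, ∀ᵐ p ∂nuT T ν, |ψ m p| ≤ |(2 * (1 + R)) * L p| := fun m => by
    filter_upwards [hhle] with p hp
    rw [abs_mul, abs_of_nonneg (by positivity : 0 ≤ 2 * (1 + R)), abs_of_nonneg (norm_nonneg _)]
    have h1 := (norm_sub_le (h p) (ι (Q m (h p)))).trans (add_le_add_right (hQ.norm_le m (h p)) _)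
    linarith
  have hψE : ∀ m, ExpIntegrable (ψ m) (nuT T ν) := fun m => hLE.mono (hψm m) (hψle m)
  have hψlim : ∀ᵐ p ∂nuT T ν, Tendsto (fun m => ψ m p) atTop (𝓝 0) :=
    Eventually.of_forall fun p => by
      simpa using ((hQ.tendsto hι (h p)).const_sub (h p)).norm
  obtain ⟨m, hm⟩ := (hLE.eventually_le hψm hψle hψlim hN
    (e := e / (8 * (R + R + 1))) (by positivity)).exists
  obtain ⟨k, a, v, hav⟩ := hQ.finite_rank m
  -- the coordinates of the projected perturbation, to which the convergence of the controls applies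
  set φ : Fin k → Time T × X → ℝ := fun i p => inner ℝ (a i) (h p) with hφ
  have hφE : ∀ i, ExpIntegrable (φ i) (nuT T ν) := fun i => by
    refine (hS.L_exp.const_mul (‖a i‖ * (1 + R))).mono
      (measurable_const.inner hhm).aestronglyMeasurable ?_
    filter_upwards [hhle] with p hp
    rw [abs_mul, abs_of_nonneg (by positivity : 0 ≤ ‖a i‖ * (1 + R))]
    refine (abs_real_inner_le_norm _ _).trans ?_
    calc ‖a i‖ * ‖h p‖ ≤ ‖a i‖ * (|L p| * (1 + R)) := by gcongr
      _ = _ := by ring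
  choose M hM0 hM using fun i => hS.exists_deriv_bound hT hι N x (v i)
  have hfin : ∀ᶠ n in atTop, ∀ i, ∀ t : Time T,
      |∫ s in Iic t, ∫ z, φ i (s, z) * ((gs n (s, z) : ℝ) - g (s, z)) ∂ν ∂leb T|
        ≤ e / (8 * (k + 1) * (M i + 1)) := by
    rw [eventually_all]
    exact fun i => hc.eventually_le hgs hg hN (hφE i) (by have := hM0 i; positivity)
  filter_upwards [hfin] with n hn t
  obtain ⟨hpi, hri⟩ := hS.integrable_driftDiff (hgs n) hg hu.meas hwR
  set r : Time T → H := driftDiff f ν (gs n) g w with hr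
  have hsec : ∀ᵐ s ∂leb T, Integrable (fun z => ((gs n (s, z) : ℝ) - g (s, z)) • h (s, z)) ν :=
    hpi.prod_right_ae
  have hQr : ∀ᵐ s ∂leb T, ι (Q m (r s))
      = ∑ i, (∫ z, φ i (s, z) * ((gs n (s, z) : ℝ) - g (s, z)) ∂ν) • ι (v i) := by
    filter_upwards [hsec] with s hs
    rw [hav, map_sum]
    refine Finset.sum_congr rfl fun i _ => ?_
    rw [map_smul]
    congr 1
    change inner ℝ (a i) (∫ z, ((gs n (s, z) : ℝ) - g (s, z)) • h (s, z) ∂ν) = _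
    rw [← integral_inner hs]
    refine integral_congr_ae (Eventually.of_forall fun z => ?_)
    simp only [hφ, inner_smul_right]
    ring
  have hρi : ∀ i, Integrable (fun s => ∫ z, φ i (s, z) * ((gs n (s, z) : ℝ) - g (s, z)) ∂ν)
      (leb T) := fun i => ((hgs n).integrable_mul_sub hg (hφE i)).integral_prod_left
  have hsmall : ∀ᵐ s ∂leb T, ‖r s - ι (Q m (r s))‖
      ≤ controlNorm ν (ψ m) (gs n) s + controlNorm ν (ψ m) g s := by
    filter_upwards [hsec, (hψE m).ae_integrable (hgs n), (hψE m).ae_integrable hg]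
      with s hs hs1 hs2
    have h1 : r s - ι (Q m (r s))
        = ∫ z, ((gs n (s, z) : ℝ) - g (s, z)) • (h (s, z) - ι (Q m (h (s, z)))) ∂ν := by
      have h2 := (ι.comp (Q m)).integral_comp_comm hs
      have h3 : r s = ∫ z, ((gs n (s, z) : ℝ) - g (s, z)) • h (s, z) ∂ν := rfl
      rw [h3]
      change _ - (ι.comp (Q m)) _ = _
      rw [← h2, ← integral_sub hs ((ι.comp (Q m)).integrable_comp hs)]
      refine integral_congr_ae (Eventually.of_forall fun z => ?_)
      simp only [map_smul, ContinuousLinearMap.comp_apply, smul_sub]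
    rw [h1, controlNorm, controlNorm, ← integral_add hs1 hs2]
    refine norm_integral_le_of_norm_le (hs1.add hs2) (Eventually.of_forall fun z => ?_)
    rw [norm_smul, Real.norm_eq_abs, ← mul_add, mul_comm]
    have h4 : ‖h (s, z) - ι (Q m (h (s, z)))‖ = |ψ m (s, z)| := (abs_of_nonneg (norm_nonneg _)).symm
    rw [h4]
    refine mul_le_mul_of_nonneg_left ?_ (abs_nonneg _)
    have h3 := abs_sub (((gs n (s, z) : ℝ)) - 1) ((g (s, z) : ℝ) - 1)
    rwa [sub_sub_sub_cancel_right] at h3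
  have hcn : ∀ g', EntropyLe g' (nuT T ν) N →
      ∫ s, controlNorm ν (ψ m) g' s ∂leb T ≤ e / (8 * (R + R + 1)) := by
    intro g' hg'
    have h1 := integral_prod (μ := leb T) (ν := ν) _ (hg'.integrable_abs (hψE m))
    exact h1.symm.le.trans (hm g' hg')
  -- the complement of the projection is small in `L¹([0,T],H)`, and the projection is integrated by
  -- parts against the coordinates of the difference of the solutions
  have hQrm : AEStronglyMeasurable (fun s => ι (Q m (r s))) (leb T) :=
    (ι.continuous.comp (Q m).continuous).comp_aestronglyMeasurable hri.1
  have i1 : Integrable (fun s => inner ℝ (r s - ι (Q m (r s))) (us n s - u s)) (leb T) := by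
    refine ((hri.sub ((ι.comp (Q m)).integrable_comp hri)).norm.mul_const (R + R)).mono'
      ((hri.1.sub hQrm).inner (hDc n).aestronglyMeasurable)
      (Eventually.of_forall fun s => (norm_inner_le_norm _ _).trans ?_)
    exact mul_le_mul_of_nonneg_left (hD n s) (norm_nonneg _)
  have i2 : ∀ i, Integrable (fun s => (∫ z, φ i (s, z) * ((gs n (s, z) : ℝ) - g (s, z)) ∂ν)
      * inner ℝ (ι (v i)) (us n s - u s)) (leb T) := fun i =>
    (hρi i).mul_bdd (c := ‖ι (v i)‖ * (R + R))
      (continuous_const.inner (hDc n)).aestronglyMeasurable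
      (Eventually.of_forall fun s => (norm_inner_le_norm _ _).trans
        (mul_le_mul_of_nonneg_left (hD n s) (norm_nonneg _)))
  have hsplit : ∫ s in Iic t, inner ℝ (r s) (us n s - u s) ∂leb T
      = ∫ s in Iic t, inner ℝ (r s - ι (Q m (r s))) (us n s - u s) ∂leb T
        + ∑ i, ∫ s in Iic t, (∫ z, φ i (s, z) * ((gs n (s, z) : ℝ) - g (s, z)) ∂ν)
          * inner ℝ (ι (v i)) (us n s - u s) ∂leb T := by
    rw [← integral_finsetSum _ fun i _ => (i2 i).integrableOn,
      ← integral_add i1.integrableOn (integrable_finsetSum _ fun i _ => (i2 i).integrableOn)]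
    refine setIntegral_congr_ae measurableSet_Iic ?_
    filter_upwards [hQr] with s hs _
    rw [inner_sub_left, hs, sum_inner]
    simp only [inner_smul_left, RCLike.conj_to_real]
    ring
  have b1 : |∫ s in Iic t, inner ℝ (r s - ι (Q m (r s))) (us n s - u s) ∂leb T| ≤ e / 2 := by
    have j1 := (hψE m).integrable_controlNorm (hgs n)
    have j2 := (hψE m).integrable_controlNorm hg
    calc |∫ s in Iic t, inner ℝ (r s - ι (Q m (r s))) (us n s - u s) ∂leb T|
        ≤ ∫ s in Iic t, (controlNorm ν (ψ m) (gs n) s + controlNorm ν (ψ m) g s) * (R + R)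
            ∂leb T := by
          rw [← Real.norm_eq_abs]
          refine norm_integral_le_of_norm_le ((j1.add j2).mul_const _).integrableOn
            (ae_restrict_of_ae ?_)
          filter_upwards [hsmall] with s hs
          refine (norm_inner_le_norm _ _).trans ?_
          have h0 := add_nonneg (controlNorm_nonneg (ν := ν) (L := ψ m) (g := gs n) s)
            (controlNorm_nonneg (ν := ν) (L := ψ m) (g := g) s)
          exact mul_le_mul hs (hD n s) (norm_nonneg _) h0
      _ ≤ ∫ s, (controlNorm ν (ψ m) (gs n) s + controlNorm ν (ψ m) g s) * (R + R) ∂leb T :=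
          setIntegral_le_integral ((j1.add j2).mul_const _) (Eventually.of_forall fun s =>
            mul_nonneg (add_nonneg (controlNorm_nonneg s) (controlNorm_nonneg s)) (by positivity))
      _ ≤ (e / (8 * (R + R + 1)) + e / (8 * (R + R + 1))) * (R + R) := by
          rw [integral_mul_const, integral_add j1 j2]
          gcongr
          · exact hcn _ (hgs n)
          · exact hcn _ hg
      _ = e / 4 * ((R + R) / (R + R + 1)) := by field_simp; ring
      _ ≤ e / 4 := mul_le_of_le_one_right (by positivity)
          (div_le_one_of_le₀ (by linarith) (by linarith))
      _ ≤ e / 2 := by linarith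
  have b2 : ∀ i, |∫ s in Iic t, (∫ z, φ i (s, z) * ((gs n (s, z) : ℝ) - g (s, z)) ∂ν)
      * inner ℝ (ι (v i)) (us n s - u s) ∂leb T| ≤ e / (2 * (k + 1)) := by
    intro i
    obtain ⟨y, hy, hyM, hyeq⟩ := hM i _ _ _ (hgs n) (hus n)
    obtain ⟨y', hy', hyM', hyeq'⟩ := hM i _ _ _ hg hu
    have h1 : ∀ s, (inner ℝ (ι (v i)) (us n s - u s) : ℝ)
        = ∫ r in Iic s, (y r - y' r) ∂leb T := fun s => by
      rw [real_inner_comm, inner_sub_left, hyeq, hyeq',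
        integral_sub hy.integrableOn hy'.integrableOn]
      ring
    simp only [h1]
    have hMi := hM0 i
    refine (abs_setIntegral_mul_le (hρi i) (hy.sub hy') (hn i) t).trans ?_
    have h2 : ∫ r, |(y - y') r| ∂leb T ≤ M i + M i := by
      calc ∫ r, |(y - y') r| ∂leb T ≤ ∫ r, (|y r| + |y' r|) ∂leb T :=
            integral_mono (hy.sub hy').abs (hy.abs.add hy'.abs) fun r => abs_sub _ _
        _ ≤ M i + M i := by
            rw [integral_add hy.abs hy'.abs]
            exact add_le_add hyM hyM'
    calc 2 * (e / (8 * (k + 1) * (M i + 1))) * ∫ r, |(y - y') r| ∂leb T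
        ≤ 2 * (e / (8 * (k + 1) * (M i + 1))) * (M i + M i) := by gcongr
      _ = e / (2 * (k + 1)) * (M i / (M i + 1)) := by field_simp; ring
      _ ≤ e / (2 * (k + 1)) := mul_le_of_le_one_right (by positivity)
          (div_le_one_of_le₀ (by linarith) (by linarith))
  rw [hsplit]
  refine (abs_add_le _ _).trans ?_
  have b3 : |∑ i, ∫ s in Iic t, (∫ z, φ i (s, z) * ((gs n (s, z) : ℝ) - g (s, z)) ∂ν)
      * inner ℝ (ι (v i)) (us n s - u s) ∂leb T| ≤ e / 2 := by
    calc _ ≤ ∑ i : Fin k, e / (2 * (k + 1)) :=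
          (Finset.abs_sum_le_sum_abs _ _).trans (Finset.sum_le_sum fun i _ => b2 i)
      _ = e / 2 * (k / (k + 1)) := by
          rw [Finset.sum_const, Finset.card_univ, Fintype.card_fin, nsmul_eq_mul]; field_simp
      _ ≤ e / 2 := mul_le_of_le_one_right (by positivity)
          (div_le_one_of_le₀ (by linarith) (by positivity))
  linarith

/-- Uniform convergence of the solutions under convergence of the controls. The mass of the weight in
`SolutionPair.norm_sub_sq_le` depends on `gs n` through its entropy only, so that the constant in
Gronwall's inequality is uniform in `n`. -/
theorem SkeletonData.eventually_norm_sub_le (hT : 0 < T) (hι : DenseRange ι)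
    (hS : SkeletonData ι A f ν α β θ C K F L G) {d : ℕ → V} {Q : ℕ → H →L[ℝ] V}
    (hQ : FiniteRankApprox ι d Q) (hN : 0 ≤ N)
    (hgs : ∀ n, EntropyLe (gs n) (nuT T ν) N) (hg : EntropyLe g (nuT T ν) N)
    (hc : ControlTendsto ν gs g) (hus : ∀ n, SolutionPair ι A f ν α x (gs n) (us n) (ws n))
    (hu : SolutionPair ι A f ν α x g u w) {e : ℝ} (he : 0 < e) :
    ∀ᶠ n in atTop, ∀ t : Time T, ‖us n t - u t‖ ≤ e := by
  obtain ⟨R, hR0, hR⟩ := exists_norm_le_continuousMap hT.le u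
  have hwR : ∀ᵐ s ∂leb T, ‖ι (w s)‖ ≤ R := hu.ae_eq.mono fun s hs => hs ▸ hR s
  obtain ⟨b, hE, -⟩ := hS.exists_evolutionData hg
  set κ₀ : Time T → ℝ := fun s => K s + C * (1 + ‖w s‖ ^ α) * (1 + ‖ι (w s)‖ ^ β) with hκ₀
  have hκ₀i : Integrable κ₀ (leb T) := by
    refine ((hS.integrable_diffWeight hg hu.meas hu.memLp hwR).sub
      ((hS.G_exp.integrable_controlNorm hg).const_mul 2)).congr (Eventually.of_forall fun s => ?_)
    simp only [Pi.sub_apply, diffWeight, hκ₀]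
    ring
  set c : ℝ := max 0 (∫ s, κ₀ s ∂leb T + 2 * controlBound ν G N) with hc'
  have hc0 : 0 ≤ c := le_max_left _ _
  have hΓ := gronwallConst_nonneg hc0
  set a : ℝ := e ^ 2 / (gronwallConst c + 1) with ha
  have ha0 : 0 < a := by positivity
  filter_upwards [hS.eventually_inner_driftDiff_le hT hι hQ hN hgs hg hc hus hu (half_pos ha0)]
    with n hn t
  obtain ⟨R', hR'0, hR'⟩ := exists_norm_le_continuousMap hT.le (us n)
  have h1 := gronwall hT.le (hS.integrable_diffWeight (hgs n) hu.meas hu.memLp hwR)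
    (fun s => hS.diffWeight_nonneg s) (c := c) (f := fun t => ‖us n t - u t‖ ^ 2)
    (g := fun t => ‖us n t - u t‖ ^ 2) (M := (R' + R) ^ 2) (a := a) (by
      have h2 : ∫ s, diffWeight ι ν α β C K G (gs n) w s ∂leb T
          = ∫ s, κ₀ s ∂leb T + 2 * ∫ s, controlNorm ν G (gs n) s ∂leb T := by
        rw [← integral_const_mul, ← integral_add hκ₀i
          ((hS.G_exp.integrable_controlNorm (hgs n)).const_mul 2)]
        rfl
      rw [h2]
      refine le_max_of_le_right ?_
      have := hS.G_exp.integral_controlNorm_le (hgs n)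
      linarith) ha0.le
    (fun t => by
      have := (norm_sub_le (us n t) (u t)).trans (add_le_add (hR' t) (hR t))
      gcongr) (fun s => ⟨s, le_rfl, le_rfl⟩) (fun t => by
      have h2 := (hus n).norm_sub_sq_le hT hι hS (hgs n) hg hu t
      have h3 := (le_abs_self _).trans (hn t)
      linarith) t
  have h2 : gronwallConst c * a ≤ e ^ 2 := by
    calc gronwallConst c * a = e ^ 2 * (gronwallConst c / (gronwallConst c + 1)) := by
          rw [ha]; field_simp
      _ ≤ e ^ 2 := mul_le_of_le_one_right (by positivity)
          (div_le_one_of_le₀ (by linarith) (by linarith))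
  exact (abs_le_of_sq_le_sq' (h1.trans h2) he.le).2

end

/-! ### Controls in `S^N` and the vague topology -/

section

variable {T : ℝ} {X : Type*} [MeasurableSpace X] {ν : Measure X}

theorem S.entropyLe {N : ℕ} (g : S T ν N) : EntropyLe g.1 (nuT T ν) N := by
  have h0 : ∀ q, 0 ≤ entropyFun (g.1 q) := fun q => entropyFun_nonneg (g.1 q).coe_nonneg
  have hm : Measurable fun q => entropyFun (g.1 q) := by
    have := g.2.1.coe_nnreal_real
    unfold entropyFun
    exact ((this.mul (Real.measurable_log.comp this)).sub this).add_const 1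
  have hle : ∫⁻ q, ENNReal.ofReal (entropyFun (g.1 q)) ∂nuT T ν ≤ N := g.2.2
  refine ⟨g.2.1, ⟨hm.aestronglyMeasurable, ?_⟩, ?_⟩
  · rw [hasFiniteIntegral_iff_ofReal (Eventually.of_forall h0)]
    exact hle.trans_lt (ENNReal.natCast_lt_top N)
  · rw [integral_eq_lintegral_of_nonneg_ae (Eventually.of_forall h0) hm.aestronglyMeasurable]
    exact ENNReal.toReal_le_of_le_ofReal N.cast_nonneg (by simpa using hle)

variable [TopologicalSpace X] [PolishSpace X] [LocallyCompactSpace X] [BorelSpace X]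
  [IsFiniteMeasureOnCompacts ν]

instance : IsFiniteMeasureOnCompacts (nuT T ν) :=
  inferInstanceAs (IsFiniteMeasureOnCompacts ((leb T).prod ν))

theorem ExpIntegrable.of_hasCompactSupport {φ : Time T × X → ℝ} (hφ : Continuous φ)
    (hc : HasCompactSupport φ) : ExpIntegrable φ (nuT T ν) :=
  ⟨hφ.aestronglyMeasurable, fun σ _ =>
    (continuous_expGauge.comp (hφ.const_mul σ)).integrable_of_hasCompactSupport
      (hc.comp_left (g := fun y => expGauge (σ * y)) (by simp [expGauge_zero]))⟩

theorem S.integral_toMFC {N : ℕ} (g : S T ν N) (φ : Time T × X → ℝ) :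
    ∫ q, φ q ∂(g.toMFC ν).1 = ∫ q, φ q * g.1 q ∂nuT T ν := by
  refine (integral_withDensity_eq_integral_smul g.2.1 φ).trans ?_
  simp only [NNReal.smul_def, smul_eq_mul, mul_comm]

/-- Vague convergence of the measures `ν_T^{g_n}` with bounded entropy implies convergence of the
densities against exponentially integrable functions. -/
theorem S.controlTendsto {N : ℕ} {gs : ℕ → S T ν N} {g : S T ν N}
    (h : Tendsto gs atTop (𝓝 g)) : ControlTendsto ν (fun n => (gs n).1) g.1 := by
  intro φ hφ
  refine tendsto_integral_mul_sub (N := N) N.cast_nonneg (fun n => (gs n).entropyLe) g.entropyLe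
    (fun ψ hψ hc => ?_) hφ
  have hψE : ExpIntegrable ψ (nuT T ν) := .of_hasCompactSupport hψ hc
  have hcont : Continuous fun m : MFC (Time T × X) => ∫ q, ψ q ∂m.1 :=
    continuous_iInf_dom (i := (⟨⟨ψ, hψ⟩, hc⟩ : C_c(Time T × X, ℝ))) continuous_induced_dom
  have h1 := ((hcont.comp continuous_induced_dom).tendsto g).comp h
  have h2 := h1.sub_const (∫ q, ψ q ∂(g.toMFC ν).1)
  rw [show (((fun m : MFC (Time T × X) => ∫ q, ψ q ∂m.1) ∘ S.toMFC ν) g)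
    - ∫ q, ψ q ∂(g.toMFC ν).1 = 0 from sub_self _] at h2
  have hi : ∀ k : S T ν N, Integrable (fun q => ψ q * k.1 q) (nuT T ν) := fun k =>
    ((k.entropyLe.integrable_mul hψE).1.add
      (hψ.integrable_of_hasCompactSupport hc)).congr (Eventually.of_forall fun q => by
        simp only [Pi.add_apply]; ring)
  refine h2.congr fun n => ?_
  simp only [Function.comp_apply, S.integral_toMFC]
  rw [← integral_sub (hi _) (hi _)]
  simp only [mul_sub]

/-- The tilted measure determines the density almost everywhere, as `ν_T` is σ-finite. -/
theorem S.ae_eq_of_toMFC_eq {N N' : ℕ} {g : S T ν N} {g' : S T ν N'}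
    (h : g.toMFC ν = g'.toMFC ν) : g.1 =ᵐ[nuT T ν] g'.1 := by
  have h1 : tilt ν g.1 = tilt ν g'.1 := congrArg Subtype.val h
  rw [tilt, tilt, withDensity_eq_iff_of_sigmaFinite g.2.1.coe_nnreal_ennreal.aemeasurable
    g'.2.1.coe_nnreal_ennreal.aemeasurable] at h1
  filter_upwards [h1] with q hq
  exact_mod_cast hq

end

/-! ### The solution map -/

section

variable {T : ℝ} {V : Type*} [NormedAddCommGroup V] [NormedSpace ℝ V] [MeasurableSpace V]
  {H : Type*} [NormedAddCommGroup H] [InnerProductSpace ℝ H] [MeasurableSpace H]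
  {X : Type*} [MeasurableSpace X] {ν : Measure X}
  {ι : V →L[ℝ] H} {A : Time T → V → StrongDual ℝ V} {f : Time T → V → X → H}
  {α β θ C : ℝ} {K F : Time T → ℝ} {L G : Time T × X → ℝ} {x : H}

/-- Of the integrability conditions on `L_f` only `L²` and an exponential moment of some order `p ≥ 2`
are needed; here `p ≥ Υ ≥ 4`. -/
theorem JumpGrowth.exists_expIntegrable (h : JumpGrowth ι f ν α β) :
    ∃ L, ExpIntegrable L (nuT T ν) ∧ ∀ t v z, ‖f t v z‖ ≤ |L (t, z)| * (1 + ‖ι v‖) := by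
  obtain ⟨η₀, p, L, -, hp, h2, -, -, -, -, ⟨-, h0, δ, hδ, hexp⟩, hf⟩ := h
  have h4 : (4 : ℝ) ≤ upsilon α β η₀ := le_max_of_le_left (le_max_right _ _)
  refine ⟨L, expIntegrable_of_memLp h0 h2 (by linarith) hδ hexp, fun t v z => ?_⟩
  exact (hf t v z).trans (mul_le_mul_of_nonneg_right (le_abs_self _) (by positivity))

theorem JumpLipschitz.exists_expIntegrable (h : JumpLipschitz ι f ν) :
    ∃ G, ExpIntegrable G (nuT T ν) ∧
      ∀ t v₁ v₂ z, ‖f t v₁ z - f t v₂ z‖ ≤ |G (t, z)| * ‖ι (v₁ - v₂)‖ := by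
  obtain ⟨G, h2, ⟨-, h0, δ, hδ, hexp⟩, hf⟩ := h
  refine ⟨G, expIntegrable_of_memLp h0 h2 le_rfl hδ hexp, fun t v₁ v₂ z => ?_⟩
  exact (hf t v₁ v₂ z).trans (mul_le_mul_of_nonneg_right (le_abs_self _) (norm_nonneg _))

variable [CompleteSpace V] [TopologicalSpace.SeparableSpace V] [BorelSpace V]
  [CompleteSpace H] [TopologicalSpace.SeparableSpace H] [BorelSpace H]
  [TopologicalSpace X] [PolishSpace X] [LocallyCompactSpace X] [BorelSpace X]
  [IsFiniteMeasureOnCompacts ν]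

/-- The solution chosen in the definition of `G0` belongs to some control with the same tilted measure.
That control agrees with `g` almost everywhere, so the solution is also one for `g`. -/
theorem SkeletonData.isSkeletonSolution_G0 (hT : 0 < T) (hV : IsReflexive V)
    (hι : Function.Injective ι) (hι' : DenseRange ι)
    (hS : SkeletonData ι A f ν α β θ C K F L G) {N : ℕ} (g : S T ν N) :
    IsSkeletonSolution ι A f ν α x g.1 (G0 ι A f ν α x (g.toMFC ν)) := by
  classical
  have := secondCountable_dual hV hι
  have : SecondCountableTopology H := UniformSpace.secondCountable_of_separable H
  obtain ⟨u, hu⟩ := hS.exists_solution hT hV hι hι' g.entropyLe x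
  have h : ∃ u : C(Time T, H), ∃ (N' : ℕ) (g' : S T ν N'),
      g'.toMFC ν = g.toMFC ν ∧ IsSkeletonSolution ι A f ν α x g'.1 u := ⟨u, N, g, rfl, hu⟩
  have h1 := h.choose_spec
  rw [G0, dif_pos h]
  obtain ⟨N', g', hg', hu'⟩ := h1
  obtain ⟨w, hw⟩ := hu'.exists_pair (S.ae_eq_of_toMFC_eq hg')
  exact hw.isSkeletonSolution

theorem SkeletonData.isSkeletonSolution_unique (hT : 0 < T) (hV : IsReflexive V)
    (hι : Function.Injective ι) (hι' : DenseRange ι)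
    (hS : SkeletonData ι A f ν α β θ C K F L G) {N : ℕ} (g : S T ν N) {u u' : C(Time T, H)}
    (h : IsSkeletonSolution ι A f ν α x g.1 u) (h' : IsSkeletonSolution ι A f ν α x g.1 u') :
    u = u' := by
  have := secondCountable_dual hV hι
  have : SecondCountableTopology H := UniformSpace.secondCountable_of_separable H
  obtain ⟨w, hw⟩ := h.exists_pair EventuallyEq.rfl
  obtain ⟨w', hw'⟩ := h'.exists_pair EventuallyEq.rfl
  exact hw.unique hT hι' hS g.entropyLe hw'

theorem SkeletonData.tendsto_G0 (hT : 0 < T) (hV : IsReflexive V)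
    (hι : Function.Injective ι) (hι' : DenseRange ι)
    (hS : SkeletonData ι A f ν α β θ C K F L G) {N : ℕ} {g : S T ν N} {gs : ℕ → S T ν N}
    (h : Tendsto gs atTop (𝓝 g)) :
    Tendsto (fun n => ⨆ t : Time T,
      ‖G0 ι A f ν α x ((gs n).toMFC ν) t - G0 ι A f ν α x (g.toMFC ν) t‖) atTop (𝓝 0) := by
  have := secondCountable_dual hV hι
  have : SecondCountableTopology H := UniformSpace.secondCountable_of_separable H
  have hsol : ∀ k : S T ν N, ∃ w, SolutionPair ι A f ν α x k.1 (G0 ι A f ν α x (k.toMFC ν)) w :=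
    fun k => (hS.isSkeletonSolution_G0 hT hV hι hι' k).exists_pair EventuallyEq.rfl
  choose w hw using hsol
  obtain ⟨d, Q, hQ⟩ := exists_finiteRankApprox (ι := ι) hι
  rw [tendsto_order]
  refine ⟨fun a ha => Eventually.of_forall fun n =>
    ha.trans_le (Real.iSup_nonneg fun t => norm_nonneg _), fun a ha => ?_⟩
  filter_upwards [hS.eventually_norm_sub_le hT hι' hQ N.cast_nonneg (fun n => (gs n).entropyLe)
    g.entropyLe (S.controlTendsto h) (fun n => hw (gs n)) (hw g) (half_pos ha)] with n hn
  exact (Real.iSup_le hn (half_pos ha).le).trans_lt (half_lt_self ha)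

end

end

end Skeleton

end

theorem theorem6p2
    {V : Type*} [NormedAddCommGroup V] [NormedSpace ℝ V] [CompleteSpace V]
    [TopologicalSpace.SeparableSpace V] [MeasurableSpace V] [BorelSpace V]
    (hV : IsReflexive V)
    {H : Type*} [NormedAddCommGroup H] [InnerProductSpace ℝ H] [CompleteSpace H]
    [TopologicalSpace.SeparableSpace H] [MeasurableSpace H] [BorelSpace H]
    (ι : V →L[ℝ] H) (hι : Function.Injective ι) (hι' : DenseRange ι)
    {X : Type*} [TopologicalSpace X] [PolishSpace X] [LocallyCompactSpace X]
    [MeasurableSpace X] [BorelSpace X]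
    (ν : Measure X) [IsFiniteMeasureOnCompacts ν]
    (T : ℝ) (hT : 0 < T)
    (A : Time T → V → StrongDual ℝ V)
    (hA : Measurable fun p : Time T × V => A p.1 p.2)
    (f : Time T → V → X → H)
    (hf : Measurable fun p : Time T × V × X => f p.1 p.2.1 p.2.2)
    (x : H)
    (α β θ C : ℝ) (hα : 1 < α) (hβ : 0 ≤ β) (hθ : 0 < θ) (hC : 0 < C)
    (K F : Time T → ℝ) (hK : ∀ t, 0 ≤ K t) (hF : ∀ t, 0 ≤ F t)
    (hKint : Integrable K (leb T)) (hFint : Integrable F (leb T))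
    (ρ : V → ℝ) (hρ : Measurable ρ) (hρ0 : ∀ v, 0 ≤ ρ v)
    (hρbdd : ∀ R : ℝ, ∃ M : ℝ, ∀ v, ‖v‖ ≤ R → ρ v ≤ M)
    (hρgrowth : ∀ v, ρ v ≤ C * (1 + ‖v‖ ^ α) * (1 + ‖ι v‖ ^ β))
    (H1 : Hemicontinuity A)
    (H2 : LocalMonotonicity ι A f ν K ρ)
    (H3 : Coercivity ι A α θ F)
    (H4 : Growth ι A α β C F)
    (H5 : JumpGrowth ι f ν α β)
    (H6 : JumpLipschitz ι f ν) :
    (∀ (N : ℕ) (g : S T ν N),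
      IsSkeletonSolution ι A f ν α x g.1 (G0 ι A f ν α x (g.toMFC ν)) ∧
      ∀ u : C(Time T, H), IsSkeletonSolution ι A f ν α x g.1 u →
        u = G0 ι A f ν α x (g.toMFC ν)) ∧
    (∀ (N : ℕ) (g : S T ν N) (gs : ℕ → S T ν N), Tendsto gs atTop (𝓝 g) →
      Tendsto (fun n => ⨆ t : Time T,
          ‖G0 ι A f ν α x ((gs n).toMFC ν) t - G0 ι A f ν α x (g.toMFC ν) t‖)
        atTop (𝓝 0)) := by
  obtain ⟨L, hL, hfL⟩ := H5.exists_expIntegrable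
  obtain ⟨G, hG, hfG⟩ := H6.exists_expIntegrable
  have hS : SkeletonData ι A f ν α β θ C K F L G :=
    { one_lt := hα
      beta_nonneg := hβ
      theta_pos := hθ
      C_nonneg := hC.le
      measurable_A := hA
      measurable_f := hf
      K_nonneg := hK
      F_nonneg := hF
      K_int := hKint
      F_int := hFint
      hemi := H1
      mono := fun t v₁ v₂ => by
        have h0 : 0 ≤ ∫ z, ‖f t v₁ z - f t v₂ z‖ ^ 2 ∂ν := integral_nonneg fun z => sq_nonneg _
        have h1 := (H2 t v₁ v₂).2
        have h2 := mul_le_mul_of_nonneg_right (add_le_add_right (hρgrowth v₂) (K t))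
          (sq_nonneg ‖ι (v₁ - v₂)‖)
        linarith
      coer := H3
      growth := H4
      L_exp := hL
      G_exp := hG
      f_le := hfL
      f_lip := hfG }
  exact ⟨fun N g => ⟨hS.isSkeletonSolution_G0 hT hV hι hι' g, fun u hu =>
    hS.isSkeletonSolution_unique hT hV hι hι' g hu (hS.isSkeletonSolution_G0 hT hV hι hι' g)⟩,
    fun N g gs h => hS.tendsto_G0 hT hV hι hι' h⟩
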